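/- \textbf{Definitions.} A \emph{stacked tiling} of a complete metric space $(H,d_H)$ homeomorphic to $\mathbb R^k$ consists of a group $\Gamma$ of isometries of $H$ that is discrete and acts properly, a nonempty compact connected set $K\subset H$ that is the closure of its interior, and a surjective map $\alpha:H\to H$ with $d_H(\alpha x,\alpha y)=a\,d_H(x,y)$ for some $a>1$, such that: $H=\bigcup_{\gamma\in\Gamma}\gamma K$; the interiors of $K$ and $\gamma K$ are disjoint for every $\gamma\in\Gamma\setminus\{1\}$; $\alpha\gamma\alpha^{-1}\in\Gamma$ for all $\gamma\in\Gamma$; and $\alpha K=\bigcup_{\gamma\in\Gamma'}\gamma K$ for some finite $\Gamma'\subset\Gamma$. If moreover $H^+=H\times\mathbb R^+$ carries a smooth structure compatible with the product topology and a distance $d_{H^+}$ induced by a smooth Riemannian metric, such that $(x,t)\mapsto(\gamma x,t)$ (for $\gamma\in\Gamma$) and $(x,t)\mapsto(\alpha x,at)$ preserve $d_{H^+}$, then $H^+$ is a $(k+1)$-dimensional \emph{metric similarity space} with base $H$. Let $n\ge 2$. The Heisenberg group $\mathrm{Heis}^{n-1}$ is $\mathbb C^{n-1}\times\mathbb R$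 with group law $(\zeta,u)(\zeta',u')=(\zeta+\zeta',\,u+u'+2\,\mathrm{Im}\langle\zeta,\zeta'\rangle)$, where $\langle\zeta,\zeta'\rangle=\sum_i\zeta_i\overline{\zeta_i'}$, and dilations $\delta_s(\zeta,u)=(s\zeta,s^2u)$. Given a real inner product on $\mathbb C^{n-1}$ (for instance the standard one), let $d_{CC}$ be the Carnot--Carath\'eodory distance on $\mathrm{Heis}^{n-1}$: the infimum of the lengths of the absolutely continuous paths whose velocity lies, at almost every time, in the left-invariant distribution equal to $\mathbb C^{n-1}\times\{0\}$ at the identity, lengths being measured by the left-invariant inner product that extends the given one. Let $J(z,w)=z_0\overline{w_1}+z_1\overline{w_0}+\sum_{j=2}^n z_j\overline{w_j}$ on $\mathbb C^{n+1}$. Complex hyperbolic space is $\mathbb H^n_{\mathbb C}=\{[z]\in\mathbb{CP}^n: J(z,z)<0\}$ with the distance $d\geq 0$ given by $\cosh^2 d([z],[w])=\dfrac{J(z,w)J(w,z)}{J(z,z)J(w,w)}$. \textbf{Proposition.} For every $n\ge2$ and every real inner product on $\mathbb C^{n-1}$, $d_{CC}$ is a (finite) metric on $\mathrm{Heis}^{n-1}$.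 The map \[\mathrm{Heis}^{n-1}\times\mathbb R^+\to\mathbb H^n_{\mathbb C},\qquad (\zeta,u,t)\mapsto[\,1:-t^2-|\zeta|^2+iu:\sqrt2\,\zeta\,]\] is a bijection. With the pulled-back distance, $\mathrm{Heis}^{n-1}\times\mathbb R^+$ is a $2n$-dimensional metric similarity space with base $(\mathrm{Heis}^{n-1},d_{CC})$, for its standard smooth structure (the one in which $(\zeta,u,t)$ is a global smooth chart). Here $\Gamma$ is the group of left translations by the elements of $\mathrm{Heis}^{n-1}$ all of whose real coordinates are integers, $\alpha=\delta_2$, $a=2$, and $K$ is a suitable tile. In particular the topology of $d_{CC}$ is the Euclidean one. -/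

import Mathlib

open Set MeasureTheory Manifold
open scoped ENNReal ContDiff ComplexConjugate Bundle

/-! ### Stacked tilings and metric similarity spaces -/

/-- A stacked tiling of the `k`-dimensional metric space `H`: a group `Γ` of isometries of `H`
(that is, a group acting faithfully by isometries), a tile `K`, and a homothety `α` of factor `a`.
The field `proper` says that `Γ`, as a discrete group, acts properly; in particular `Γ` is discrete
in the isometry group. -/
structure IsStackedTiling (k : ℕ) {H : Type*} [MetricSpace H] (Γ : Type*) [Group Γ]
    [MulAction Γ H] (α : H → H) (a : ℝ) (K : Set H) : Prop where
  complete : CompleteSpace H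
  homeomorphic : Nonempty (H ≃ₜ EuclideanSpace ℝ (Fin k))
  faithful : ∀ γ : Γ, (∀ x : H, γ • x = x) → γ = 1
  isometric : ∀ (γ : Γ) (x y : H), dist (γ • x) (γ • y) = dist x y
  proper : ∀ C : Set H, IsCompact C →
    {γ : Γ | (((fun x : H => γ • x) '' C) ∩ C).Nonempty}.Finite
  tile_compact : IsCompact K
  tile_connected : IsConnected K
  tile_domain : closure (interior K) = K
  cover : (⋃ γ : Γ, (fun x : H => γ • x) '' K) = univ
  disjoint_interiors : ∀ γ : Γ, γ ≠ 1 →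
    Disjoint (interior K) (interior ((fun x : H => γ • x) '' K))
  one_lt_factor : 1 < a
  surjective : Function.Surjective α
  homothety : ∀ x y : H, dist (α x) (α y) = a * dist x y
  conjugation : ∀ γ : Γ, ∃ γ' : Γ, ∀ x : H, α (γ • x) = γ' • α x
  finite_subdivision : ∃ F : Set Γ, F.Finite ∧ α '' K = ⋃ γ ∈ F, (fun x : H => γ • x) '' K

/-- The positive half-line `ℝ⁺`. -/
abbrev PosReal : Type := Ioi (0 : ℝ)

/-- Multiplication by a positive number on `ℝ⁺`. -/
def PosReal.scale (a : ℝ) (ha : 0 < a) (t : PosReal) : PosReal := ⟨a * t, mul_pos ha t.2⟩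

/-- `d` is the distance of a smooth Riemannian metric on the smooth manifold `M`: the infimum of
the lengths of `C¹` paths, which is required to be finite. -/
def IsRiemannianDistance {E : Type*} [NormedAddCommGroup E] [NormedSpace ℝ E] {M : Type*}
    [TopologicalSpace M] [ChartedSpace E M] [IsManifold 𝓘(ℝ, E) ∞ M] (d : M → M → ℝ) : Prop :=
  ∃ g : Bundle.ContMDiffRiemannianMetric 𝓘(ℝ, E) ∞ E (fun x : M => TangentSpace 𝓘(ℝ, E) x),
    letI : Bundle.RiemannianBundle (fun x : M => TangentSpace 𝓘(ℝ, E) x) :=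
      ⟨g.toRiemannianMetric⟩
    ∀ p q : M, 0 ≤ d p q ∧ Manifold.riemannianEDist 𝓘(ℝ, E) p q = ENNReal.ofReal (d p q)

/-- `H × ℝ⁺` with its smooth structure (modelled on `E`, and compatible with the product topology)
and the distance `d` is a `(k + 1)`-dimensional metric similarity space with base `H`, for the
stacked tiling of `H` given by `Γ`, `α`, `a` and `K`. -/
structure IsMetricSimilaritySpace (k : ℕ) {H : Type*} [MetricSpace H] (Γ : Type*) [Group Γ]
    [MulAction Γ H] (α : H → H) (a : ℝ) (K : Set H)
    {E : Type*} [NormedAddCommGroup E] [NormedSpace ℝ E] [ChartedSpace E (H × PosReal)]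
    [IsManifold 𝓘(ℝ, E) ∞ (H × PosReal)] (d : H × PosReal → H × PosReal → ℝ) : Prop where
  tiling : IsStackedTiling k Γ α a K
  dimension : Module.finrank ℝ E = k + 1
  riemannian : IsRiemannianDistance (E := E) d
  isometric : ∀ (γ : Γ) (p q : H × PosReal), d (γ • p.1, p.2) (γ • q.1, q.2) = d p q
  homothety : ∀ (ha : 0 < a) (p q : H × PosReal),
    d (α p.1, PosReal.scale a ha p.2) (α q.1, PosReal.scale a ha q.2) = d p q

/-! ### The Heisenberg group and its Carnot–Carathéodory metric -/

/-- The Heisenberg group modelled on `ℂᵐ × ℝ`. -/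
@[ext] structure Heis (m : ℕ) where
  ζ : EuclideanSpace ℂ (Fin m)
  u : ℝ

namespace Heis

variable {m : ℕ}

/-- The standard Hermitian pairing `⟨ζ, ζ'⟩ = ∑ ζᵢ ζ'ᵢ*`, linear in the first variable. -/
noncomputable def herm (z w : EuclideanSpace ℂ (Fin m)) : ℂ := ∑ i, z i * conj (w i)

lemma herm_add_left (x y w : EuclideanSpace ℂ (Fin m)) : herm (x + y) w = herm x w + herm y w := by
  simp [herm, add_mul, Finset.sum_add_distrib]

lemma herm_add_right (w x y : EuclideanSpace ℂ (Fin m)) :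
    herm w (x + y) = herm w x + herm w y := by
  simp [herm, mul_add, Finset.sum_add_distrib]

lemma herm_self_im (x : EuclideanSpace ℂ (Fin m)) : (herm x x).im = 0 := by
  simp [herm, Complex.mul_conj]

lemma herm_neg_left (x y : EuclideanSpace ℂ (Fin m)) : herm (-x) y = -herm x y := by
  simp [herm]

/-- The group law `(ζ, u) (ζ', u') = (ζ + ζ', u + u' + 2 Im ⟨ζ, ζ'⟩)`. -/
noncomputable instance : Group (Heis m) where
  mul g h := ⟨g.ζ + h.ζ, g.u + h.u + 2 * (herm g.ζ h.ζ).im⟩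
  one := ⟨0, 0⟩
  inv g := ⟨-g.ζ, -g.u⟩
  mul_assoc g h l := by
    change (⟨_, _⟩ : Heis m) = ⟨_, _⟩
    ext1
    · exact add_assoc _ _ _
    · change g.u + h.u + 2 * (herm g.ζ h.ζ).im + l.u + 2 * (herm (g.ζ + h.ζ) l.ζ).im
        = g.u + (h.u + l.u + 2 * (herm h.ζ l.ζ).im) + 2 * (herm g.ζ (h.ζ + l.ζ)).im
      rw [herm_add_left, herm_add_right, Complex.add_im, Complex.add_im]
      ring
  one_mul g := by
    change (⟨_, _⟩ : Heis m) = g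
    ext1
    · exact zero_add _
    · change 0 + g.u + 2 * (herm 0 g.ζ).im = g.u
      simp [herm]
  mul_one g := by
    change (⟨_, _⟩ : Heis m) = g
    ext1
    · exact add_zero _
    · change g.u + 0 + 2 * (herm g.ζ 0).im = g.u
      simp [herm]
  inv_mul_cancel g := by
    change (⟨_, _⟩ : Heis m) = ⟨0, 0⟩
    ext1
    · exact neg_add_cancel _
    · change -g.u + g.u + 2 * (herm (-g.ζ) g.ζ).im = 0
      simp [herm_neg_left, herm_self_im]

lemma mul_ζ (g h : Heis m) : (g * h).ζ = g.ζ + h.ζ := rfl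
lemma mul_u (g h : Heis m) : (g * h).u = g.u + h.u + 2 * (herm g.ζ h.ζ).im := rfl
lemma one_ζ : (1 : Heis m).ζ = 0 := rfl
lemma one_u : (1 : Heis m).u = 0 := rfl
lemma inv_ζ (g : Heis m) : (g⁻¹).ζ = -g.ζ := rfl
lemma inv_u (g : Heis m) : (g⁻¹).u = -g.u := rfl

/-- The anisotropic dilation `δ_s (ζ, u) = (s ζ, s² u)`. -/
noncomputable def dilation (s : ℝ) (g : Heis m) : Heis m := ⟨s • g.ζ, s ^ 2 * g.u⟩

/-- `z` has coordinates in `ℤ[i]`. -/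
def IsIntegral (z : EuclideanSpace ℂ (Fin m)) : Prop :=
  ∀ i, ∃ a b : ℤ, z i = a + b * Complex.I

lemma IsIntegral.herm_im {z w : EuclideanSpace ℂ (Fin m)} (hz : IsIntegral z)
    (hw : IsIntegral w) : ∃ c : ℤ, (herm z w).im = c := by
  choose a b hab using hz
  choose a' b' hab' using hw
  refine ⟨∑ i, (b i * a' i - a i * b' i), ?_⟩
  simp only [herm, Complex.im_sum, Int.cast_sum]
  refine Finset.sum_congr rfl fun i _ => ?_
  rw [hab, hab']
  simp
  ring

/-- The subgroup of elements all of whose real coordinates are integers. -/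
noncomputable def integerLattice (m : ℕ) : Subgroup (Heis m) where
  carrier := {g | IsIntegral g.ζ ∧ ∃ c : ℤ, g.u = c}
  mul_mem' := by
    rintro g h ⟨hg, c, hc⟩ ⟨hh, d, hd⟩
    obtain ⟨e, he⟩ := hg.herm_im hh
    refine ⟨fun i => ?_, c + d + 2 * e, ?_⟩
    · obtain ⟨a, b, hab⟩ := hg i
      obtain ⟨a', b', hab'⟩ := hh i
      refine ⟨a + a', b + b', ?_⟩
      rw [mul_ζ, PiLp.add_apply, hab, hab']
      push_cast
      ring
    · rw [mul_u, hc, hd, he]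
      push_cast
      ring
  one_mem' := ⟨fun i => ⟨0, 0, by simp [one_ζ]⟩, 0, by simp [one_u]⟩
  inv_mem' := by
    rintro g ⟨hg, c, hc⟩
    refine ⟨fun i => ?_, -c, by simp [inv_u, hc]⟩
    obtain ⟨a, b, hab⟩ := hg i
    refine ⟨-a, -b, ?_⟩
    rw [inv_ζ, PiLp.neg_apply, hab]
    push_cast
    ring

/-- The global coordinates `(ζ, u)`. -/
def coords (g : Heis m) : EuclideanSpace ℂ (Fin m) × ℝ := (g.ζ, g.u)

/-- The value at `g` of the left-invariant vector field that is `(w, 0)` at the identity, in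
coordinates. These vectors, for `w ∈ ℂᵐ`, form the left-invariant distribution `𝓓` at `g`. -/
noncomputable def leftInvariantVector (g : Heis m) (w : EuclideanSpace ℂ (Fin m)) :
    EuclideanSpace ℂ (Fin m) × ℝ :=
  deriv (fun s : ℝ => coords (g * ⟨s • w, 0⟩)) 0

lemma leftInvariantVector_eq (g : Heis m) (w : EuclideanSpace ℂ (Fin m)) :
    leftInvariantVector g w = (w, 2 * (herm g.ζ w).im) := by
  have key : ∀ s : ℝ, coords (g * ⟨s • w, 0⟩)
      = (g.ζ + s • w, g.u + s * (2 * (herm g.ζ w).im)) := by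
    intro s
    have : (herm g.ζ (s • w)).im = s * (herm g.ζ w).im := by
      simp only [herm, Complex.im_sum, Finset.mul_sum]
      refine Finset.sum_congr rfl fun i _ => ?_
      simp
      ring
    simp only [coords, mul_ζ, mul_u, this]
    congr 1
    ring
  unfold leftInvariantVector
  simp only [key]
  have h1 : HasDerivAt (fun s : ℝ => g.ζ + s • w) w 0 := by
    simpa using ((hasDerivAt_id (0 : ℝ)).smul_const w).const_add g.ζ
  have h2 : HasDerivAt (fun s : ℝ => g.u + s * (2 * (herm g.ζ w).im))
      (2 * (herm g.ζ w).im) 0 := by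
    simpa using ((hasDerivAt_id (0 : ℝ)).mul_const (2 * (herm g.ζ w).im)).const_add g.u
  exact (h1.prodMk h2).deriv

/-- `γ : [0, 1] → Heis m` is a horizontal path from `x` to `y`: it is absolutely continuous, and
its velocity lies in the distribution `𝓓` at almost every time. -/
structure IsHorizontalPath (γ : ℝ → Heis m) (x y : Heis m) : Prop where
  source : γ 0 = x
  target : γ 1 = y
  absolutelyContinuous_ζ : AbsolutelyContinuousOnInterval (fun t => (γ t).ζ) 0 1
  absolutelyContinuous_u : AbsolutelyContinuousOnInterval (fun t => (γ t).u) 0 1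
  horizontal : ∀ᵐ t ∂(volume.restrict (Icc (0 : ℝ) 1)), ∃ w : EuclideanSpace ℂ (Fin m),
    HasDerivAt (fun s => coords (γ s)) (leftInvariantVector (γ t) w) t

/-- The length of a horizontal path for the left-invariant inner product on `𝓓` that is `B` on
`𝓓₀ = ℂᵐ`. The velocity is the value at `γ t` of the left-invariant vector field `(w, 0)` with
`w = (ζ ∘ γ)' (t)`, so its norm is `√(B w w)`. -/
noncomputable def horizontalLength (B : LinearMap.BilinForm ℝ (EuclideanSpace ℂ (Fin m)))
    (γ : ℝ → Heis m) : ℝ≥0∞ :=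
  ∫⁻ t in Icc (0 : ℝ) 1,
    ENNReal.ofReal (√(B (deriv (fun s => (γ s).ζ) t) (deriv (fun s => (γ s).ζ) t)))

/-- The Carnot–Carathéodory distance, a priori with values in `[0, ∞]`. -/
noncomputable def ccEDist (B : LinearMap.BilinForm ℝ (EuclideanSpace ℂ (Fin m)))
    (x y : Heis m) : ℝ≥0∞ :=
  ⨅ (γ : ℝ → Heis m) (_ : IsHorizontalPath γ x y), horizontalLength B γ

end Heis

/-! ### Complex hyperbolic space -/

/-- The negative points of complex projective space for a sesquilinear form `J`. -/
def NegativePoints {V : Type*} [AddCommGroup V] [Module ℂ V] (J : V →ₗ[ℂ] V →ₗ⋆[ℂ] ℂ) : Type _ :=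
  {p : Projectivization ℂ V // (J p.rep p.rep).re < 0}

/-- The distance `d` with `cosh² d(p, q) = J(z, w) J(w, z) / (J(z, z) J(w, w))`, where `z` and `w`
represent `p` and `q`. -/
noncomputable def NegativePoints.hypDist {V : Type*} [AddCommGroup V] [Module ℂ V]
    {J : V →ₗ[ℂ] V →ₗ⋆[ℂ] ℂ} (p q : NegativePoints J) : ℝ :=
  Real.arcosh (√((J p.1.rep q.1.rep * J q.1.rep p.1.rep
    / (J p.1.rep p.1.rep * J q.1.rep q.1.rep)).re))

/-- The Hermitian form `z₀ w₁* + z₁ w₀* + z₂ w₂* + ⋯ + z_{m+1} w_{m+1}*` of type `(m + 1, 1)`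
on `ℂ^{m+2}`. -/
noncomputable def siegelForm (m : ℕ) : (Fin (m + 2) → ℂ) →ₗ[ℂ] (Fin (m + 2) → ℂ) →ₗ⋆[ℂ] ℂ :=
  LinearMap.mk₂'ₛₗ (RingHom.id ℂ) (starRingEnd ℂ)
    (fun z w => z 0 * conj (w 1) + z 1 * conj (w 0)
      + ∑ i : Fin m, z i.succ.succ * conj (w i.succ.succ))
    (by intro x y w; simp only [Pi.add_apply, add_mul, Finset.sum_add_distrib]; ring)
    (by intro c x w
        simp only [Pi.smul_apply, smul_eq_mul, RingHom.id_apply, mul_add, Finset.mul_sum,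
          mul_assoc])
    (by intro w x y
        simp only [Pi.add_apply, map_add, mul_add, Finset.sum_add_distrib]; ring)
    (by intro c x w
        simp only [Pi.smul_apply, smul_eq_mul, map_mul, mul_add, Finset.mul_sum,
          mul_left_comm])

/-- Complex hyperbolic space of complex dimension `m + 1`, in the Siegel model. -/
abbrev ComplexHyperbolicSpace (m : ℕ) : Type := NegativePoints (siegelForm m)

/-- The homogeneous coordinates `[1 : -v - |ζ|² + iu : √2 ζ]` of the point of the Siegel model
with horospherical coordinates `(ζ, u, v)`. -/
noncomputable def siegelVector {m : ℕ} (p : Heis m × PosReal) : Fin (m + 2) → ℂ :=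
  Fin.cons 1 (Fin.cons
    (-((p.2 : ℝ) : ℂ) - ((‖p.1.ζ‖ ^ 2 : ℝ) : ℂ) + (p.1.u : ℂ) * Complex.I)
    (fun i => ((√2 : ℝ) : ℂ) * p.1.ζ i))

lemma siegelVector_ne_zero {m : ℕ} (p : Heis m × PosReal) : siegelVector p ≠ 0 := by
  intro h
  have := congrFun h 0
  simp [siegelVector] at this

lemma siegelForm_siegelVector {m : ℕ} (p : Heis m × PosReal) :
    siegelForm m (siegelVector p) (siegelVector p) = ((-2 * (p.2 : ℝ) : ℝ) : ℂ) := by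
  have h2 : ((√2 : ℝ) : ℂ) * ((√2 : ℝ) : ℂ) = 2 := by
    rw [← Complex.ofReal_mul, Real.mul_self_sqrt (by norm_num)]; simp
  have hs : ∑ i : Fin m, ((√2 : ℝ) : ℂ) * p.1.ζ i * conj (((√2 : ℝ) : ℂ) * p.1.ζ i)
      = 2 * ((‖p.1.ζ‖ ^ 2 : ℝ) : ℂ) := by
    rw [EuclideanSpace.norm_sq_eq, Complex.ofReal_sum, Finset.mul_sum]
    refine Finset.sum_congr rfl fun i _ => ?_
    rw [map_mul, Complex.conj_ofReal, Complex.ofReal_pow, ← Complex.mul_conj', ← h2]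
    ring
  have e1 : (siegelVector p) 1
      = -((p.2 : ℝ) : ℂ) - ((‖p.1.ζ‖ ^ 2 : ℝ) : ℂ) + (p.1.u : ℂ) * Complex.I := rfl
  have e0 : (siegelVector p) 0 = 1 := rfl
  have ei : ∀ i : Fin m, (siegelVector p) i.succ.succ = ((√2 : ℝ) : ℂ) * p.1.ζ i := fun _ => rfl
  change (siegelVector p) 0 * conj ((siegelVector p) 1) + (siegelVector p) 1
    * conj ((siegelVector p) 0) + ∑ i : Fin m, (siegelVector p) i.succ.succ
    * conj ((siegelVector p) i.succ.succ) = _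
  simp only [e0, e1, ei]
  rw [hs]
  simp
  ring

/-- The identification of `Heis m × ℝ⁺` (with coordinates `(ζ, u, v)`) with the Siegel model. -/
noncomputable def horospherical {m : ℕ} (p : Heis m × PosReal) : ComplexHyperbolicSpace m :=
  ⟨Projectivization.mk ℂ (siegelVector p) (siegelVector_ne_zero p), by
    obtain ⟨a, ha⟩ := Projectivization.exists_smul_eq_mk_rep ℂ (siegelVector p)
      (siegelVector_ne_zero p)
    rw [← ha]
    have hv : 0 < (p.2 : ℝ) := p.2.2
    have hpos : 0 < Complex.normSq (a : ℂ) := Complex.normSq_pos.2 a.ne_zero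
    have : siegelForm m (a • siegelVector p) (a • siegelVector p)
        = ((Complex.normSq (a : ℂ) * (-2 * (p.2 : ℝ)) : ℝ) : ℂ) := by
      rw [Units.smul_def, LinearMap.map_smulₛₗ, LinearMap.map_smulₛₗ, LinearMap.smul_apply,
        siegelForm_siegelVector, smul_eq_mul, smul_eq_mul, ← mul_assoc, RingHom.id_apply,
        mul_comm (conj (a : ℂ)), Complex.mul_conj]
      push_cast
      ring
    rw [this, Complex.ofReal_re]
    nlinarith⟩

/-- Horospherical coordinates with the vertical coordinate `t = √v`. -/
noncomputable def horosphericalSqrt {m : ℕ} (p : Heis m × PosReal) : ComplexHyperbolicSpace m :=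
  horospherical (p.1, ⟨(p.2 : ℝ) ^ 2, pow_pos (mem_Ioi.1 p.2.2) 2⟩)

/-- The coordinates `(ζ, u, t)` on `Heis m × ℝ⁺`. -/
def heisPlusCoords {m : ℕ} (p : Heis m × PosReal) : EuclideanSpace ℂ (Fin m) × ℝ × ℝ :=
  (p.1.ζ, p.1.u, (p.2 : ℝ))

/-! ### Absolutely continuous functions -/

namespace AbsolutelyContinuousOnInterval

open scoped NNReal

variable {X : Type*} [PseudoMetricSpace X] {a b c d : ℝ}

/-! The two metrics in the statement are linked only through the topology, the lattice and the
dilation. On the base, all that is used of d_CC is recorded in `IsHomogeneousMetric`: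
left-invariance, homogeneity under dilations, the Euclidean topology and properness. This is why
every inner product `B` works, although the hyperbolic side uses only the standard one.

These properties follow from a ball-box estimate. Translations and dilations carry horizontal paths
to horizontal paths and multiply lengths by 1 and s. A path of length L from the identity has ‖ζ‖ ≤
CL, and since u' = 2 Im⟨ζ, ζ'⟩ along it, |u| ≤ 2(CL)² (`enorm_ζ_le_ccEDist`). Conversely, a vertical
displacement u is the commutator of two horizontal segments of size about √|u|
(`ccEDist_one_vertical`), so the distance is finite and at most a multiple of ‖ζ‖ + √|u|.

The tile is the attractor of the maps x ↦ δ_{1/2}(d·x), where the digits d represent the cosets of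
δ₂Γ in Γ; thus δ₂K is a finite union of translates of K. The union of all translates is closed,
stable under δ_{1/2} and within bounded distance of every point, so it is everything; Baire then
gives an interior point, and self-similarity spreads it densely over K. Over a ζ with irrational
coordinates the horizontal digits are forced and the fibre of K has diameter at most (3 + 1)/4 = 1
(`abs_sub_u_le_one`), so that interiors of distinct translates cannot meet. Connectedness holds
because the first-level pieces are linked by common points (`mem_iff_of_pieces`), hence so are the
pieces at every scale.

In horospherical coordinates cosh² d is an explicit rational function of q⁻¹p and the two heights
(`hypDist_horosphericalSqrt`), from which the invariances are read off. The Riemannian metric is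
(|dζ|² + dt²)/t² + (du − 2 Im⟨ζ, dζ⟩)²/(4t⁴). That d bounds lengths from below is the inequality
|∇d| ≤ 1, a Cauchy–Schwarz inequality for F = cosh² d (`coshSq_deriv_sq_le`). That d is attained
comes from the radii of the unit ball, rewritten in these coordinates and moved by translations and
dilations (`exists_contDiffOn_lintegral_eq`). A single global chart turns both facts into a
statement about the Riemannian distance. -/

lemma congr_eqOn {f g : ℝ → X} (hf : AbsolutelyContinuousOnInterval f a b)
    (h : EqOn f g (uIcc a b)) : AbsolutelyContinuousOnInterval g a b := by
  rw [absolutelyContinuousOnInterval_iff] at hf ⊢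
  intro ε hε
  obtain ⟨δ, hδ, H⟩ := hf ε hε
  refine ⟨δ, hδ, fun E hE hlt => ?_⟩
  have := H E hE hlt
  rwa [Finset.sum_congr rfl fun i hi => by rw [← h (hE.1 i hi).1, ← h (hE.1 i hi).2]]

lemma disjoint_uIoc_image {φ : ℝ → ℝ} (hφ : Monotone φ ∨ Antitone φ) {p q r s : ℝ}
    (h : Disjoint (uIoc p q) (uIoc r s)) : Disjoint (uIoc (φ p) (φ q)) (uIoc (φ r) (φ s)) := by
  rcases eq_or_ne p q with rfl | hpq
  · simp
  rcases eq_or_ne r s with rfl | hrs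
  · simp
  -- Disjoint nonempty half-open intervals are ordered on the line, possibly with a common endpoint;
  -- a monotone map keeps weak inequalities between endpoints.
  have key : max p q ≤ min r s ∨ max r s ≤ min p q := by
    by_contra! hcon
    have h1 : min p q < max p q := min_lt_max.2 hpq
    have h2 : min r s < max r s := min_lt_max.2 hrs
    have m1 : min (max p q) (max r s) ∈ uIoc p q := ⟨lt_min h1 hcon.2, min_le_left _ _⟩
    exact Set.disjoint_left.1 h m1 ⟨lt_min hcon.1 h2, min_le_right _ _⟩
  simp only [max_le_iff, le_min_iff] at key
  rw [Set.disjoint_left]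
  rintro x hx hx'
  simp only [mem_uIoc] at hx hx'
  rcases hφ with hφ | hφ <;> rcases key with ⟨⟨k1, k2⟩, k3, k4⟩ | ⟨⟨k1, k2⟩, k3, k4⟩ <;>
    (have := hφ k1; have := hφ k2; have := hφ k3; have := hφ k4; grind)

/-- Absolute continuity is tested on disjoint families of intervals. Monotonicity keeps the image
family disjoint, and the Lipschitz bound keeps its total length small. -/
lemma comp_lipschitz {f : ℝ → X} {φ : ℝ → ℝ} {K : ℝ≥0}
    (hf : AbsolutelyContinuousOnInterval f c d) (hφ : LipschitzWith K φ)
    (hmono : Monotone φ ∨ Antitone φ) (hmaps : ∀ t ∈ uIcc a b, φ t ∈ uIcc c d) :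
    AbsolutelyContinuousOnInterval (fun t => f (φ t)) a b := by
  rw [absolutelyContinuousOnInterval_iff] at hf ⊢
  intro ε hε
  obtain ⟨δ, hδ, H⟩ := hf ε hε
  -- `K + 1` rather than `K`, which may be zero.
  refine ⟨δ / (K + 1), by positivity, fun E hE hlt => ?_⟩
  refine H (E.1, fun i => (φ (E.2 i).1, φ (E.2 i).2)) ⟨fun i hi => ?_, fun i hi j hj hij => ?_⟩ ?_
  · exact ⟨hmaps _ (hE.1 i hi).1, hmaps _ (hE.1 i hi).2⟩
  · exact disjoint_uIoc_image hmono (hE.2 hi hj hij)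
  · calc ∑ i ∈ Finset.range E.1, dist (φ (E.2 i).1) (φ (E.2 i).2)
        ≤ ∑ i ∈ Finset.range E.1, (K + 1) * dist (E.2 i).1 (E.2 i).2 := by
          refine Finset.sum_le_sum fun i _ => (hφ.dist_le_mul _ _).trans ?_
          gcongr
          linarith
      _ = (K + 1) * ∑ i ∈ Finset.range E.1, dist (E.2 i).1 (E.2 i).2 := by rw [Finset.mul_sum]
      _ < (K + 1) * (δ / (K + 1)) := by gcongr
      _ = δ := by field_simp

lemma comp_affine {f : ℝ → X} (hf : AbsolutelyContinuousOnInterval f c d) {k l : ℝ}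
    (hmaps : ∀ t ∈ uIcc a b, k * t + l ∈ uIcc c d) :
    AbsolutelyContinuousOnInterval (fun t => f (k * t + l)) a b := by
  refine hf.comp_lipschitz (φ := fun t => k * t + l) (K := ‖k‖₊) ?_ ?_ hmaps
  · refine LipschitzWith.of_dist_le_mul fun x y => ?_
    rw [Real.dist_eq, Real.dist_eq, coe_nnnorm, Real.norm_eq_abs, ← abs_mul]
    exact le_of_eq (congrArg _ (by ring))
  · rcases le_total 0 k with h | h
    · exact Or.inl fun x y hxy => by dsimp only; nlinarith
    · exact Or.inr fun x y hxy => by dsimp only; nlinarith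

lemma of_const (x : X) : AbsolutelyContinuousOnInterval (fun _ : ℝ => x) a b :=
  (LipschitzWith.const x (α := ℝ)).lipschitzOnWith.absolutelyContinuousOnInterval

variable {F G : Type*} [NormedAddCommGroup F] [NormedSpace ℝ F]
  [NormedAddCommGroup G] [NormedSpace ℝ G]

lemma clm_comp {f : ℝ → F} (hf : AbsolutelyContinuousOnInterval f a b) (A : F →L[ℝ] G) :
    AbsolutelyContinuousOnInterval (fun t => A (f t)) a b := by
  refine squeeze_zero (fun t => Finset.sum_nonneg fun i _ => dist_nonneg) (fun t => ?_)
    (by simpa using Filter.Tendsto.const_mul ‖A‖ hf)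
  rw [Finset.mul_sum]
  exact Finset.sum_le_sum fun i _ => A.lipschitz.dist_le_mul _ _

omit [NormedSpace ℝ F] in
/-- Concatenation of two absolutely continuous functions on `[0, 1]`. -/
lemma concat {f g : ℝ → F} (hf : AbsolutelyContinuousOnInterval f 0 1)
    (hg : AbsolutelyContinuousOnInterval g 0 1) (h : f 1 = g 0) :
    AbsolutelyContinuousOnInterval (fun t => if t ≤ 1 / 2 then f (2 * t) else g (2 * t - 1))
      0 1 := by
  have lip1 : LipschitzWith 2 fun t : ℝ => min (2 * t) 1 := by
    refine LipschitzWith.min_const (LipschitzWith.of_dist_le_mul fun x y => ?_) 1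
    rw [Real.dist_eq, Real.dist_eq, ← mul_sub, abs_mul]
    norm_num
  have lip2 : LipschitzWith 2 fun t : ℝ => max (2 * t - 1) 0 := by
    refine LipschitzWith.max_const (LipschitzWith.of_dist_le_mul fun x y => ?_) 0
    rw [Real.dist_eq, Real.dist_eq, show 2 * x - 1 - (2 * y - 1) = 2 * (x - y) by ring, abs_mul]
    norm_num
  have h1 := hf.comp_lipschitz (a := 0) (b := 1) lip1
    (Or.inl fun x y hxy => by dsimp only; gcongr) (fun t ht => by
      rw [uIcc_of_le zero_le_one] at ht ⊢
      exact ⟨le_min (by linarith [ht.1]) zero_le_one, min_le_right _ _⟩)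
  have h2 := hg.comp_lipschitz (a := 0) (b := 1) lip2
    (Or.inl fun x y hxy => by dsimp only; gcongr) (fun t ht => by
      rw [uIcc_of_le zero_le_one] at ht ⊢
      exact ⟨le_max_right _ _, max_le (by linarith [ht.2]) zero_le_one⟩)
  -- The concatenation equals f(min(2t, 1)) + g(max(2t − 1, 0)) − f(1), so no interval has to be
  -- split at 1/2.
  refine ((h1.add h2).sub (of_const (f 1))).congr_eqOn fun t _ => ?_
  simp only [Pi.add_apply, Pi.sub_apply]
  split_ifs with ht
  · rw [min_eq_left (by linarith), max_eq_right (by linarith), h]; abel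
  · rw [min_eq_right (by linarith), max_eq_left (by linarith)]; abel

/-- The fundamental theorem of calculus for absolutely continuous functions. In extended nonnegative
form it asks for neither measurability nor integrability of `h`. -/
lemma enorm_sub_le_lintegral {f : ℝ → ℝ} (hf : AbsolutelyContinuousOnInterval f 0 1)
    {h : ℝ → ℝ≥0∞} (hle : ∀ᵐ s ∂(volume.restrict (Icc (0 : ℝ) 1)), ‖deriv f s‖ₑ ≤ h s)
    {t : ℝ} (ht : t ∈ Icc (0 : ℝ) 1) : ‖f t - f 0‖ₑ ≤ ∫⁻ s in Icc (0 : ℝ) 1, h s := by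
  have hsub : Ioc 0 t ⊆ Icc (0 : ℝ) 1 := fun s hs => ⟨hs.1.le, hs.2.trans ht.2⟩
  have hAC : AbsolutelyContinuousOnInterval f 0 t := hf.mono (by
    rw [uIcc_of_le ht.1, uIcc_of_le zero_le_one]; exact Icc_subset_Icc le_rfl ht.2)
  rw [← hAC.integral_deriv_eq_sub, intervalIntegral.integral_of_le ht.1]
  refine (enorm_integral_le_lintegral_enorm _).trans ?_
  exact (lintegral_mono_set hsub).trans (lintegral_mono_ae hle)

end AbsolutelyContinuousOnInterval

/-! ### Algebra and coordinates of the Heisenberg group -/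

namespace Heis

variable {m : ℕ}

lemma herm_eq_inner (z w : EuclideanSpace ℂ (Fin m)) : herm z w = inner ℂ w z := by
  simp [herm, PiLp.inner_apply]

lemma abs_herm_im_le (z w : EuclideanSpace ℂ (Fin m)) : |(herm z w).im| ≤ ‖z‖ * ‖w‖ := by
  rw [herm_eq_inner, mul_comm]
  exact (Complex.abs_im_le_norm _).trans (norm_inner_le_norm _ _)

lemma herm_smul_left (r : ℝ) (z w : EuclideanSpace ℂ (Fin m)) : herm (r • z) w = r * herm z w := by
  simp [herm, Finset.mul_sum, mul_assoc]

lemma herm_smul_right (r : ℝ) (z w : EuclideanSpace ℂ (Fin m)) :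
    herm z (r • w) = r * herm z w := by
  simp [herm, Finset.mul_sum, mul_left_comm]

lemma herm_neg_right (x y : EuclideanSpace ℂ (Fin m)) : herm x (-y) = -herm x y := by
  simp [herm]

lemma herm_zero_left (x : EuclideanSpace ℂ (Fin m)) : herm 0 x = 0 := by simp [herm]

lemma herm_zero_right (x : EuclideanSpace ℂ (Fin m)) : herm x 0 = 0 := by simp [herm]

lemma herm_im_swap (x y : EuclideanSpace ℂ (Fin m)) : (herm y x).im = -(herm x y).im := by
  rw [herm_eq_inner, herm_eq_inner, ← inner_conj_symm, Complex.conj_im]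

/-- `w ↦ Im ⟨z, w⟩` as a real-linear functional. -/
noncomputable def hermImCLM (z : EuclideanSpace ℂ (Fin m)) : EuclideanSpace ℂ (Fin m) →L[ℝ] ℝ :=
  LinearMap.mkContinuous
    { toFun := fun w => (herm z w).im
      map_add' := fun x y => by rw [herm_add_right, Complex.add_im]
      map_smul' := fun r x => by simp [herm_smul_right] } ‖z‖ fun w => abs_herm_im_le z w

@[simp] lemma hermImCLM_apply (z w : EuclideanSpace ℂ (Fin m)) :
    hermImCLM z w = (herm z w).im := rfl

lemma continuous_herm_im :
    Continuous fun p : EuclideanSpace ℂ (Fin m) × EuclideanSpace ℂ (Fin m) =>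
      (herm p.1 p.2).im := by
  simp only [herm_eq_inner]
  exact Complex.continuous_im.comp (continuous_snd.inner continuous_fst)

lemma dilation_mul (s : ℝ) (g h : Heis m) : dilation s (g * h) = dilation s g * dilation s h := by
  ext1
  · simp [dilation, mul_ζ]
  · simp only [dilation, mul_u, herm_smul_left, herm_smul_right]
    simp
    ring

lemma dilation_dilation (s r : ℝ) (g : Heis m) : dilation s (dilation r g) = dilation (s * r) g := by
  ext1
  · simp [dilation, mul_smul]
  · simp only [dilation]; ring

lemma dilation_one (g : Heis m) : dilation 1 g = g := by
  ext1 <;> simp [dilation]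

lemma leftInvariantVector_smul (g : Heis m) (c : ℝ) (w : EuclideanSpace ℂ (Fin m)) :
    leftInvariantVector g (c • w) = c • leftInvariantVector g w := by
  simp [leftInvariantVector_eq, herm_smul_right, mul_left_comm]

lemma coords_mul (g h : Heis m) : coords (g * h) =
    coords g + (h.ζ, h.u + 2 * (herm g.ζ h.ζ).im) := by
  simp [coords, mul_ζ, mul_u, add_assoc]

/-! ### Horizontal paths -/

lemma IsHorizontalPath.mul_left {γ : ℝ → Heis m} {x y : Heis m} (h : IsHorizontalPath γ x y)
    (g : Heis m) : IsHorizontalPath (fun t => g * γ t) (g * x) (g * y) where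
  source := by rw [h.source]
  target := by rw [h.target]
  absolutelyContinuous_ζ := (AbsolutelyContinuousOnInterval.of_const g.ζ).add
    h.absolutelyContinuous_ζ
  absolutelyContinuous_u :=
    ((AbsolutelyContinuousOnInterval.of_const g.u).add h.absolutelyContinuous_u).add
      ((h.absolutelyContinuous_ζ.clm_comp (hermImCLM g.ζ)).const_mul 2)
  horizontal := by
    filter_upwards [h.horizontal] with t ⟨w, hw⟩
    refine ⟨w, ?_⟩
    simp only [coords_mul]
    rw [leftInvariantVector_eq] at hw ⊢
    have h1 : HasDerivAt (fun s => (γ s).ζ) w t := hw.fst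
    have h2 : HasDerivAt (fun s => (γ s).u) _ t := hw.snd
    have h3 := (hermImCLM g.ζ).hasFDerivAt.comp_hasDerivAt t h1
    refine ((h1.prodMk (h2.add (h3.const_mul 2))).const_add (coords g)).congr_deriv ?_
    simp only [mul_ζ, herm_add_left, hermImCLM_apply, Complex.add_im]
    congr 1
    ring

lemma IsHorizontalPath.dilation {γ : ℝ → Heis m} {x y : Heis m} (h : IsHorizontalPath γ x y)
    (s : ℝ) : IsHorizontalPath (fun t => dilation s (γ t)) (dilation s x) (dilation s y) where
  source := by rw [h.source]
  target := by rw [h.target]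
  absolutelyContinuous_ζ := h.absolutelyContinuous_ζ.const_smul s
  absolutelyContinuous_u := h.absolutelyContinuous_u.const_mul (s ^ 2)
  horizontal := by
    filter_upwards [h.horizontal] with t ⟨w, hw⟩
    refine ⟨s • w, ?_⟩
    rw [leftInvariantVector_eq] at hw ⊢
    have h1 : HasDerivAt (fun s => (γ s).ζ) w t := hw.fst
    have h2 : HasDerivAt (fun s => (γ s).u) _ t := hw.snd
    refine ((h1.const_smul s).prodMk (h2.const_mul (s ^ 2))).congr_deriv ?_
    simp only [Heis.dilation, herm_smul_left, herm_smul_right,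
      Complex.im_ofReal_mul]
    congr 1
    ring

lemma ae_comp_affine {P : ℝ → Prop} (h : ∀ᵐ t, P t) {k : ℝ} (hk : k ≠ 0) (l : ℝ) :
    ∀ᵐ t, P (k * t + l) :=
  ((measurePreserving_add_right volume l).quasiMeasurePreserving.comp
    (Measure.quasiMeasurePreserving_smul volume hk)).ae h

lemma hasDerivAt_coords_affine {γ : ℝ → Heis m} {k l t : ℝ} {w : EuclideanSpace ℂ (Fin m)}
    (h : HasDerivAt (fun s => coords (γ s)) (leftInvariantVector (γ (k * t + l)) w) (k * t + l)) :
    HasDerivAt (fun s => coords (γ (k * s + l))) (leftInvariantVector (γ (k * t + l)) (k • w)) t := by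
  rw [leftInvariantVector_smul]
  have h2 : HasDerivAt (fun s : ℝ => k * s + l) k t := by
    simpa using ((hasDerivAt_id t).const_mul k).add_const l
  exact h.scomp t h2

/-- The reversal is written `-1 * t + 1` to be an instance of the affine reparametrisations k t + l
treated above. -/
lemma IsHorizontalPath.reverse {γ : ℝ → Heis m} {x y : Heis m} (h : IsHorizontalPath γ x y) :
    IsHorizontalPath (fun t => γ (-1 * t + 1)) y x where
  source := by simp [h.target]
  target := by simp [h.source]
  absolutelyContinuous_ζ := h.absolutelyContinuous_ζ.comp_affine fun t ht => by
    rw [uIcc_of_le zero_le_one] at ht ⊢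
    constructor <;> linarith [ht.1, ht.2]
  absolutelyContinuous_u := h.absolutelyContinuous_u.comp_affine fun t ht => by
    rw [uIcc_of_le zero_le_one] at ht ⊢
    constructor <;> linarith [ht.1, ht.2]
  horizontal := by
    have := h.horizontal
    rw [ae_restrict_iff' measurableSet_Icc] at this ⊢
    filter_upwards [ae_comp_affine this (k := -1) (by norm_num) 1] with t ht h01
    obtain ⟨w, hw⟩ := ht ⟨by linarith [h01.2], by linarith [h01.1]⟩
    exact ⟨_, hasDerivAt_coords_affine hw⟩

/-- Concatenation of paths parametrised by `[0, 1]`. -/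
noncomputable def concatPath (γ₁ γ₂ : ℝ → Heis m) (t : ℝ) : Heis m :=
  if t ≤ 1 / 2 then γ₁ (2 * t) else γ₂ (2 * t - 1)

lemma concatPath_eventuallyEq_left (γ₁ γ₂ : ℝ → Heis m) {t : ℝ} (ht : t < 1 / 2) :
    concatPath γ₁ γ₂ =ᶠ[nhds t] fun s => γ₁ (2 * s + 0) := by
  filter_upwards [Iio_mem_nhds ht] with s hs
  rw [concatPath, if_pos (le_of_lt hs), add_zero]

lemma concatPath_eventuallyEq_right (γ₁ γ₂ : ℝ → Heis m) {t : ℝ} (ht : 1 / 2 < t) :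
    concatPath γ₁ γ₂ =ᶠ[nhds t] fun s => γ₂ (2 * s + -1) := by
  filter_upwards [Ioi_mem_nhds ht] with s hs
  rw [concatPath, if_neg (not_le.2 hs), sub_eq_add_neg]

lemma IsHorizontalPath.concat {γ₁ γ₂ : ℝ → Heis m} {x y z : Heis m}
    (h₁ : IsHorizontalPath γ₁ x y) (h₂ : IsHorizontalPath γ₂ y z) :
    IsHorizontalPath (concatPath γ₁ γ₂) x z where
  source := by simp [concatPath, h₁.source]
  target := by norm_num [concatPath, h₂.target]
  absolutelyContinuous_ζ := by
    simpa only [concatPath, apply_ite Heis.ζ] using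
      h₁.absolutelyContinuous_ζ.concat h₂.absolutelyContinuous_ζ (by rw [h₁.target, h₂.source])
  absolutelyContinuous_u := by
    simpa only [concatPath, apply_ite Heis.u] using
      h₁.absolutelyContinuous_u.concat h₂.absolutelyContinuous_u (by rw [h₁.target, h₂.source])
  horizontal := by
    have e₁ := h₁.horizontal
    have e₂ := h₂.horizontal
    rw [ae_restrict_iff' measurableSet_Icc] at e₁ e₂ ⊢
    -- The junction time 1/2, where the path may have a corner, is a null set and is discarded.
    filter_upwards [ae_comp_affine e₁ (k := 2) (by norm_num) 0,
      ae_comp_affine e₂ (k := 2) (by norm_num) (-1), Measure.ae_ne volume (1 / 2 : ℝ)]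
      with t t₁ t₂ hne h01
    rcases lt_or_gt_of_ne hne with hlt | hgt
    · obtain ⟨w, hw⟩ := t₁ ⟨by linarith [h01.1], by linarith⟩
      have e := concatPath_eventuallyEq_left γ₁ γ₂ hlt
      refine ⟨(2 : ℝ) • w, ?_⟩
      rw [e.eq_of_nhds]
      exact (hasDerivAt_coords_affine hw).congr_of_eventuallyEq (e.fun_comp coords)
    · obtain ⟨w, hw⟩ := t₂ ⟨by linarith, by linarith [h01.2]⟩
      have e := concatPath_eventuallyEq_right γ₁ γ₂ hgt
      refine ⟨(2 : ℝ) • w, ?_⟩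
      rw [e.eq_of_nhds]
      exact (hasDerivAt_coords_affine hw).congr_of_eventuallyEq (e.fun_comp coords)

/-! ### Lengths -/

variable (B : LinearMap.BilinForm ℝ (EuclideanSpace ℂ (Fin m)))

lemma sqrt_bilin_smul (c : ℝ) (w : EuclideanSpace ℂ (Fin m)) :
    √(B (c • w) (c • w)) = |c| * √(B w w) := by
  rw [map_smul, map_smul, LinearMap.smul_apply, smul_eq_mul, smul_eq_mul, ← mul_assoc,
    Real.sqrt_mul (mul_self_nonneg c), Real.sqrt_mul_self_eq_abs]

lemma ofReal_sqrt_smul (c : ℝ) (w : EuclideanSpace ℂ (Fin m)) :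
    ENNReal.ofReal √(B (c • w) (c • w)) = ENNReal.ofReal |c| * ENNReal.ofReal √(B w w) := by
  rw [← ENNReal.ofReal_mul (abs_nonneg c), sqrt_bilin_smul]

/-- Length does not depend on the parametrisation: the factor |k| from the chain rule is the
Jacobian of the change of variables. No regularity of `f` is needed. -/
lemma lintegral_deriv_affine (f : ℝ → EuclideanSpace ℂ (Fin m)) {k : ℝ} (hk : k ≠ 0) (l : ℝ)
    {s : Set ℝ} (hs : MeasurableSet s) :
    ∫⁻ t in s, ENNReal.ofReal √(B (deriv (fun r => f (k * r + l)) t)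
        (deriv (fun r => f (k * r + l)) t))
      = ∫⁻ t in (fun r => k * r + l) '' s, ENNReal.ofReal √(B (deriv f t) (deriv f t)) := by
  have hd : ∀ x ∈ s, HasDerivWithinAt (fun r : ℝ => k * r + l) k s x := fun x _ => by
    simpa using (((hasDerivAt_id x).const_mul k).add_const l).hasDerivWithinAt
  have hinj : InjOn (fun r : ℝ => k * r + l) s := fun x _ y _ h =>
    mul_left_cancel₀ hk (add_right_cancel h)
  rw [lintegral_image_eq_lintegral_abs_deriv_mul hs hd hinj]
  refine lintegral_congr fun t => ?_
  have : deriv (fun r => f (k * r + l)) t = k • deriv f (k * t + l) := by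
    have := deriv_comp_mul_left k (fun r => f (r + l)) t
    rw [this, deriv_comp_add_const]
  rw [this, ofReal_sqrt_smul]

lemma horizontalLength_mul_left (γ : ℝ → Heis m) (g : Heis m) :
    horizontalLength B (fun t => g * γ t) = horizontalLength B γ := by
  simp only [horizontalLength, mul_ζ, deriv_const_add]

lemma horizontalLength_dilation (γ : ℝ → Heis m) (s : ℝ) :
    horizontalLength B (fun t => dilation s (γ t)) =
      ENNReal.ofReal |s| * horizontalLength B γ := by
  simp only [horizontalLength, dilation, deriv_fun_const_smul_field, ofReal_sqrt_smul]
  rw [lintegral_const_mul' _ _ ENNReal.ofReal_ne_top]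

lemma horizontalLength_reverse (γ : ℝ → Heis m) :
    horizontalLength B (fun t => γ (-1 * t + 1)) = horizontalLength B γ := by
  rw [horizontalLength, lintegral_deriv_affine B (fun r => (γ r).ζ) (by norm_num) 1
    measurableSet_Icc]
  have : (fun r : ℝ => -1 * r + 1) '' Icc 0 1 = Icc 0 1 := by
    simpa [sub_eq_neg_add] using image_const_sub_Icc (1 : ℝ) 0 1
  rw [this, horizontalLength]

lemma horizontalLength_concat (γ₁ γ₂ : ℝ → Heis m) :
    horizontalLength B (concatPath γ₁ γ₂) ≤ horizontalLength B γ₁ + horizontalLength B γ₂ := by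
  have hunion : Icc (0 : ℝ) 1 ⊆ Icc 0 (1 / 2) ∪ Icc (1 / 2) 1 := by
    rw [Icc_union_Icc_eq_Icc (by norm_num) (by norm_num)]
  refine (lintegral_mono_set hunion).trans ((lintegral_union_le _ _ _).trans (le_of_eq ?_))
  congr 1
  · have : (fun r : ℝ => 2 * r + 0) '' Icc 0 (1 / 2) = Icc 0 1 := by
      rw [image_affine_Icc' (by norm_num)]; norm_num
    rw [horizontalLength, ← this, ← lintegral_deriv_affine B (fun r => (γ₁ r).ζ) (by norm_num) 0
      measurableSet_Icc]
    refine lintegral_congr_ae ?_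
    rw [Filter.EventuallyEq, ae_restrict_iff' measurableSet_Icc]
    filter_upwards [Measure.ae_ne volume (1 / 2 : ℝ)] with t hne ht
    have e : deriv (fun s => (concatPath γ₁ γ₂ s).ζ) t = deriv (fun r => (γ₁ (2 * r + 0)).ζ) t :=
      ((concatPath_eventuallyEq_left γ₁ γ₂ (lt_of_le_of_ne ht.2 hne)).fun_comp ζ).deriv_eq
    rw [e]
  · have : (fun r : ℝ => 2 * r + -1) '' Icc (1 / 2) 1 = Icc 0 1 := by
      rw [image_affine_Icc' (by norm_num)]; norm_num
    rw [horizontalLength, ← this, ← lintegral_deriv_affine B (fun r => (γ₂ r).ζ) (by norm_num) (-1)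
      measurableSet_Icc]
    refine lintegral_congr_ae ?_
    rw [Filter.EventuallyEq, ae_restrict_iff' measurableSet_Icc]
    filter_upwards [Measure.ae_ne volume (1 / 2 : ℝ)] with t hne ht
    have e : deriv (fun s => (concatPath γ₁ γ₂ s).ζ) t = deriv (fun r => (γ₂ (2 * r + -1)).ζ) t :=
      ((concatPath_eventuallyEq_right γ₁ γ₂ (lt_of_le_of_ne ht.1 hne.symm)).fun_comp ζ).deriv_eq
    rw [e]

/-! ### The Carnot–Carathéodory distance -/

variable {B} in
lemma IsHorizontalPath.ccEDist_le {γ : ℝ → Heis m} {x y : Heis m} (h : IsHorizontalPath γ x y) :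
    ccEDist B x y ≤ horizontalLength B γ :=
  iInf₂_le γ h

lemma ccEDist_triangle (x y z : Heis m) : ccEDist B x z ≤ ccEDist B x y + ccEDist B y z := by
  simp only [ccEDist, ENNReal.iInf_add, ENNReal.add_iInf]
  exact le_iInf fun γ₂ => le_iInf fun h₂ => le_iInf fun γ₁ => le_iInf fun h₁ =>
    (h₁.concat h₂).ccEDist_le.trans (horizontalLength_concat B γ₁ γ₂)

lemma ccEDist_comm_le (x y : Heis m) : ccEDist B x y ≤ ccEDist B y x :=
  le_iInf₂ fun γ h => h.reverse.ccEDist_le.trans (horizontalLength_reverse B γ).le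

lemma ccEDist_comm (x y : Heis m) : ccEDist B x y = ccEDist B y x :=
  le_antisymm (ccEDist_comm_le B x y) (ccEDist_comm_le B y x)

lemma ccEDist_mul_left_le (g x y : Heis m) : ccEDist B (g * x) (g * y) ≤ ccEDist B x y :=
  le_iInf₂ fun γ h => (h.mul_left g).ccEDist_le.trans (horizontalLength_mul_left B γ g).le

lemma ccEDist_mul_left (g x y : Heis m) : ccEDist B (g * x) (g * y) = ccEDist B x y := by
  refine le_antisymm (ccEDist_mul_left_le B g x y) ?_
  simpa using ccEDist_mul_left_le B g⁻¹ (g * x) (g * y)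

lemma ccEDist_eq_one (x y : Heis m) : ccEDist B x y = ccEDist B 1 (x⁻¹ * y) := by
  rw [← ccEDist_mul_left B x⁻¹ x y, inv_mul_cancel]

lemma ccEDist_dilation_le {s : ℝ} (hs : 0 < s) (x y : Heis m) :
    ccEDist B (dilation s x) (dilation s y) ≤ ENNReal.ofReal s * ccEDist B x y := by
  have h0 : ENNReal.ofReal s ≠ 0 := by simpa using hs
  rw [ccEDist, ccEDist]
  simp only [ENNReal.mul_iInf_of_ne h0 ENNReal.ofReal_ne_top]
  refine le_iInf₂ fun γ h => (h.dilation s).ccEDist_le.trans (le_of_eq ?_)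
  rw [horizontalLength_dilation, abs_of_pos hs]

lemma ccEDist_dilation {s : ℝ} (hs : 0 < s) (x y : Heis m) :
    ccEDist B (dilation s x) (dilation s y) = ENNReal.ofReal s * ccEDist B x y := by
  refine le_antisymm (ccEDist_dilation_le B hs x y) ?_
  -- The reverse inequality is the one already proved, for the inverse dilation.
  have h := ccEDist_dilation_le B (inv_pos.2 hs) (dilation s x) (dilation s y)
  rw [dilation_dilation, dilation_dilation, inv_mul_cancel₀ hs.ne', dilation_one, dilation_one] at h
  calc ENNReal.ofReal s * ccEDist B x y
      ≤ ENNReal.ofReal s * (ENNReal.ofReal s⁻¹ * ccEDist B (dilation s x) (dilation s y)) := by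
        gcongr
    _ = ccEDist B (dilation s x) (dilation s y) := by
        rw [← mul_assoc, ← ENNReal.ofReal_mul hs.le, mul_inv_cancel₀ hs.ne', ENNReal.ofReal_one,
          one_mul]

/-- The segment t ↦ (t w, 0) is horizontal because Im⟨w, w⟩ = 0, and its speed is constant. -/
lemma ccEDist_one_horizontal (w : EuclideanSpace ℂ (Fin m)) :
    ccEDist B 1 ⟨w, 0⟩ ≤ ENNReal.ofReal √(B w w) := by
  have hd : ∀ t : ℝ, HasDerivAt (fun t : ℝ => t • w) w t := fun t => by
    simpa using (hasDerivAt_id t).smul_const w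
  have h : IsHorizontalPath (fun t : ℝ => (⟨t • w, 0⟩ : Heis m)) 1 ⟨w, 0⟩ := by
    refine ⟨?_, by simp, ?_, AbsolutelyContinuousOnInterval.of_const 0, ?_⟩
    · simp only [zero_smul]; rfl
    · exact ContDiffOn.absolutelyContinuousOnInterval (by fun_prop)
    · refine Filter.Eventually.of_forall fun t => ⟨w, ?_⟩
      rw [leftInvariantVector_eq, herm_smul_left]
      refine ((hd t).prodMk (hasDerivAt_const t (0 : ℝ))).congr_deriv ?_
      simp [herm_self_im]
  refine h.ccEDist_le.trans ?_
  simp [horizontalLength, (hd _).deriv]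

end Heis

namespace Heis

variable {m : ℕ}

/-! ### Comparison of the Carnot–Carathéodory distance with the coordinates -/

section Comparison

variable (B : LinearMap.BilinForm ℝ (EuclideanSpace ℂ (Fin m)))

lemma continuous_bilin_self : Continuous fun w => B w w :=
  B.toContinuousBilinearMap.continuous.clm_apply continuous_id

/-- By compactness `B` has a positive minimum on the unit sphere; the case of an empty sphere is
that of the zero space. -/
lemma exists_norm_le_mul_sqrt (hB_pos : ∀ v, v ≠ 0 → 0 < B v v) :
    ∃ C : ℝ, 0 ≤ C ∧ ∀ w, ‖w‖ ≤ C * √(B w w) := by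
  rcases (Metric.sphere (0 : EuclideanSpace ℂ (Fin m)) 1).eq_empty_or_nonempty with he | hne
  · refine ⟨0, le_rfl, fun w => ?_⟩
    by_contra! hw
    have hw' : w ≠ 0 := by rintro rfl; simp at hw
    have : (‖w‖⁻¹ : ℝ) • w ∈ Metric.sphere (0 : EuclideanSpace ℂ (Fin m)) 1 := by
      simp [norm_smul, hw']
    simp [he] at this
  · obtain ⟨v, hv, hmin⟩ := (isCompact_sphere (0 : EuclideanSpace ℂ (Fin m)) 1).exists_isMinOn hne
      (continuous_bilin_self B).continuousOn
    have hv0 : v ≠ 0 := by rintro rfl; simp at hv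
    have hpos := Real.sqrt_pos.2 (hB_pos v hv0)
    refine ⟨(√(B v v))⁻¹, by positivity, fun w => ?_⟩
    rcases eq_or_ne w 0 with rfl | hw
    · simp
    have hw' : 0 < ‖w‖ := norm_pos_iff.2 hw
    have hs : (‖w‖⁻¹ : ℝ) • w ∈ Metric.sphere (0 : EuclideanSpace ℂ (Fin m)) 1 := by
      simp [norm_smul, hw]
    have h1 : √(B v v) ≤ √(B ((‖w‖⁻¹ : ℝ) • w) ((‖w‖⁻¹ : ℝ) • w)) := Real.sqrt_le_sqrt (hmin hs)
    rw [sqrt_bilin_smul, abs_of_pos (by positivity), inv_mul_eq_div, le_div_iff₀ hw'] at h1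
    rwa [inv_mul_eq_div, le_div_iff₀ hpos, mul_comm]

lemma exists_sqrt_le_mul_norm : ∃ C : ℝ, 0 ≤ C ∧ ∀ w, √(B w w) ≤ C * ‖w‖ := by
  obtain ⟨M, hM⟩ := (isCompact_closedBall (0 : EuclideanSpace ℂ (Fin m)) 1).exists_bound_of_continuousOn
    (continuous_bilin_self B).continuousOn
  refine ⟨√M, Real.sqrt_nonneg _, fun w => ?_⟩
  rcases eq_or_ne w 0 with rfl | hw
  · simp
  have hw' : 0 < ‖w‖ := norm_pos_iff.2 hw
  have h1 := Real.sqrt_le_sqrt ((le_abs_self _).trans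
    (hM ((‖w‖⁻¹ : ℝ) • w) (by simp [norm_smul, hw])))
  rwa [sqrt_bilin_smul, abs_of_pos (by positivity), inv_mul_eq_div, div_le_iff₀ hw'] at h1

variable {B}

/-- Horizontality as a differential equation: u is determined by ζ through u' = 2 Im⟨ζ, ζ'⟩. -/
lemma IsHorizontalPath.ae_hasDerivAt {γ : ℝ → Heis m} {x y : Heis m}
    (h : IsHorizontalPath γ x y) : ∀ᵐ t ∂(volume.restrict (Icc (0 : ℝ) 1)),
      HasDerivAt (fun s => (γ s).ζ) (deriv (fun s => (γ s).ζ) t) t ∧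
      deriv (fun s => (γ s).u) t = 2 * (herm (γ t).ζ (deriv (fun s => (γ s).ζ) t)).im := by
  filter_upwards [h.horizontal] with t ⟨w, hw⟩
  rw [leftInvariantVector_eq] at hw
  have h1 : HasDerivAt (fun s => (γ s).ζ) w t := hw.fst
  have h2 : HasDerivAt (fun s => (γ s).u) _ t := hw.snd
  rw [h1.deriv, h2.deriv]
  exact ⟨h1, rfl⟩

lemma lintegral_enorm_deriv_le {C : ℝ} (hC0 : 0 ≤ C) (hC : ∀ w, ‖w‖ ≤ C * √(B w w))
    (γ : ℝ → Heis m) : ∫⁻ t in Icc (0 : ℝ) 1, ‖deriv (fun s => (γ s).ζ) t‖ₑ ≤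
      ENNReal.ofReal C * horizontalLength B γ := by
  rw [horizontalLength, ← lintegral_const_mul' _ _ ENNReal.ofReal_ne_top]
  refine lintegral_mono fun t => ?_
  rw [← ofReal_norm, ← ENNReal.ofReal_mul hC0]
  exact ENNReal.ofReal_le_ofReal (hC _)

lemma IsHorizontalPath.enorm_ζ_le {γ : ℝ → Heis m} {y : Heis m} (h : IsHorizontalPath γ 1 y)
    {C : ℝ} (hC0 : 0 ≤ C) (hC : ∀ w, ‖w‖ ≤ C * √(B w w)) {t : ℝ} (ht : t ∈ Icc (0 : ℝ) 1) :
    ‖(γ t).ζ‖ₑ ≤ ENNReal.ofReal C * horizontalLength B γ := by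
  -- A functional of norm at most 1 that norms ζ(t) reduces the estimate to a real-valued function.
  obtain ⟨A, hA, hAt⟩ := exists_dual_vector'' ℝ (γ t).ζ
  have hAC := h.absolutelyContinuous_ζ.clm_comp A
  have key : ‖A (γ t).ζ - A (γ 0).ζ‖ₑ ≤ ∫⁻ s in Icc (0 : ℝ) 1, ‖deriv (fun s => (γ s).ζ) s‖ₑ := by
    refine hAC.enorm_sub_le_lintegral ?_ ht
    filter_upwards [h.ae_hasDerivAt] with s hs
    have e : HasDerivAt (fun t => A (γ t).ζ) (A (deriv (fun s => (γ s).ζ) s)) s :=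
      A.hasFDerivAt.comp_hasDerivAt s hs.1
    rw [e.deriv, enorm_le_iff_norm_le]
    exact (A.le_opNorm _).trans (mul_le_of_le_one_left (norm_nonneg _) hA)
  rw [h.source, one_ζ, map_zero, sub_zero, hAt] at key
  refine le_trans (le_of_eq ?_) (key.trans (lintegral_enorm_deriv_le hC0 hC γ))
  rw [← ofReal_norm, ← ofReal_norm]
  simp

/-- Integrate |u'| ≤ 2‖ζ‖‖ζ'‖ with the bound on ‖ζ‖ just obtained; this makes u quadratic in the
length. Finiteness of the length allows the constant to leave the integral. -/
lemma IsHorizontalPath.enorm_u_le {γ : ℝ → Heis m} {y : Heis m} (h : IsHorizontalPath γ 1 y)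
    {C : ℝ} (hC0 : 0 ≤ C) (hC : ∀ w, ‖w‖ ≤ C * √(B w w)) (hL : horizontalLength B γ ≠ ⊤) :
    ‖y.u‖ₑ ≤ 2 * (ENNReal.ofReal C * horizontalLength B γ) ^ 2 := by
  set L := ENNReal.ofReal C * horizontalLength B γ
  have key : ‖(γ 1).u - (γ 0).u‖ₑ ≤
      ∫⁻ s in Icc (0 : ℝ) 1, 2 * L * ‖deriv (fun s => (γ s).ζ) s‖ₑ := by
    refine h.absolutelyContinuous_u.enorm_sub_le_lintegral ?_ ⟨zero_le_one, le_rfl⟩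
    filter_upwards [h.ae_hasDerivAt, ae_restrict_mem measurableSet_Icc] with s hs hsI
    rw [hs.2]
    calc ‖2 * (herm (γ s).ζ (deriv (fun s => (γ s).ζ) s)).im‖ₑ
        ≤ ENNReal.ofReal (2 * (‖(γ s).ζ‖ * ‖deriv (fun s => (γ s).ζ) s‖)) := by
          rw [← ofReal_norm, norm_mul]
          refine ENNReal.ofReal_le_ofReal ?_
          simp only [Real.norm_ofNat, Real.norm_eq_abs]
          gcongr
          exact abs_herm_im_le _ _
      _ = 2 * ‖(γ s).ζ‖ₑ * ‖deriv (fun s => (γ s).ζ) s‖ₑ := by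
          rw [ENNReal.ofReal_mul (by norm_num), ENNReal.ofReal_mul (norm_nonneg _),
            ofReal_norm, ofReal_norm, mul_assoc]
          simp
      _ ≤ 2 * L * ‖deriv (fun s => (γ s).ζ) s‖ₑ := by
          gcongr
          exact h.enorm_ζ_le hC0 hC hsI
  rw [h.source, h.target, one_u, sub_zero, lintegral_const_mul' _ _
    (ENNReal.mul_ne_top (by simp) (ENNReal.mul_ne_top ENNReal.ofReal_ne_top hL))] at key
  exact key.trans ((mul_le_mul_right (lintegral_enorm_deriv_le hC0 hC γ) (2 * L)).trans
    (le_of_eq (by ring)))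

lemma enorm_ζ_le_ccEDist {C : ℝ} (hC0 : 0 ≤ C) (hC : ∀ w, ‖w‖ ≤ C * √(B w w)) {y : Heis m}
    {r : ℝ} (hr : ccEDist B 1 y < ENNReal.ofReal r) : ‖y.ζ‖ ≤ C * r ∧ |y.u| ≤ 2 * (C * r) ^ 2 := by
  simp only [ccEDist, iInf_lt_iff] at hr
  obtain ⟨γ, hγ, hlt⟩ := hr
  have hr0 : 0 ≤ r := (ENNReal.ofReal_pos.1 (bot_le.trans_lt hlt)).le
  have hle : ENNReal.ofReal C * horizontalLength B γ ≤ ENNReal.ofReal (C * r) := by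
    rw [ENNReal.ofReal_mul hC0]
    gcongr
  constructor
  · have := (hγ.enorm_ζ_le hC0 hC (t := 1) ⟨zero_le_one, le_rfl⟩).trans hle
    rwa [hγ.target, ← ofReal_norm, ENNReal.ofReal_le_ofReal_iff (by positivity)] at this
  · have h2 := hγ.enorm_u_le hC0 hC hlt.ne_top
    have : ‖y.u‖ₑ ≤ ENNReal.ofReal (2 * (C * r) ^ 2) := by
      rw [ENNReal.ofReal_mul (by norm_num), ENNReal.ofReal_pow (by positivity)]
      refine h2.trans ?_
      rw [ENNReal.ofReal_ofNat]
      gcongr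
    rwa [← ofReal_norm, ENNReal.ofReal_le_ofReal_iff (by positivity)] at this

lemma ccEDist_one_mul_le (g h : Heis m) :
    ccEDist B 1 (g * h) ≤ ccEDist B 1 g + ccEDist B 1 h := by
  refine (ccEDist_triangle B 1 g _).trans (le_of_eq ?_)
  congr 1
  conv_rhs => rw [← ccEDist_mul_left B g, mul_one]

/-- The commutator of s e and r f, with f = i e, is vertical of height −4sr, since Im⟨e, f⟩ = −1.
Taking |s| = |r| = √|u|/2, each of its four horizontal segments costs at most C√|u|/2. -/
lemma ccEDist_one_vertical (hm : 1 ≤ m) {C : ℝ} (hC : ∀ w, √(B w w) ≤ C * ‖w‖) (u : ℝ) :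
    ccEDist B 1 ⟨0, u⟩ ≤ ENNReal.ofReal (2 * C * √|u|) := by
  let i : Fin m := ⟨0, hm⟩
  set e : EuclideanSpace ℂ (Fin m) := EuclideanSpace.single i 1
  set f : EuclideanSpace ℂ (Fin m) := EuclideanSpace.single i Complex.I
  have hef : herm e f = -Complex.I := by simp [herm, e, f]
  have hfe : herm f e = Complex.I := by simp [herm, e, f]
  have hee : (herm e e).im = 0 := herm_self_im e
  have hff : (herm f f).im = 0 := herm_self_im f
  have hne : ‖e‖ = 1 := by simp [e]
  have hnf : ‖f‖ = 1 := by simp [f]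
  -- The sign of u decides whether s and r have opposite or equal signs.
  obtain ⟨s, r, hsr, hs, hr⟩ : ∃ s r : ℝ, -4 * s * r = u ∧ |s| = √|u| / 2 ∧ |r| = √|u| / 2 := by
    have hsq := Real.mul_self_sqrt (abs_nonneg u)
    have habs : |√|u| / 2| = √|u| / 2 := abs_of_nonneg (by positivity)
    rcases le_total 0 u with h | h
    · refine ⟨√|u| / 2, -(√|u| / 2), ?_, habs, by rw [abs_neg, habs]⟩
      rw [abs_of_nonneg h] at hsq ⊢
      linarith
    · refine ⟨√|u| / 2, √|u| / 2, ?_, habs, habs⟩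
      rw [abs_of_nonpos h] at hsq ⊢
      linarith
  have hprod : (⟨0, u⟩ : Heis m) =
      ⟨s • e, 0⟩ * (⟨r • f, 0⟩ * (⟨(-s) • e, 0⟩ * ⟨(-r) • f, 0⟩)) := by
    ext1
    · simp only [mul_ζ]; module
    · simp only [mul_u, mul_ζ, herm_add_right, herm_smul_left, herm_smul_right, hef, hfe,
        Complex.add_im, Complex.im_ofReal_mul, hee, hff]
      simp
      linarith
  have hbound : ∀ (c : ℝ) (w : EuclideanSpace ℂ (Fin m)), ‖w‖ = 1 → |c| = √|u| / 2 →
      ccEDist B 1 ⟨c • w, 0⟩ ≤ ENNReal.ofReal (C * (√|u| / 2)) := fun c w hw hc => by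
    refine (ccEDist_one_horizontal B _).trans (ENNReal.ofReal_le_ofReal ((hC _).trans ?_))
    rw [norm_smul, hw, Real.norm_eq_abs, hc, mul_one]
  have hC0 : 0 ≤ C := by
    have := (Real.sqrt_nonneg _).trans (hC e)
    rwa [hne, mul_one] at this
  have hnn : 0 ≤ C * (√|u| / 2) := by positivity
  rw [hprod]
  calc _ ≤ ENNReal.ofReal (C * (√|u| / 2)) + (ENNReal.ofReal (C * (√|u| / 2)) +
        (ENNReal.ofReal (C * (√|u| / 2)) + ENNReal.ofReal (C * (√|u| / 2)))) := by
        refine (ccEDist_one_mul_le _ _).trans (add_le_add (hbound s e hne hs) ?_)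
        refine (ccEDist_one_mul_le _ _).trans (add_le_add (hbound r f hnf hr) ?_)
        exact (ccEDist_one_mul_le _ _).trans (add_le_add
          (hbound (-s) e hne (by rwa [abs_neg])) (hbound (-r) f hnf (by rwa [abs_neg])))
    _ = ENNReal.ofReal (2 * C * √|u|) := by
        rw [← ENNReal.ofReal_add hnn hnn, ← ENNReal.ofReal_add hnn (by positivity),
          ← ENNReal.ofReal_add hnn (by positivity)]
        congr 1
        ring

lemma ccEDist_one_le (hm : 1 ≤ m) {C : ℝ} (hC0 : 0 ≤ C) (hC : ∀ w, √(B w w) ≤ C * ‖w‖)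
    (g : Heis m) : ccEDist B 1 g ≤ ENNReal.ofReal (C * (‖g.ζ‖ + 2 * √|g.u|)) := by
  have hprod : g = ⟨g.ζ, 0⟩ * ⟨0, g.u⟩ := by
    ext1 <;> simp [mul_ζ, mul_u, herm_zero_right]
  calc ccEDist B 1 g ≤ ccEDist B 1 ⟨g.ζ, 0⟩ + ccEDist B 1 ⟨0, g.u⟩ := by
        conv_lhs => rw [hprod]
        exact ccEDist_one_mul_le _ _
    _ ≤ ENNReal.ofReal (C * ‖g.ζ‖) + ENNReal.ofReal (2 * C * √|g.u|) :=
        add_le_add ((ccEDist_one_horizontal B _).trans (ENNReal.ofReal_le_ofReal (hC _)))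
          (ccEDist_one_vertical hm hC _)
    _ = _ := by
        rw [← ENNReal.ofReal_add (by positivity) (by positivity)]
        congr 1
        ring

end Comparison

/-! ### The Carnot–Carathéodory metric space -/

section Metric

variable {B : LinearMap.BilinForm ℝ (EuclideanSpace ℂ (Fin m))}

lemma ccEDist_self (x : Heis m) : ccEDist B x x = 0 := by
  rw [ccEDist_eq_one, inv_mul_cancel]
  refine le_antisymm ((ccEDist_one_horizontal B 0).trans ?_) bot_le
  simp

lemma eq_of_ccEDist_eq_zero (hB_pos : ∀ v, v ≠ 0 → 0 < B v v) {x y : Heis m}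
    (h : ccEDist B x y = 0) : x = y := by
  obtain ⟨C, hC0, hC⟩ := exists_norm_le_mul_sqrt B hB_pos
  rw [ccEDist_eq_one] at h
  have key : ∀ r : ℝ, 0 < r → ‖(x⁻¹ * y).ζ‖ ≤ C * r ∧ |(x⁻¹ * y).u| ≤ 2 * (C * r) ^ 2 :=
    fun r hr => enorm_ζ_le_ccEDist hC0 hC (by simpa [h] using hr)
  have lim : ∀ f : ℝ → ℝ, Continuous f → Filter.Tendsto f (nhdsWithin 0 (Ioi 0)) (nhds (f 0)) :=
    fun f hf => (hf.tendsto 0).mono_left nhdsWithin_le_nhds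
  have h1 : ‖(x⁻¹ * y).ζ‖ ≤ C * 0 := ge_of_tendsto (lim (fun r => C * r) (by fun_prop))
    (by filter_upwards [self_mem_nhdsWithin] with r hr using (key r hr).1)
  have h2 : |(x⁻¹ * y).u| ≤ 2 * (C * 0) ^ 2 :=
    ge_of_tendsto (lim (fun r => 2 * (C * r) ^ 2) (by fun_prop))
      (by filter_upwards [self_mem_nhdsWithin] with r hr using (key r hr).2)
  have h3 : x⁻¹ * y = 1 := by
    ext1
    · exact norm_le_zero_iff.1 (by simpa using h1)
    · exact abs_nonpos_iff.1 (by simpa using h2)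
  exact (inv_mul_eq_one.1 h3)

/-- The Carnot–Carathéodory metric. -/
@[reducible]
noncomputable def ccMetricSpace (hm : 1 ≤ m) (hB_pos : ∀ v, v ≠ 0 → 0 < B v v) :
    MetricSpace (Heis m) :=
  letI : EMetricSpace (Heis m) :=
    { edist := ccEDist B
      edist_self := ccEDist_self
      edist_comm := ccEDist_comm B
      edist_triangle := ccEDist_triangle B
      eq_of_edist_eq_zero := eq_of_ccEDist_eq_zero hB_pos }
  EMetricSpace.toMetricSpace fun x y => by
    obtain ⟨C, hC0, hC⟩ := exists_sqrt_le_mul_norm B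
    change ccEDist B x y ≠ ⊤
    rw [ccEDist_eq_one]
    exact ((ccEDist_one_le hm hC0 hC _).trans_lt ENNReal.ofReal_lt_top).ne

variable [MetricSpace (Heis m)] (hed : ∀ x y : Heis m, edist x y = ccEDist B x y)
include hed

lemma dist_mul_left (g x y : Heis m) : dist (g * x) (g * y) = dist x y := by
  rw [dist_edist, dist_edist, hed, hed, ccEDist_mul_left]

lemma dist_dilation {s : ℝ} (hs : 0 < s) (x y : Heis m) :
    dist (dilation s x) (dilation s y) = s * dist x y := by
  rw [dist_edist, dist_edist, hed, hed, ccEDist_dilation B hs, ENNReal.toReal_mul,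
    ENNReal.toReal_ofReal hs.le]

lemma norm_coords_le_dist (hB_pos : ∀ v, v ≠ 0 → 0 < B v v) :
    ∃ C : ℝ, 0 ≤ C ∧ ∀ x y : Heis m, ‖(x⁻¹ * y).ζ‖ ≤ C * dist x y ∧
      |(x⁻¹ * y).u| ≤ 2 * (C * dist x y) ^ 2 := by
  obtain ⟨C, hC0, hC⟩ := exists_norm_le_mul_sqrt B hB_pos
  -- The box estimate requires a radius strictly larger than the distance; twice the distance is
  -- used.
  refine ⟨2 * C, by positivity, fun x y => ?_⟩
  rcases eq_or_ne x y with rfl | hne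
  · simp [one_ζ, one_u]
  have hpos := dist_pos.2 hne
  have := enorm_ζ_le_ccEDist hC0 hC (y := x⁻¹ * y) (r := 2 * dist x y) (by
    rw [← ccEDist_eq_one, ← hed, edist_dist]
    exact (ENNReal.ofReal_lt_ofReal_iff (by positivity)).2 (by linarith))
  convert this using 2 <;> ring_nf

lemma dist_le_coords (hm : 1 ≤ m) : ∃ C : ℝ, 0 ≤ C ∧ ∀ x y : Heis m,
    dist x y ≤ C * (‖(x⁻¹ * y).ζ‖ + 2 * √|(x⁻¹ * y).u|) := by
  obtain ⟨C, hC0, hC⟩ := exists_sqrt_le_mul_norm B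
  refine ⟨C, hC0, fun x y => ?_⟩
  have := ccEDist_one_le hm hC0 hC (x⁻¹ * y)
  rwa [← ccEDist_eq_one, ← hed, edist_dist, ENNReal.ofReal_le_ofReal_iff (by positivity)] at this

omit [MetricSpace (Heis m)] hed in
lemma coords_eq_add (x y : Heis m) : coords y = coords x +
    ((x⁻¹ * y).ζ, (x⁻¹ * y).u + 2 * (herm x.ζ (x⁻¹ * y).ζ).im) := by
  rw [← coords_mul, mul_inv_cancel_left]

lemma continuous_coords (hB_pos : ∀ v, v ≠ 0 → 0 < B v v) :
    Continuous (coords : Heis m → EuclideanSpace ℂ (Fin m) × ℝ) := by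
  obtain ⟨C, hC0, hC⟩ := norm_coords_le_dist hed hB_pos
  rw [continuous_iff_continuousAt]
  intro x
  have hd : Filter.Tendsto (fun y => dist x y) (nhds x) (nhds 0) := by
    simpa using (continuous_const.dist continuous_id : Continuous fun y => dist x y).tendsto x
  have h1 : Filter.Tendsto (fun y => (x⁻¹ * y).ζ) (nhds x) (nhds 0) :=
    squeeze_zero_norm (fun y => (hC x y).1) (by simpa using hd.const_mul C)
  have h2 : Filter.Tendsto (fun y => (x⁻¹ * y).u) (nhds x) (nhds 0) :=
    squeeze_zero_norm (fun y => (hC x y).2) (by simpa using ((hd.const_mul C).pow 2).const_mul 2)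
  have h3 : Filter.Tendsto (fun y => (herm x.ζ (x⁻¹ * y).ζ).im) (nhds x) (nhds 0) := by
    have := ((hermImCLM x.ζ).continuous.tendsto 0).comp h1
    rwa [map_zero] at this
  rw [ContinuousAt, funext (coords_eq_add x)]
  simpa [one_ζ, one_u, herm_zero_right] using (h1.prodMk_nhds (h2.add (h3.const_mul 2))).const_add (coords x)

lemma continuous_mk (hm : 1 ≤ m) :
    Continuous fun p : EuclideanSpace ℂ (Fin m) × ℝ => (⟨p.1, p.2⟩ : Heis m) := by
  obtain ⟨C, hC0, hC⟩ := dist_le_coords hed hm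
  rw [continuous_iff_continuousAt]
  intro p
  rw [ContinuousAt, tendsto_iff_dist_tendsto_zero]
  simp only [dist_comm _ (⟨p.1, p.2⟩ : Heis m)]
  refine squeeze_zero (fun _ => dist_nonneg) (fun q => hC _ _) ?_
  have hcont : Continuous fun q : EuclideanSpace ℂ (Fin m) × ℝ =>
      C * (‖-p.1 + q.1‖ + 2 * √|-p.2 + q.2 + 2 * (herm (-p.1) q.1).im|) := by
    have := (hermImCLM (-p.1)).continuous
    simp only [← hermImCLM_apply]
    fun_prop
  have := hcont.tendsto p
  simpa [mul_ζ, mul_u, inv_ζ, inv_u, herm_neg_left, herm_self_im] using this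

/-- The coordinates are a homeomorphism for the Carnot–Carathéodory metric. -/
noncomputable def coordsHomeomorph (hm : 1 ≤ m) (hB_pos : ∀ v, v ≠ 0 → 0 < B v v) :
    Heis m ≃ₜ EuclideanSpace ℂ (Fin m) × ℝ where
  toFun := coords
  invFun p := ⟨p.1, p.2⟩
  left_inv _ := rfl
  right_inv _ := rfl
  continuous_toFun := continuous_coords hed hB_pos
  continuous_invFun := continuous_mk hed hm

/-- A closed ball is closed and lies in a bounded coordinate region: u(y) − u(x) differs from the
u-part of x⁻¹y by 2 Im⟨ζ(x), ·⟩, which gives the second term of the radius. -/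
lemma properSpace (hm : 1 ≤ m) (hB_pos : ∀ v, v ≠ 0 → 0 < B v v) : ProperSpace (Heis m) := by
  obtain ⟨C, hC0, hC⟩ := norm_coords_le_dist hed hB_pos
  refine ⟨fun x r => ?_⟩
  have hc : IsCompact ((coordsHomeomorph hed hm hB_pos) ⁻¹'
      (Metric.closedBall (coords x) (max (C * r) (2 * (C * r) ^ 2 + 2 * (‖x.ζ‖ * (C * r)))))) :=
    (coordsHomeomorph hed hm hB_pos).isCompact_preimage.2 (isCompact_closedBall _ _)
  refine hc.of_isClosed_subset Metric.isClosed_closedBall fun y hy => ?_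
  change dist (coords y) (coords x) ≤ _
  rw [coords_eq_add x y, dist_self_add_left, Prod.norm_def]
  have hxy : C * dist x y ≤ C * r := by
    gcongr
    rwa [dist_comm]
  have h1 : ‖(x⁻¹ * y).ζ‖ ≤ C * r := (hC x y).1.trans hxy
  refine max_le_max h1 ((norm_add_le _ _).trans (add_le_add ?_ ?_))
  · refine (hC x y).2.trans ?_
    have : 0 ≤ C * dist x y := by positivity
    gcongr
  · rw [norm_mul]
    simp only [Real.norm_ofNat, Real.norm_eq_abs]
    refine mul_le_mul_of_nonneg_left ((abs_herm_im_le _ _).trans ?_) (by norm_num)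
    gcongr

end Metric

end Heis

namespace Heis

variable {m : ℕ}

/-! ### Real coordinates -/

/-- The real coordinate functionals of `ℂᵐ`: real parts for `false`, imaginary parts for `true`. -/
noncomputable def realCoord (j : Fin m × Bool) (z : EuclideanSpace ℂ (Fin m)) : ℝ :=
  bif j.2 then (z j.1).im else (z j.1).re

/-- The real basis of `ℂᵐ` dual to `realCoord`. -/
noncomputable def realUnit (j : Fin m × Bool) : EuclideanSpace ℂ (Fin m) :=
  EuclideanSpace.single j.1 (bif j.2 then Complex.I else 1)

lemma realCoord_add (j : Fin m × Bool) (z w : EuclideanSpace ℂ (Fin m)) :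
    realCoord j (z + w) = realCoord j z + realCoord j w := by
  rcases j with ⟨i, _ | _⟩ <;> simp [realCoord]

lemma realCoord_neg (j : Fin m × Bool) (z : EuclideanSpace ℂ (Fin m)) :
    realCoord j (-z) = -realCoord j z := by
  rcases j with ⟨i, _ | _⟩ <;> simp [realCoord]

lemma realCoord_zero (j : Fin m × Bool) : realCoord j (0 : EuclideanSpace ℂ (Fin m)) = 0 := by
  rcases j with ⟨i, _ | _⟩ <;> simp [realCoord]

lemma realCoord_smul (j : Fin m × Bool) (r : ℝ) (z : EuclideanSpace ℂ (Fin m)) :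
    realCoord j (r • z) = r * realCoord j z := by
  rcases j with ⟨i, _ | _⟩ <;> simp [realCoord]

lemma realCoord_sum {ι : Type*} (s : Finset ι) (j : Fin m × Bool)
    (f : ι → EuclideanSpace ℂ (Fin m)) :
    realCoord j (∑ i ∈ s, f i) = ∑ i ∈ s, realCoord j (f i) := by
  classical
  induction s using Finset.induction_on with
  | empty => simp [realCoord_zero]
  | insert a s ha ih => rw [Finset.sum_insert ha, Finset.sum_insert ha, realCoord_add, ih]

lemma realCoord_realUnit (j k : Fin m × Bool) :
    realCoord j (realUnit k) = if j = k then 1 else 0 := by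
  rcases j with ⟨i, _ | _⟩ <;> rcases k with ⟨l, _ | _⟩ <;> by_cases h : i = l <;>
    simp [realCoord, realUnit, h]

lemma ext_realCoord {z w : EuclideanSpace ℂ (Fin m)} (h : ∀ j, realCoord j z = realCoord j w) :
    z = w := by
  ext i
  exact Complex.ext (h (i, false)) (h (i, true))

lemma continuous_realCoord (j : Fin m × Bool) :
    Continuous (realCoord j : EuclideanSpace ℂ (Fin m) → ℝ) := by
  rcases j with ⟨i, _ | _⟩
  · exact Complex.continuous_re.comp (EuclideanSpace.proj (𝕜 := ℂ) i).continuous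
  · exact Complex.continuous_im.comp (EuclideanSpace.proj (𝕜 := ℂ) i).continuous

lemma isIntegral_iff {z : EuclideanSpace ℂ (Fin m)} :
    IsIntegral z ↔ ∀ j, ∃ n : ℤ, realCoord j z = n := by
  constructor
  · rintro h ⟨i, b⟩
    obtain ⟨p, q, hpq⟩ := h i
    cases b
    · exact ⟨p, by simp [realCoord, hpq]⟩
    · exact ⟨q, by simp [realCoord, hpq]⟩
  · intro h i
    obtain ⟨p, hp⟩ := h (i, false)
    obtain ⟨q, hq⟩ := h (i, true)
    refine ⟨p, q, Complex.ext ?_ ?_⟩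
    · simpa [realCoord] using hp
    · simpa [realCoord] using hq

/-- The vector with given real coordinates. -/
noncomputable def ofRealCoord (f : Fin m × Bool → ℝ) : EuclideanSpace ℂ (Fin m) :=
  ∑ j, f j • realUnit j

@[simp] lemma realCoord_ofRealCoord (f : Fin m × Bool → ℝ) (j : Fin m × Bool) :
    realCoord j (ofRealCoord f) = f j := by
  simp [ofRealCoord, realCoord_sum, realCoord_smul, realCoord_realUnit]

lemma ofRealCoord_realCoord (z : EuclideanSpace ℂ (Fin m)) :
    ofRealCoord (fun j => realCoord j z) = z :=
  ext_realCoord fun j => by simp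

lemma continuous_ofRealCoord :
    Continuous (ofRealCoord : (Fin m × Bool → ℝ) → EuclideanSpace ℂ (Fin m)) := by
  unfold ofRealCoord
  fun_prop

lemma herm_im_eq (z w : EuclideanSpace ℂ (Fin m)) : (herm z w).im =
    ∑ i, (realCoord (i, true) z * realCoord (i, false) w
      - realCoord (i, false) z * realCoord (i, true) w) := by
  simp only [herm, Complex.im_sum, realCoord]
  refine Finset.sum_congr rfl fun i _ => ?_
  simp
  ring

/-- Each of the m summands of the symplectic form is a difference of two numbers in [0, 1]. -/
lemma abs_herm_im_le_of_mem_unit {z w : EuclideanSpace ℂ (Fin m)}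
    (hz : ∀ j, realCoord j z ∈ Icc (0 : ℝ) 1) (hw : ∀ j, realCoord j w ∈ Icc (0 : ℝ) 1) :
    |(herm z w).im| ≤ m := by
  rw [herm_im_eq]
  refine (Finset.abs_sum_le_sum_abs _ _).trans ?_
  have : ∀ i ∈ (Finset.univ : Finset (Fin m)), |realCoord (i, true) z * realCoord (i, false) w
      - realCoord (i, false) z * realCoord (i, true) w| ≤ 1 := fun i _ => by
    have h1 := mul_nonneg (hz (i, true)).1 (hw (i, false)).1
    have h2 := mul_nonneg (hz (i, false)).1 (hw (i, true)).1
    have h3 := mul_le_one₀ (hz (i, true)).2 (hw (i, false)).1 (hw (i, false)).2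
    have h4 := mul_le_one₀ (hz (i, false)).2 (hw (i, true)).1 (hw (i, true)).2
    rw [abs_le]
    constructor <;> linarith
  simpa using Finset.sum_le_sum this

/-! ### The digits and the tile -/

/-- The digits of the self-similar tile: representatives of `δ₂ Γ \ Γ`. -/
noncomputable def digit (d : Finset (Fin m × Bool) × Fin 4) : Heis m :=
  ⟨∑ j ∈ d.1, realUnit j, (d.2 : ℕ)⟩

lemma realCoord_digit (d : Finset (Fin m × Bool) × Fin 4) (j : Fin m × Bool) :
    realCoord j (digit d).ζ = if j ∈ d.1 then 1 else 0 := by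
  simp [digit, realCoord_sum, realCoord_realUnit]

lemma realCoord_digit_mem (d : Finset (Fin m × Bool) × Fin 4) (j : Fin m × Bool) :
    realCoord j (digit d).ζ ∈ Icc (0 : ℝ) 1 := by
  rw [realCoord_digit]
  split_ifs <;> simp

lemma mem_integerLattice {g : Heis m} : g ∈ integerLattice m ↔
    (∀ j, ∃ n : ℤ, realCoord j g.ζ = n) ∧ ∃ c : ℤ, g.u = c := by
  rw [← isIntegral_iff]
  rfl

lemma digit_mem (d : Finset (Fin m × Bool) × Fin 4) : digit d ∈ integerLattice m := by
  refine mem_integerLattice.2 ⟨fun j => ?_, (d.2 : ℕ), by simp [digit]⟩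
  rw [realCoord_digit]
  split_ifs
  · exact ⟨1, by simp⟩
  · exact ⟨0, by simp⟩

lemma dilation_two_mem {g : Heis m} (hg : g ∈ integerLattice m) :
    dilation 2 g ∈ integerLattice m := by
  rw [mem_integerLattice] at hg ⊢
  obtain ⟨h1, c, hc⟩ := hg
  refine ⟨fun j => ?_, 4 * c, ?_⟩
  · obtain ⟨n, hn⟩ := h1 j
    exact ⟨2 * n, by simp [dilation, realCoord_smul, hn]⟩
  · simp [dilation, hc]
    norm_num

/-- Every lattice element is a dilated lattice element times a digit. -/
lemma exists_eq_dilation_mul_digit {g : Heis m} (hg : g ∈ integerLattice m) :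
    ∃ h ∈ integerLattice m, ∃ d, g = dilation 2 h * digit d := by
  obtain ⟨h1, c, hc⟩ := mem_integerLattice.1 hg
  choose n hn using h1
  classical
  let s : Finset (Fin m × Bool) := Finset.univ.filter fun j => n j % 2 = 1
  let b : EuclideanSpace ℂ (Fin m) := ofRealCoord fun j => ((n j / 2 : ℤ) : ℝ)
  have hb : IsIntegral b := isIntegral_iff.2 fun j => ⟨n j / 2, by simp [b]⟩
  -- Parities give the horizontal digit. The product with δ₂(b, ·) then adds 2 Im⟨2b, digit⟩ = 4e to
  -- the vertical coordinate, whichever the vertical digit, so it is c − 4e that is divided by 4.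
  obtain ⟨e, he⟩ := hb.herm_im (digit_mem (s, 0)).1
  have hlt : ((c - 4 * e) % 4).toNat < 4 := by omega
  refine ⟨⟨b, ((c - 4 * e) / 4 : ℤ)⟩, ⟨hb, _, rfl⟩, (s, ⟨_, hlt⟩), ?_⟩
  ext1
  · refine ext_realCoord fun j => ?_
    rw [mul_ζ, realCoord_add, realCoord_digit, hn]
    simp only [dilation, realCoord_smul, b, realCoord_ofRealCoord]
    have h2 := Int.emod_add_mul_ediv (n j) 2
    by_cases hj : n j % 2 = 1
    · rw [if_pos (by simpa [s] using hj)]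
      rw [hj] at h2
      rw [add_comm]
      exact_mod_cast h2.symm
    · rw [if_neg (by simpa [s] using hj)]
      have h3 : n j % 2 = 0 := by omega
      rw [h3, zero_add] at h2
      rw [add_zero]
      exact_mod_cast h2.symm
  · rw [mul_u, hc]
    have hz : (digit (s, (⟨_, hlt⟩ : Fin 4)) : Heis m).ζ = (digit (s, 0) : Heis m).ζ := rfl
    simp only [hz, dilation, herm_smul_left, Complex.im_ofReal_mul, he]
    have h4 : (((c - 4 * e) % 4).toNat : ℤ) = (c - 4 * e) % 4 := Int.toNat_of_nonneg (by omega)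
    have h5 : ((digit (s, (⟨_, hlt⟩ : Fin 4)) : Heis m).u : ℝ) = (((c - 4 * e) % 4 : ℤ) : ℝ) := by
      exact congrArg (Int.cast : ℤ → ℝ) h4
    rw [h5]
    have h6 : c = 2 ^ 2 * ((c - 4 * e) / 4) + (c - 4 * e) % 4 + 2 * (2 * e) := by omega
    exact_mod_cast h6

/-- The maps of the iterated function system defining the tile. -/
noncomputable def contraction (d : Finset (Fin m × Bool) × Fin 4) (x : Heis m) : Heis m :=
  dilation (1 / 2) (digit d * x)

lemma dilation_two_contraction (d : Finset (Fin m × Bool) × Fin 4) (x : Heis m) :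
    dilation 2 (contraction d x) = digit d * x := by
  rw [contraction, dilation_dilation]
  norm_num [dilation_one]

lemma contraction_eq_iff {d : Finset (Fin m × Bool) × Fin 4} {x y : Heis m} :
    contraction d x = y ↔ digit d * x = dilation 2 y := by
  constructor
  · rintro rfl
    rw [dilation_two_contraction]
  · intro h
    rw [contraction, h, dilation_dilation]
    norm_num [dilation_one]

lemma realCoord_contraction (d : Finset (Fin m × Bool) × Fin 4) (x : Heis m) (j : Fin m × Bool) :
    2 * realCoord j (contraction d x).ζ = (if j ∈ d.1 then 1 else 0) + realCoord j x.ζ := by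
  rw [← realCoord_digit, ← realCoord_add, ← mul_ζ, ← dilation_two_contraction]
  simp [dilation, realCoord_smul]

lemma contraction_u (d : Finset (Fin m × Bool) × Fin 4) (x : Heis m) :
    4 * (contraction d x).u = (d.2 : ℕ) + x.u + 2 * (herm (digit d).ζ x.ζ).im := by
  have h1 : (digit d * x).u = (d.2 : ℕ) + x.u + 2 * (herm (digit d).ζ x.ζ).im := rfl
  rw [← h1, ← dilation_two_contraction]
  simp only [dilation]
  norm_num

/-- A compact box that is mapped into itself by the iterated function system. -/
def tileBox (m : ℕ) : Set (Heis m) :=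
  {x | (∀ j, realCoord j x.ζ ∈ Icc (0 : ℝ) 1) ∧ |x.u| ≤ m + 1}

/-- The height m + 1 of the box is chosen for this: 4|u'| ≤ 3 + (m + 1) + 2m ≤ 4(m + 1). -/
lemma contraction_mem_tileBox (d : Finset (Fin m × Bool) × Fin 4) {x : Heis m}
    (hx : x ∈ tileBox m) : contraction d x ∈ tileBox m := by
  constructor
  · intro j
    have h1 := realCoord_contraction d x j
    have h2 := hx.1 j
    constructor <;> split_ifs at h1 <;> linarith [h2.1, h2.2]
  · have h1 := contraction_u d x
    have h2 := abs_le.1 (abs_herm_im_le_of_mem_unit (realCoord_digit_mem d) hx.1)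
    have h3 := abs_le.1 hx.2
    have h4 : ((d.2 : ℕ) : ℝ) ≤ 3 := by exact_mod_cast Nat.lt_succ_iff.1 d.2.2
    have h5 : (0 : ℝ) ≤ ((d.2 : ℕ) : ℝ) := Nat.cast_nonneg _
    have h6 : (0 : ℝ) ≤ m := Nat.cast_nonneg _
    rw [abs_le]
    constructor <;> linarith

/-- The self-similar tile: the largest subset of the box that is covered by its images under the
iterated function system. -/
def tile (m : ℕ) : Set (Heis m) :=
  ⋃₀ {A | A ⊆ tileBox m ∧ A ⊆ ⋃ d, contraction d '' A}

lemma tile_subset_tileBox : tile m ⊆ tileBox m := sUnion_subset fun _ hA => hA.1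

lemma tile_subset_iUnion : tile m ⊆ ⋃ d, contraction d '' tile m := by
  refine sUnion_subset fun A hA => hA.2.trans ?_
  exact iUnion_mono fun d => image_mono (subset_sUnion_of_mem hA)

lemma subset_tile {A : Set (Heis m)} (h1 : A ⊆ tileBox m) (h2 : A ⊆ ⋃ d, contraction d '' A) :
    A ⊆ tile m := subset_sUnion_of_mem ⟨h1, h2⟩

/-- Knaster–Tarski: the union of the images of the tile is again a subset of the box covered by its
own images, so maximality puts it inside the tile. -/
lemma tile_eq_iUnion : tile m = ⋃ d, contraction d '' tile m := by
  refine subset_antisymm tile_subset_iUnion (subset_tile ?_ ?_)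
  · refine iUnion_subset fun d => ?_
    rintro _ ⟨x, hx, rfl⟩
    exact contraction_mem_tileBox d (tile_subset_tileBox hx)
  · exact iUnion_mono fun d => image_mono tile_subset_iUnion

lemma contraction_mem_tile (d : Finset (Fin m × Bool) × Fin 4) {x : Heis m} (hx : x ∈ tile m) :
    contraction d x ∈ tile m := by
  rw [tile_eq_iUnion]
  exact mem_iUnion.2 ⟨d, mem_image_of_mem _ hx⟩

lemma mem_tile_of_fixed {d : Finset (Fin m × Bool) × Fin 4} {x : Heis m} (hx : x ∈ tileBox m)
    (h : contraction d x = x) : x ∈ tile m := by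
  refine subset_tile (A := {x}) (by simpa using hx) ?_ rfl
  exact singleton_subset_iff.2 (mem_iUnion.2 ⟨d, x, rfl, h⟩)

/-- The fixed points of the contractions with at most one horizontal digit. -/
lemma fixed_mem_tile {s : Finset (Fin m × Bool)} {z : EuclideanSpace ℂ (Fin m)}
    (hs : (digit (s, 0) : Heis m).ζ = z) (c : Fin 4) :
    (⟨z, ((c : ℕ) : ℝ) / 3⟩ : Heis m) ∈ tile m := by
  subst hs
  have h3 : ((c : ℕ) : ℝ) ≤ 3 := by exact_mod_cast Nat.lt_succ_iff.1 c.2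
  -- The equation digit · x = δ₂ x gives ζ = 2ζ − z and c + u = 4u, hence u = c/3.
  refine mem_tile_of_fixed (d := (s, c)) ⟨realCoord_digit_mem _, ?_⟩ (contraction_eq_iff.2 ?_)
  · rw [abs_of_nonneg (by positivity)]
    have : (0 : ℝ) ≤ m := Nat.cast_nonneg _
    linarith
  · have hz : (digit (s, c) : Heis m).ζ = (digit (s, 0) : Heis m).ζ := rfl
    ext1
    · rw [mul_ζ, hz]
      simp only [dilation]
      module
    · rw [mul_u, hz, herm_self_im]
      simp only [dilation, digit]
      ring

lemma tile_nonempty : (tile m).Nonempty := ⟨_, fixed_mem_tile (s := ∅) rfl 0⟩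

lemma dilation_two_image_tile : dilation 2 '' tile m = ⋃ d, (fun x => digit d * x) '' tile m := by
  conv_lhs => rw [tile_eq_iUnion]
  rw [image_iUnion]
  refine iUnion_congr fun d => ?_
  rw [image_image]
  exact image_congr fun x _ => dilation_two_contraction d x

/-- Every point can be translated into the box by the lattice. -/
lemma exists_mem_tileBox (x : Heis m) : ∃ g ∈ integerLattice m, g⁻¹ * x ∈ tileBox m := by
  let a : EuclideanSpace ℂ (Fin m) := ofRealCoord fun j => (⌊realCoord j x.ζ⌋ : ℝ)
  let r : ℝ := x.u + 2 * (herm (-a) x.ζ).im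
  refine ⟨⟨a, (⌊r⌋ : ℝ)⟩, mem_integerLattice.2 ⟨fun j => ⟨⌊realCoord j x.ζ⌋, ?_⟩, ⌊r⌋, rfl⟩, ?_, ?_⟩
  · simp [a]
  · intro j
    rw [mul_ζ, inv_ζ, realCoord_add, realCoord_neg]
    simp only [a, realCoord_ofRealCoord]
    constructor <;> linarith [Int.floor_le (realCoord j x.ζ), Int.lt_floor_add_one (realCoord j x.ζ)]
  · have h : ((⟨a, (⌊r⌋ : ℝ)⟩ : Heis m)⁻¹ * x).u = r - ⌊r⌋ := by
      rw [mul_u, inv_ζ, inv_u]; simp only [r]; ring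
    have h6 : (0 : ℝ) ≤ m := Nat.cast_nonneg _
    rw [h, abs_le]
    constructor <;> linarith [Int.floor_le r, Int.lt_floor_add_one r]

/-! ### The tile over generic horizontal coordinates -/

/-- Over a point with irrational coordinates, the tile is contained in a unit interval. -/
lemma abs_sub_u_le_one {x y : Heis m} (hx : x ∈ tile m) (hy : y ∈ tile m) (hxy : x.ζ = y.ζ)
    (hirr : ∀ j, Irrational (realCoord j x.ζ)) : |x.u - y.u| ≤ 1 := by
  -- The horizontal digits of both points agree, hence 4(u − v) is a difference of vertical digits
  -- plus the difference one level down. The bound D therefore improves to (3 + D)/4, whose fixed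
  -- point is 1.
  have key : ∀ (n : ℕ) (x y : Heis m), x ∈ tile m → y ∈ tile m → x.ζ = y.ζ →
      (∀ j, Irrational (realCoord j x.ζ)) → |x.u - y.u| ≤ 1 + 2 * (m + 1) * (1 / 4) ^ n := by
    intro n
    induction n with
    | zero =>
      intro x y hx hy _ _
      have h1 := abs_le.1 (tile_subset_tileBox hx).2
      have h2 := abs_le.1 (tile_subset_tileBox hy).2
      rw [abs_le]
      constructor <;> linarith
    | succ n ih =>
      intro x y hx hy hxy hirr
      obtain ⟨d, x', hx', rfl⟩ := mem_iUnion.1 (tile_subset_iUnion hx)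
      obtain ⟨e, y', hy', rfl⟩ := mem_iUnion.1 (tile_subset_iUnion hy)
      have hX := realCoord_contraction d x'
      have hY := realCoord_contraction e y'
      have hirr' : ∀ j, Irrational (realCoord j x'.ζ) := fun j => by
        have h := (hirr j).natCast_mul two_ne_zero
        push_cast at h
        rw [hX] at h
        split_ifs at h with hj
        · have := h.sub_natCast 1
          simpa using this
        · simpa using h
      have hirr2 : ∀ j, Irrational (realCoord j y'.ζ) := fun j => by
        have h := (hirr j).natCast_mul two_ne_zero
        push_cast at h
        rw [hxy, hY] at h
        split_ifs at h with hj
        · have := h.sub_natCast 1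
          simpa using this
        · simpa using h
      -- Twice the coordinate is the digit plus a remainder in [0, 1]; irrationality excludes the
      -- remainder 1, so the digit is an integer part and is unique.
      have hde : ∀ j, j ∈ d.1 ↔ j ∈ e.1 := fun j => by
        have h1 := hX j
        rw [hxy, hY j] at h1
        have b1 := (tile_subset_tileBox hx').1 j
        have b2 := (tile_subset_tileBox hy').1 j
        have n1 := (hirr' j).ne_one
        have n2 := (hirr2 j).ne_one
        have l1 := lt_of_le_of_ne b1.2 n1
        have l2 := lt_of_le_of_ne b2.2 n2
        split_ifs at h1 with p q q
        · simp [p, q]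
        · linarith [b1.1, b2.1]
        · linarith [b1.1, b2.1]
        · simp [p, q]
      have hde' : d.1 = e.1 := Finset.ext hde
      have hxy' : x'.ζ = y'.ζ := ext_realCoord fun j => by
        have h1 := hX j
        rw [hxy, hY j, hde'] at h1
        linarith
      have hz : (digit d : Heis m).ζ = (digit e : Heis m).ζ := by simp only [digit, hde']
      have hu := contraction_u d x'
      have hv := contraction_u e y'
      rw [hz, hxy'] at hu
      have I := abs_le.1 (ih x' y' hx' hy' hxy' hirr')
      have h3 : ((d.2 : ℕ) : ℝ) ≤ 3 := by exact_mod_cast Nat.lt_succ_iff.1 d.2.2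
      have h4 : ((e.2 : ℕ) : ℝ) ≤ 3 := by exact_mod_cast Nat.lt_succ_iff.1 e.2.2
      have h5 : (0 : ℝ) ≤ ((d.2 : ℕ) : ℝ) := Nat.cast_nonneg _
      have h6 : (0 : ℝ) ≤ ((e.2 : ℕ) : ℝ) := Nat.cast_nonneg _
      rw [pow_succ, abs_le]
      constructor <;> linarith [I.1, I.2]
  have lim : Filter.Tendsto (fun n : ℕ => 1 + 2 * ((m : ℝ) + 1) * (1 / 4) ^ n) Filter.atTop
      (nhds (1 + 2 * ((m : ℝ) + 1) * 0)) :=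
    ((tendsto_pow_atTop_nhds_zero_of_lt_one (by norm_num) (by norm_num)).const_mul _).const_add _
  rw [mul_zero, add_zero] at lim
  exact ge_of_tendsto' lim fun n => key n x y hx hy hxy hirr

end Heis

namespace Heis

variable {m : ℕ}

/-! ### The tiling -/

/-- The integer coordinates of a lattice element. -/
noncomputable def latticeCoords (g : integerLattice m) : (Fin m × Bool → ℤ) × ℤ :=
  (fun j => ⌊realCoord j (g : Heis m).ζ⌋, ⌊(g : Heis m).u⌋)

lemma injective_latticeCoords : Function.Injective (latticeCoords (m := m)) := by
  intro g h hgh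
  obtain ⟨g1, c, hc⟩ := mem_integerLattice.1 g.2
  obtain ⟨h1, d, hd⟩ := mem_integerLattice.1 h.2
  have e1 := congrArg Prod.fst hgh
  have e2 := congrArg Prod.snd hgh
  apply Subtype.ext
  ext1
  · refine ext_realCoord fun j => ?_
    obtain ⟨p, hp⟩ := g1 j
    obtain ⟨q, hq⟩ := h1 j
    have := congrFun e1 j
    simp only [latticeCoords, hp, hq, Int.floor_intCast] at this
    rw [hp, hq, this]
  · simp only [latticeCoords, hc, hd, Int.floor_intCast] at e2
    rw [hc, hd, e2]

instance : Countable (integerLattice m) := injective_latticeCoords.countable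

/-- For a digit z these numbers are −1, 0 or 1, which limits the vertical shift when one horizontal
digit changes. -/
lemma herm_realUnit_im (z : EuclideanSpace ℂ (Fin m)) (i : Fin m) :
    (herm z (realUnit (i, false))).im = realCoord (i, true) z ∧
      (herm z (realUnit (i, true))).im = -realCoord (i, false) z := by
  constructor
  · simp [herm, realUnit, realCoord]
  · rw [herm, Finset.sum_eq_single i (fun l _ hl => by simp [realUnit, hl]) (by simp)]
    simp [realUnit, realCoord]

/-- A set that is constant on each first-level piece of the tile is constant on the tile. -/
lemma mem_iff_of_pieces {S : Set (Heis m)}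
    (h : ∀ d, ∀ x ∈ tile m, ∀ y ∈ tile m, contraction d x ∈ S ↔ contraction d y ∈ S)
    {x y : Heis m} (hx : x ∈ tile m) (hy : y ∈ tile m) : x ∈ S ↔ y ∈ S := by
  classical
  obtain ⟨k, hk⟩ := tile_nonempty (m := m)
  -- Two pieces that share a point carry the same value of membership in `S`. It remains to link all
  -- pieces by explicit common points.
  have glue : ∀ d e, ∀ x ∈ tile m, ∀ y ∈ tile m, digit d * x = digit e * y →
      (contraction d k ∈ S ↔ contraction e k ∈ S) := fun d e x hx y hy hxy => by
    rw [h d k hk x hx, h e k hk y hy, contraction, hxy, contraction]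
  have v0 : (⟨0, 0⟩ : Heis m) ∈ tile m := by
    simpa using fixed_mem_tile (s := (∅ : Finset (Fin m × Bool))) (z := 0) (by simp [digit]) 0
  have v1 : (⟨0, 1⟩ : Heis m) ∈ tile m := by
    simpa using fixed_mem_tile (s := (∅ : Finset (Fin m × Bool))) (z := 0) (by simp [digit]) 3
  -- The top (0, 1) of the tile in one piece is the bottom (0, 0) in the next one up; both are fixed
  -- points, of vertical digits 3 and 0.
  have vert : ∀ (s : Finset (Fin m × Bool)) (c c' : Fin 4), (c' : ℕ) = c + 1 →
      (contraction (s, c) k ∈ S ↔ contraction (s, c') k ∈ S) := fun s c c' hc =>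
    glue _ _ _ v1 _ v0 (by ext1 <;> simp [mul_ζ, mul_u, digit, hc, herm_zero_right])
  have vert0 : ∀ (s : Finset (Fin m × Bool)) (c : Fin 4),
      (contraction (s, c) k ∈ S ↔ contraction (s, 0) k ∈ S) := fun s c => by
    have h1 := vert s 0 1 rfl
    have h2 := vert s 1 2 rfl
    have h3 := vert s 2 3 rfl
    fin_cases c <;> simp only [Fin.zero_eta, Fin.mk_one, Fin.reduceFinMk] <;> tauto
  -- The point (e_j, 0), moved by the digit (s, 2), has height 2 + 2 Im, that is 0, 2 or 4. Starting
  -- from the vertical digit 2 keeps it within reach of the pieces over `insert j s`: height 4 is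
  -- the top of the piece with digit 3.
  have horiz : ∀ (j : Fin m × Bool) (s : Finset (Fin m × Bool)), j ∉ s →
      (contraction (insert j s, 0) k ∈ S ↔ contraction (s, 0) k ∈ S) := fun j s hj => by
    have hq : (⟨realUnit j, 0⟩ : Heis m) ∈ tile m := by
      simpa using fixed_mem_tile (s := {j}) (z := realUnit j) (by simp [digit]) 0
    have him : (herm (digit (s, 2)).ζ (realUnit j)).im = -1 ∨
        (herm (digit (s, 2)).ζ (realUnit j)).im = 0 ∨
        (herm (digit (s, 2)).ζ (realUnit j)).im = 1 := by
      rcases j with ⟨i, _ | _⟩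
      · rw [(herm_realUnit_im _ i).1, realCoord_digit]; split_ifs <;> simp
      · rw [(herm_realUnit_im _ i).2, realCoord_digit]; split_ifs <;> simp
    have hsum : ∀ c c' : Fin 4, (digit (s, c) : Heis m).ζ + realUnit j =
        (digit (insert j s, c')).ζ := fun c c' => by
      simp [digit, Finset.sum_insert hj, add_comm]
    rw [← vert0 s 2]
    rcases him with e | e | e
    · refine (glue (s, 2) (insert j s, 0) _ hq _ v0 ?_).symm
      ext1
      · simp [mul_ζ, hsum 2 0]
      · rw [mul_u, mul_u, e]; simp [digit, herm_zero_right]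
    · rw [← vert0 (insert j s) 2]
      refine (glue (s, 2) (insert j s, 2) _ hq _ v0 ?_).symm
      ext1
      · simp [mul_ζ, hsum 2 2]
      · rw [mul_u, mul_u, e]; simp [digit, herm_zero_right]
    · rw [← vert0 (insert j s) 3]
      refine (glue (s, 2) (insert j s, 3) _ hq _ v1 ?_).symm
      ext1
      · simp [mul_ζ, hsum 2 3]
      · rw [mul_u, mul_u, e]; simp [digit, herm_zero_right]; norm_num
  have all : ∀ s : Finset (Fin m × Bool),
      (contraction (s, 0) k ∈ S ↔ contraction (∅, 0) k ∈ S) := fun s => by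
    induction s using Finset.induction_on with
    | empty => rfl
    | insert j s hj ih => rw [horiz j s hj, ih]
  have key : ∀ x ∈ tile m, x ∈ S ↔ contraction (∅, 0) k ∈ S := fun x hx => by
    obtain ⟨⟨s, c⟩, x', hx', rfl⟩ := mem_iUnion.1 (tile_subset_iUnion hx)
    rw [h _ x' hx' k hk, vert0, all]
  rw [key x hx, key y hy]

/-- A left-invariant proper metric on the Heisenberg group, homogeneous for the dilations and
inducing the Euclidean topology. -/
structure IsHomogeneousMetric (m : ℕ) [MetricSpace (Heis m)] : Prop where
  dist_mul_left : ∀ g x y : Heis m, dist (g * x) (g * y) = dist x y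
  dist_dilation : ∀ s : ℝ, 0 < s → ∀ x y : Heis m,
    dist (dilation s x) (dilation s y) = s * dist x y
  continuous_coords : Continuous (coords : Heis m → EuclideanSpace ℂ (Fin m) × ℝ)
  continuous_mk : Continuous fun p : EuclideanSpace ℂ (Fin m) × ℝ => (⟨p.1, p.2⟩ : Heis m)
  properSpace : ProperSpace (Heis m)

namespace IsHomogeneousMetric

variable [MetricSpace (Heis m)] (H : IsHomogeneousMetric m)
include H

omit H in
lemma continuous_of_dist_eq {f : Heis m → Heis m} {k : ℝ}
    (h : ∀ x y, dist (f x) (f y) = k * dist x y) : Continuous f := by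
  refine (LipschitzWith.of_dist_le_mul (K := ‖k‖₊) fun x y => ?_).continuous
  rw [h, coe_nnnorm]
  exact mul_le_mul_of_nonneg_right (le_abs_self k) dist_nonneg

/-- Left translation as a homeomorphism. -/
noncomputable def mulLeftHomeomorph (g : Heis m) : Heis m ≃ₜ Heis m where
  toEquiv := Equiv.mulLeft g
  continuous_toFun := continuous_of_dist_eq (k := 1) fun x y => by
    simpa using H.dist_mul_left g x y
  continuous_invFun := continuous_of_dist_eq (k := 1) fun x y => by
    simpa using H.dist_mul_left g⁻¹ x y

lemma dist_contraction (d : Finset (Fin m × Bool) × Fin 4) (x y : Heis m) :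
    dist (contraction d x) (contraction d y) = 1 / 2 * dist x y := by
  rw [contraction, contraction, H.dist_dilation _ (by norm_num), H.dist_mul_left]

/-- The maps of the iterated function system as homeomorphisms. -/
noncomputable def contractionHomeomorph (d : Finset (Fin m × Bool) × Fin 4) :
    Heis m ≃ₜ Heis m where
  toFun := contraction d
  invFun x := (digit d)⁻¹ * dilation 2 x
  left_inv x := by simp [dilation_two_contraction]
  right_inv x := contraction_eq_iff.2 (by simp)
  continuous_toFun := continuous_of_dist_eq (H.dist_contraction d)
  continuous_invFun := continuous_of_dist_eq (k := 2) fun x y => by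
    rw [H.dist_mul_left, H.dist_dilation _ (by norm_num)]

lemma continuous_ζ : Continuous (ζ : Heis m → EuclideanSpace ℂ (Fin m)) :=
  continuous_fst.comp H.continuous_coords

lemma continuous_u : Continuous (u : Heis m → ℝ) :=
  continuous_snd.comp H.continuous_coords

/-! ### Compactness of the tile and properness of the lattice action -/

lemma isCompact_tileBox : IsCompact (tileBox m) := by
  have hc : IsCompact ((fun p : (Fin m × Bool → ℝ) × ℝ => (⟨ofRealCoord p.1, p.2⟩ : Heis m)) ''
      (Icc 0 1 ×ˢ Icc (-((m : ℝ) + 1)) (m + 1))) :=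
    (isCompact_Icc.prod isCompact_Icc).image
      (H.continuous_mk.comp ((continuous_ofRealCoord.comp continuous_fst).prodMk continuous_snd))
  convert hc
  ext x
  constructor
  · intro hx
    refine ⟨(fun j => realCoord j x.ζ, x.u), ⟨⟨fun j => (hx.1 j).1, fun j => (hx.1 j).2⟩,
      abs_le.1 hx.2⟩, ?_⟩
    simp only [ofRealCoord_realCoord]
  · rintro ⟨p, ⟨hp1, hp2⟩, rfl⟩
    exact ⟨fun j => by simpa using ⟨hp1.1 j, hp1.2 j⟩, abs_le.2 hp2⟩

/-- The closure of the tile is still covered by its images, a finite union of closed sets, and still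
lies in the box; maximality gives the rest. -/
lemma isClosed_tile : IsClosed (tile m) := by
  rw [← closure_subset_iff_isClosed]
  refine subset_tile ?_ ?_
  · exact closure_minimal tile_subset_tileBox H.isCompact_tileBox.isClosed
  · have hcl : IsClosed (⋃ d, contraction d '' closure (tile m)) :=
      isClosed_iUnion_of_finite fun d =>
        (H.contractionHomeomorph d).isClosed_image.2 isClosed_closure
    refine closure_minimal (tile_subset_iUnion.trans ?_) hcl
    exact iUnion_mono fun d => image_mono subset_closure

lemma isCompact_tile : IsCompact (tile m) :=
  H.isCompact_tileBox.of_isClosed_subset H.isClosed_tile tile_subset_tileBox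

/-- The integer lattice acts properly. -/
lemma finite_lattice_inter {C : Set (Heis m)} (hC : IsCompact C) :
    {g : integerLattice m | (((fun x : Heis m => g • x) '' C) ∩ C).Nonempty}.Finite := by
  -- A lattice element g is recovered continuously from x and g x. These differences range over
  -- compact sets, so the integer coordinates of g are bounded.
  have hc : IsCompact ((fun p : Heis m × Heis m => p.2.ζ - p.1.ζ) '' (C ×ˢ C)) :=
    (hC.prod hC).image ((H.continuous_ζ.comp continuous_snd).sub
      (H.continuous_ζ.comp continuous_fst))
  have hc2 : IsCompact ((fun p : Heis m × Heis m =>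
      p.2.u - p.1.u - 2 * (herm (p.2.ζ - p.1.ζ) p.1.ζ).im) '' (C ×ˢ C)) := by
    refine (hC.prod hC).image ?_
    have h1 := H.continuous_ζ
    have h2 := H.continuous_u
    have h3 : Continuous fun p : Heis m × Heis m => (herm (p.2.ζ - p.1.ζ) p.1.ζ).im :=
      continuous_herm_im.comp (((h1.comp continuous_snd).sub (h1.comp continuous_fst)).prodMk
        (h1.comp continuous_fst))
    fun_prop
  have hbd : ∀ j, ∃ R : ℝ, ∀ z ∈ (fun p : Heis m × Heis m => p.2.ζ - p.1.ζ) '' (C ×ˢ C),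
      |realCoord j z| ≤ R := fun j =>
    hc.exists_bound_of_continuousOn (continuous_realCoord j).continuousOn
  choose R hR using hbd
  obtain ⟨S, hS⟩ := hc2.exists_bound_of_continuousOn continuous_id.continuousOn
  refine Set.Finite.of_finite_image (f := latticeCoords) ?_ injective_latticeCoords.injOn
  refine ((Set.finite_Icc (fun j => -⌈R j⌉) (fun j => ⌈R j⌉)).prod
    (Set.finite_Icc (-⌈S⌉) ⌈S⌉)).subset ?_
  rintro _ ⟨g, ⟨_, ⟨x, hx, rfl⟩, hy⟩, rfl⟩
  have hy' : (g : Heis m) * x ∈ C := hy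
  have e1 : (g : Heis m).ζ = ((g : Heis m) * x).ζ - x.ζ := by simp [mul_ζ]
  have e2 : (g : Heis m).u = ((g : Heis m) * x).u - x.u
      - 2 * (herm (((g : Heis m) * x).ζ - x.ζ) x.ζ).im := by
    rw [← e1, mul_u]; ring
  have b1 : ∀ j, |realCoord j (g : Heis m).ζ| ≤ R j := fun j => by
    rw [e1]
    exact hR j _ ⟨(x, (g : Heis m) * x), ⟨hx, hy'⟩, rfl⟩
  have b2 : |(g : Heis m).u| ≤ S := by
    rw [e2]
    exact hS _ ⟨(x, (g : Heis m) * x), ⟨hx, hy'⟩, rfl⟩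
  have key : ∀ (n : ℤ) (t S : ℝ), t = n → |t| ≤ S → -⌈S⌉ ≤ ⌊t⌋ ∧ ⌊t⌋ ≤ ⌈S⌉ := by
    rintro n t S rfl h
    rw [Int.floor_intCast]
    have h' := abs_le.1 (h.trans (Int.le_ceil S))
    exact ⟨by exact_mod_cast h'.1, by exact_mod_cast h'.2⟩
  obtain ⟨g1, c, hc⟩ := mem_integerLattice.1 g.2
  refine ⟨⟨fun j => ?_, fun j => ?_⟩, key c _ S hc b2⟩
  · obtain ⟨n, hn⟩ := g1 j
    exact (key n _ (R j) hn (b1 j)).1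
  · obtain ⟨n, hn⟩ := g1 j
    exact (key n _ (R j) hn (b1 j)).2

/-! ### The translates of the tile cover, and the tile is the closure of its interior -/

lemma isClosed_smul_tile (g : integerLattice m) :
    IsClosed ((fun x : Heis m => g • x) '' tile m) :=
  (H.mulLeftHomeomorph (g : Heis m)).isClosed_image.2 H.isClosed_tile

lemma isClosed_iUnion_smul_tile :
    IsClosed (⋃ g : integerLattice m, (fun x : Heis m => g • x) '' tile m) := by
  have := H.properSpace
  refine LocallyFinite.isClosed_iUnion (fun x => ?_) H.isClosed_smul_tile
  refine ⟨Metric.closedBall x 1, Metric.closedBall_mem_nhds x one_pos, ?_⟩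
  refine (H.finite_lattice_inter ((isCompact_closedBall x 1).union H.isCompact_tile)).subset ?_
  rintro g ⟨y, ⟨k, hk, rfl⟩, hy⟩
  exact ⟨_, ⟨k, Or.inr hk, rfl⟩, Or.inl hy⟩

omit [MetricSpace (Heis m)] H in
-- If g = δ₂(h)·d then δ_{1/2}(g k) = h·δ_{1/2}(d k), and δ_{1/2}(d k) is again in the tile.
lemma half_mem_iUnion_smul_tile {x : Heis m}
    (hx : x ∈ ⋃ g : integerLattice m, (fun x : Heis m => g • x) '' tile m) :
    dilation (1 / 2) x ∈ ⋃ g : integerLattice m, (fun x : Heis m => g • x) '' tile m := by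
  obtain ⟨g, k, hk, rfl⟩ := mem_iUnion.1 hx
  obtain ⟨h, hh, d, hd⟩ := exists_eq_dilation_mul_digit g.2
  refine mem_iUnion.2 ⟨⟨h, hh⟩, _, contraction_mem_tile d hk, ?_⟩
  change h * contraction d k = dilation (1 / 2) ((g : Heis m) * k)
  rw [hd, mul_assoc, dilation_mul, dilation_dilation, contraction]
  norm_num [dilation_one]

lemma exists_dist_le_tileBox : ∃ D : ℝ, ∀ x ∈ tileBox m, ∀ y ∈ tileBox m, dist x y ≤ D :=
  ⟨_, fun _ hx _ hy => Metric.dist_le_diam_of_mem H.isCompact_tileBox.isBounded hx hy⟩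

omit [MetricSpace (Heis m)] H in
lemma tendsto_mul_half_pow (D : ℝ) :
    Filter.Tendsto (fun n : ℕ => D * (1 / 2 : ℝ) ^ n) Filter.atTop (nhds 0) := by
  simpa using (tendsto_pow_atTop_nhds_zero_of_lt_one (r := (1 / 2 : ℝ)) (by norm_num)
    (by norm_num)).const_mul D

omit H in
lemma mem_closure_of_dist_le {A : Set (Heis m)} {x : Heis m} {D : ℝ}
    (h : ∀ n : ℕ, ∃ y ∈ A, dist x y ≤ D * (1 / 2) ^ n) : x ∈ closure A := by
  refine Metric.mem_closure_iff.2 fun ε hε => ?_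
  obtain ⟨n, hn⟩ := ((tendsto_mul_half_pow D).eventually_lt_const hε).exists
  obtain ⟨y, hy, hxy⟩ := h n
  exact ⟨y, hy, hxy.trans_lt hn⟩

/-- Every point is within D of the union, by moving it into the box. Applying this to δ₂ x and
halving improves D to D/2, and so on; the union is closed, hence everything. -/
lemma iUnion_smul_tile : ⋃ g : integerLattice m, (fun x : Heis m => g • x) '' tile m = univ := by
  obtain ⟨k, hk⟩ := tile_nonempty (m := m)
  obtain ⟨D, hD⟩ := H.exists_dist_le_tileBox
  refine eq_univ_of_forall fun x => ?_
  rw [← H.isClosed_iUnion_smul_tile.closure_eq]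
  refine mem_closure_of_dist_le (D := D) fun n => ?_
  induction n generalizing x with
  | zero =>
    obtain ⟨g, hg, hgx⟩ := exists_mem_tileBox x
    refine ⟨g * k, mem_iUnion.2 ⟨⟨g, hg⟩, k, hk, rfl⟩, ?_⟩
    rw [← H.dist_mul_left g⁻¹, inv_mul_cancel_left, pow_zero, mul_one]
    exact hD _ hgx _ (tile_subset_tileBox hk)
  | succ n ih =>
    obtain ⟨y, hy, hxy⟩ := ih (dilation 2 x)
    refine ⟨_, half_mem_iUnion_smul_tile hy, ?_⟩
    have hx : x = dilation (1 / 2) (dilation 2 x) := by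
      rw [dilation_dilation]; norm_num [dilation_one]
    conv_lhs => rw [hx]
    rw [H.dist_dilation _ (by norm_num), pow_succ]
    linarith

/-- Baire category: countably many closed translates cover a complete space, so one of them has an
interior point, which is translated back. -/
lemma interior_tile_nonempty : (interior (tile m)).Nonempty := by
  have := H.properSpace
  obtain ⟨g, x, hx⟩ := nonempty_interior_of_iUnion_of_closed H.isClosed_smul_tile
    H.iUnion_smul_tile
  have e : interior ((fun x : Heis m => g • x) '' tile m) =
      (fun x : Heis m => g • x) '' interior (tile m) :=
    ((H.mulLeftHomeomorph (g : Heis m)).image_interior _).symm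
  rw [e] at hx
  obtain ⟨y, hy, -⟩ := hx
  exact ⟨y, hy⟩

/-- Compositions of n contractions are homeomorphisms preserving the tile. They put an interior
point in every piece of level n, whose diameter is at most D/2ⁿ. -/
lemma closure_interior_tile : closure (interior (tile m)) = tile m := by
  refine subset_antisymm (closure_minimal interior_subset H.isClosed_tile) fun x hx => ?_
  obtain ⟨k, hk⟩ := H.interior_tile_nonempty
  obtain ⟨D, hD⟩ := H.exists_dist_le_tileBox
  refine mem_closure_of_dist_le (D := D) fun n => ?_
  induction n generalizing x with
  | zero =>
    refine ⟨k, hk, ?_⟩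
    rw [pow_zero, mul_one]
    exact hD _ (tile_subset_tileBox hx) _ (tile_subset_tileBox (interior_subset hk))
  | succ n ih =>
    obtain ⟨d, x', hx', rfl⟩ := mem_iUnion.1 (tile_subset_iUnion hx)
    obtain ⟨y, hy, hxy⟩ := ih x' hx'
    refine ⟨contraction d y, ?_, ?_⟩
    · refine interior_maximal (t := contraction d '' interior (tile m)) ?_ ?_ ⟨y, hy, rfl⟩
      · rintro _ ⟨z, hz, rfl⟩
        exact contraction_mem_tile d (interior_subset hz)
      · exact (H.contractionHomeomorph d).isOpenMap _ isOpen_interior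
    · rw [H.dist_contraction, pow_succ]
      linarith

/-! ### Disjointness of the interiors -/

lemma exists_irrational_mem {U : Set (Heis m)} (hU : IsOpen U) {x : Heis m} (hx : x ∈ U) :
    ∃ y ∈ U, ∀ j, Irrational (realCoord j y.ζ) := by
  have hcont : Continuous fun f : Fin m × Bool → ℝ => (⟨ofRealCoord f, x.u⟩ : Heis m) :=
    H.continuous_mk.comp (continuous_ofRealCoord.prodMk continuous_const)
  have hdense : Dense (Set.pi univ fun _ : Fin m × Bool => {t : ℝ | Irrational t}) :=
    dense_pi univ fun _ _ => dense_irrational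
  obtain ⟨f, hf, hfi⟩ := hdense.exists_mem_open (hU.preimage hcont)
    ⟨fun j => realCoord j x.ζ, by simpa only [mem_preimage, ofRealCoord_realCoord] using hx⟩
  exact ⟨_, hfi, fun j => by simpa using hf j (mem_univ j)⟩

lemma disjoint_interior_smul_tile {g : integerLattice m} (hg : g ≠ 1) :
    Disjoint (interior (tile m)) (interior ((fun x : Heis m => g • x) '' tile m)) := by
  rw [Set.disjoint_left]
  intro x₀ h1 h2
  obtain ⟨x, ⟨hx1, hx2⟩, hirr⟩ := H.exists_irrational_mem (isOpen_interior.inter isOpen_interior)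
    (mem_inter h1 h2)
  obtain ⟨k, hk, hkx⟩ := interior_subset hx2
  have hkx' : (g : Heis m) * k = x := hkx
  obtain ⟨hgζ, c, hc⟩ := mem_integerLattice.1 g.2
  -- Each coordinate of x lies strictly between 0 and 1 and differs by an integer from one in [0,
  -- 1]: with x on the open side, only the integer 0 is possible.
  have hζ0 : (g : Heis m).ζ = 0 := ext_realCoord fun j => by
    obtain ⟨n, hn⟩ := hgζ j
    have e : realCoord j x.ζ = n + realCoord j k.ζ := by
      rw [← hkx', mul_ζ, realCoord_add, hn]
    have bx := (tile_subset_tileBox (interior_subset hx1)).1 j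
    have bk := (tile_subset_tileBox hk).1 j
    have x0 : realCoord j x.ζ ≠ 0 := (hirr j).ne_zero
    have x1 : realCoord j x.ζ ≠ 1 := (hirr j).ne_one
    have l0 := lt_of_le_of_ne bx.1 x0.symm
    have l1 := lt_of_le_of_ne bx.2 x1
    have n1 : (n : ℝ) < 1 := by linarith [bk.1]
    have n2 : (-1 : ℝ) < n := by linarith [bk.2]
    have n3 : n < 1 := by exact_mod_cast n1
    have n4 : -1 < n := by exact_mod_cast n2
    have : n = 0 := by omega
    rw [hn, this, realCoord_zero, Int.cast_zero]
  have hζ : k.ζ = x.ζ := by rw [← hkx', mul_ζ, hζ0, zero_add]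
  have hu : x.u = c + k.u := by
    rw [← hkx', mul_u, hζ0, herm_zero_left, hc]; simp
  have hc0 : c ≠ 0 := by
    rintro rfl
    exact hg (Subtype.ext (Heis.ext hζ0 (by rw [hc, Int.cast_zero]; rfl)))
  have hcont : Continuous fun s : ℝ => (⟨x.ζ, x.u + s⟩ : Heis m) :=
    H.continuous_mk.comp (continuous_const.prodMk (continuous_const.add continuous_id))
  have hmem : (fun s : ℝ => (⟨x.ζ, x.u + s⟩ : Heis m)) ⁻¹' interior (tile m) ∈ nhds (0 : ℝ) := by
    refine (isOpen_interior.preimage hcont).mem_nhds ?_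
    simpa only [mem_preimage, add_zero] using hx1
  obtain ⟨ε, hε, hball⟩ := Metric.mem_nhds_iff.1 hmem
  -- The point x may be moved up and down within the tile, while k stays in the same fibre at signed
  -- height difference c. Since that fibre has diameter at most 1, |c| < 1.
  have bound : ∀ s : ℝ, |s| < ε → |c + s| ≤ 1 := fun s hs => by
    have h3 : (⟨x.ζ, x.u + s⟩ : Heis m) ∈ tile m :=
      interior_subset (hball (by simpa [Metric.mem_ball, Real.dist_eq] using hs))
    have := abs_sub_u_le_one h3 hk hζ.symm hirr
    rw [hu] at this
    convert this using 2
    ring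
  have b1 := abs_le.1 (bound (ε / 2) (by rw [abs_of_pos] <;> linarith))
  have b2 := abs_le.1 (bound (-(ε / 2)) (by rw [abs_neg, abs_of_pos] <;> linarith))
  have n3 : (c : ℝ) < 1 := by linarith [b1.2]
  have n4 : (-1 : ℝ) < c := by linarith [b2.1]
  have n5 : c < 1 := by exact_mod_cast n3
  have n6 : -1 < c := by exact_mod_cast n4
  omega

/-! ### Connectedness of the tile -/

lemma mem_iff_of_dist_le {D : ℝ} (hD : ∀ x ∈ tileBox m, ∀ y ∈ tileBox m, dist x y ≤ D) (n : ℕ) :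
    ∀ S : Set (Heis m), (∀ x ∈ tile m, ∀ y ∈ tile m, dist x y ≤ D * (1 / 2) ^ n →
      (x ∈ S ↔ y ∈ S)) → ∀ x ∈ tile m, ∀ y ∈ tile m, (x ∈ S ↔ y ∈ S) := by
  induction n with
  | zero =>
    intro S hS x hx y hy
    refine hS x hx y hy ?_
    rw [pow_zero, mul_one]
    exact hD _ (tile_subset_tileBox hx) _ (tile_subset_tileBox hy)
  | succ n ih =>
    intro S hS x hx y hy
    refine mem_iff_of_pieces (fun d => ?_) hx hy
    -- Pulling back by a contraction doubles the scale at which membership is locally constant;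
    -- after n steps that scale exceeds the diameter of the tile.
    refine ih (contraction d ⁻¹' S) fun x hx y hy hxy => ?_
    refine hS _ (contraction_mem_tile d hx) _ (contraction_mem_tile d hy) ?_
    rw [H.dist_contraction, pow_succ]
    linarith

/-- Two closed sets separating the compact tile would be at positive distance; membership in one of
them would then be constant at a small scale, hence on the whole tile. -/
lemma isConnected_tile : IsConnected (tile m) := by
  refine ⟨tile_nonempty, isPreconnected_closed_iff.2 fun t t' ht ht' hsub ⟨x, hx, hxt⟩
    ⟨y, hy, hyt⟩ => ?_⟩
  by_contra hcon
  rw [Set.not_nonempty_iff_eq_empty] at hcon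
  have hdisj : Disjoint (tile m ∩ t) (tile m ∩ t') := by
    rw [Set.disjoint_left]
    rintro z ⟨hz, hz1⟩ ⟨_, hz2⟩
    exact hcon.subset ⟨hz, hz1, hz2⟩
  obtain ⟨r, hr, hlt⟩ := Metric.exists_pos_forall_lt_edist (H.isCompact_tile.inter_right ht)
    (H.isClosed_tile.inter ht') hdisj
  obtain ⟨D, hD⟩ := H.exists_dist_le_tileBox
  obtain ⟨n, hn⟩ := ((tendsto_mul_half_pow D).eventually_lt_const
    (NNReal.coe_pos.2 hr)).exists
  have far : ∀ a ∈ tile m ∩ t, ∀ b ∈ tile m ∩ t', (r : ℝ) < dist a b := fun a ha b hb => by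
    have := hlt a ha b hb
    rw [edist_nndist, ENNReal.coe_lt_coe] at this
    exact_mod_cast this
  have near : ∀ a ∈ tile m, ∀ b ∈ tile m, dist a b ≤ D * (1 / 2) ^ n → a ∈ t → b ∈ t :=
    fun a ha b hb hab hat => by
      by_contra hbt
      have := far a ⟨ha, hat⟩ b ⟨hb, (hsub hb).resolve_left hbt⟩
      linarith
  have := H.mem_iff_of_dist_le hD n t fun a ha b hb hab =>
    ⟨near a ha b hb hab, near b hb a ha (by rwa [dist_comm])⟩
  have hyt2 : y ∈ t := (this x hx y hy).1 hxt
  exact hcon.subset ⟨hy, hyt2, hyt⟩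

omit [MetricSpace (Heis m)] H in
lemma nonempty_continuousLinearEquiv (m : ℕ) :
    Nonempty ((EuclideanSpace ℂ (Fin m) × ℝ) ≃L[ℝ] EuclideanSpace ℝ (Fin (2 * m + 1))) := by
  refine FiniteDimensional.nonempty_continuousLinearEquiv_of_finrank_eq ?_
  rw [Module.finrank_prod, finrank_real_of_complex]
  simp

/-- The integer lattice, the dilation by `2` and the self-similar tile form a stacked tiling. -/
theorem isStackedTiling :
    IsStackedTiling (2 * m + 1) (integerLattice m) (dilation (m := m) 2) 2 (tile m) where
  complete := by
    have := H.properSpace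
    infer_instance
  homeomorphic := by
    obtain ⟨e⟩ := nonempty_continuousLinearEquiv m
    let f : Heis m ≃ₜ EuclideanSpace ℂ (Fin m) × ℝ :=
      { toFun := coords
        invFun := fun p => ⟨p.1, p.2⟩
        left_inv := fun _ => rfl
        right_inv := fun _ => rfl
        continuous_toFun := H.continuous_coords
        continuous_invFun := H.continuous_mk }
    exact ⟨f.trans e.toHomeomorph⟩
  faithful g hg := Subtype.ext (by simpa [Subgroup.smul_def] using hg 1)
  isometric g x y := H.dist_mul_left g x y
  proper _ hC := H.finite_lattice_inter hC
  tile_compact := H.isCompact_tile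
  tile_connected := H.isConnected_tile
  tile_domain := H.closure_interior_tile
  cover := H.iUnion_smul_tile
  disjoint_interiors _ hg := H.disjoint_interior_smul_tile hg
  one_lt_factor := one_lt_two
  surjective x := ⟨dilation (1 / 2) x, by rw [dilation_dilation]; norm_num [dilation_one]⟩
  homothety := H.dist_dilation 2 two_pos
  conjugation g := ⟨⟨dilation 2 g, dilation_two_mem g.2⟩, fun x => dilation_mul 2 g x⟩
  finite_subdivision := by
    refine ⟨range fun d => ⟨digit d, digit_mem d⟩, finite_range _, ?_⟩
    rw [dilation_two_image_tile, biUnion_range]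
    rfl

end IsHomogeneousMetric

lemma isHomogeneousMetric_of_edist_eq {B : LinearMap.BilinForm ℝ (EuclideanSpace ℂ (Fin m))}
    [MetricSpace (Heis m)] (hed : ∀ x y : Heis m, edist x y = ccEDist B x y) (hm : 1 ≤ m)
    (hB_pos : ∀ v, v ≠ 0 → 0 < B v v) : IsHomogeneousMetric m where
  dist_mul_left := dist_mul_left hed
  dist_dilation _ hs := dist_dilation hed hs
  continuous_coords := continuous_coords hed hB_pos
  continuous_mk := continuous_mk hed hm
  properSpace := properSpace hed hm hB_pos

end Heis

/-! ### The Siegel model in horospherical coordinates -/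

section Siegel

variable {m : ℕ}

lemma siegelForm_apply (z w : Fin (m + 2) → ℂ) : siegelForm m z w =
    z 0 * conj (w 1) + z 1 * conj (w 0) + ∑ i : Fin m, z i.succ.succ * conj (w i.succ.succ) := rfl

lemma siegelForm_conj (z w : Fin (m + 2) → ℂ) : conj (siegelForm m z w) = siegelForm m w z := by
  simp only [siegelForm_apply, map_add, map_mul, Complex.conj_conj, map_sum, mul_comm]
  ring

lemma siegelForm_smul_smul (a b : ℂ) (z w : Fin (m + 2) → ℂ) :
    siegelForm m (a • z) (b • w) = a * conj b * siegelForm m z w := by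
  rw [LinearMap.map_smulₛₗ, LinearMap.map_smulₛₗ, LinearMap.smul_apply]
  simp only [smul_eq_mul, RingHom.id_apply]
  ring

lemma siegelVector_zero (p : Heis m × PosReal) : siegelVector p 0 = 1 := rfl

lemma siegelVector_one (p : Heis m × PosReal) : siegelVector p 1 =
    -((p.2 : ℝ) : ℂ) - ((‖p.1.ζ‖ ^ 2 : ℝ) : ℂ) + (p.1.u : ℂ) * Complex.I := rfl

lemma siegelVector_succ_succ (p : Heis m × PosReal) (i : Fin m) :
    siegelVector p i.succ.succ = ((√2 : ℝ) : ℂ) * p.1.ζ i := rfl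

/-- The square of the vertical coordinate. -/
def PosReal.sq (t : PosReal) : PosReal := ⟨(t : ℝ) ^ 2, pow_pos (mem_Ioi.1 t.2) 2⟩

lemma PosReal.coe_sq (t : PosReal) : (t.sq : ℝ) = (t : ℝ) ^ 2 := rfl

lemma horosphericalSqrt_eq (p : Heis m × PosReal) :
    horosphericalSqrt p = horospherical (p.1, p.2.sq) := rfl

lemma horospherical_val (p : Heis m × PosReal) :
    (horospherical p).1 = Projectivization.mk ℂ (siegelVector p) (siegelVector_ne_zero p) := rfl

theorem injective_horosphericalSqrt : Function.Injective (horosphericalSqrt (m := m)) := by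
  intro p q h
  have h1 := congrArg Subtype.val h
  rw [horosphericalSqrt_eq, horosphericalSqrt_eq, horospherical_val, horospherical_val,
    Projectivization.mk_eq_mk_iff'] at h1
  obtain ⟨a, ha⟩ := h1
  have h0 := congrFun ha 0
  -- The lifts are normalised by their first coordinate 1, so proportional lifts are equal.
  rw [Pi.smul_apply, siegelVector_zero, siegelVector_zero, smul_eq_mul, mul_one] at h0
  rw [h0, one_smul] at ha
  have hζ : p.1.ζ = q.1.ζ := by
    ext i
    have := congrFun ha i.succ.succ
    rw [siegelVector_succ_succ, siegelVector_succ_succ] at this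
    exact (mul_left_cancel₀ (by simp) this).symm
  have h2 := congrFun ha 1
  rw [siegelVector_one, siegelVector_one] at h2
  have hre := congrArg Complex.re h2
  have him := congrArg Complex.im h2
  simp [PosReal.coe_sq, hζ, -Complex.ofReal_pow] at hre him
  have ht : (p.2 : ℝ) = q.2 := by
    have hp := mem_Ioi.1 p.2.2
    have hq := mem_Ioi.1 q.2.2
    nlinarith
  exact Prod.ext (Heis.ext hζ him.symm) (Subtype.ext ht)

theorem surjective_horosphericalSqrt : Function.Surjective (horosphericalSqrt (m := m)) := by
  rintro ⟨p, hp⟩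
  set z := p.rep with hz
  have hre : ∀ w : Fin (m + 2) → ℂ, (siegelForm m w w).re =
      2 * (w 0 * conj (w 1)).re + ∑ i : Fin m, Complex.normSq (w i.succ.succ) := fun w => by
    rw [siegelForm_apply]
    simp [Complex.mul_conj]
    ring
  -- If z₀ = 0 only the nonnegative terms of J remain, against J(z, z) < 0.
  have hz0 : z 0 ≠ 0 := by
    intro h0
    rw [hre, h0] at hp
    have : 0 ≤ ∑ i : Fin m, Complex.normSq (z i.succ.succ) :=
      Finset.sum_nonneg fun i _ => Complex.normSq_nonneg _
    simp at hp
    linarith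
  set w : Fin (m + 2) → ℂ := (z 0)⁻¹ • z with hw
  have hw0 : w 0 = 1 := by simp [hw, hz0]
  have hneg : (siegelForm m w w).re < 0 := by
    rw [hw, siegelForm_smul_smul, Complex.mul_conj, Complex.re_ofReal_mul]
    exact mul_neg_of_pos_of_neg (Complex.normSq_pos.2 (inv_ne_zero hz0)) hp
  have hs2 : ((√2 : ℝ) : ℂ) ≠ 0 := by simp
  let ζ : EuclideanSpace ℂ (Fin m) := WithLp.toLp 2 fun i => w i.succ.succ / ((√2 : ℝ) : ℂ)
  have hnorm : 2 * ‖ζ‖ ^ 2 = ∑ i : Fin m, Complex.normSq (w i.succ.succ) := by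
    rw [EuclideanSpace.norm_sq_eq, Finset.mul_sum]
    refine Finset.sum_congr rfl fun i _ => ?_
    simp [ζ, div_pow, Complex.normSq_eq_norm_sq, abs_of_nonneg]
    ring
  rw [hre, hw0, one_mul, Complex.conj_re, ← hnorm] at hneg
  have hv : 0 < -(w 1).re - ‖ζ‖ ^ 2 := by linarith
  let q : Heis m × PosReal := (⟨ζ, (w 1).im⟩, ⟨√(-(w 1).re - ‖ζ‖ ^ 2), Real.sqrt_pos.2 hv⟩)
  refine ⟨q, Subtype.ext ?_⟩
  have hq : siegelVector (q.1, q.2.sq) = w := by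
    ext i
    refine Fin.cases ?_ (fun j => Fin.cases ?_ (fun k => ?_) j) i
    · rw [siegelVector_zero, hw0]
    · change siegelVector (q.1, q.2.sq) 1 = w 1
      rw [siegelVector_one, PosReal.coe_sq, Real.sq_sqrt hv.le]
      apply Complex.ext <;> simp [q, -Complex.ofReal_pow]
    · rw [siegelVector_succ_succ]
      exact mul_div_cancel₀ _ hs2
  rw [horosphericalSqrt_eq, horospherical_val]
  refine Eq.trans ?_ (Projectivization.mk_rep p)
  rw [Projectivization.mk_eq_mk_iff']
  exact ⟨(z 0)⁻¹, by rw [hq]⟩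

theorem bijective_horosphericalSqrt : Function.Bijective (horosphericalSqrt (m := m)) :=
  ⟨injective_horosphericalSqrt, surjective_horosphericalSqrt⟩

/-- `cosh²` of the hyperbolic distance of two points of heights `t` and `t'` whose Heisenberg
coordinates differ by `x`. -/
noncomputable def coshSqDist (x : Heis m) (t t' : ℝ) : ℝ :=
  ((t ^ 2 + t' ^ 2 + ‖x.ζ‖ ^ 2) ^ 2 + x.u ^ 2) / (4 * t ^ 2 * t' ^ 2)

/-- The lifts are adapted to the group law: J depends only on q⁻¹p and the heights, the imaginary
part of ⟨ζ, ζ'⟩ entering exactly as in the Heisenberg product. Invariance under left translations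
results. -/
lemma siegelForm_siegelVector_siegelVector (p q : Heis m × PosReal) :
    siegelForm m (siegelVector p) (siegelVector q) =
      ((-(p.2 + q.2 + ‖(q.1⁻¹ * p.1).ζ‖ ^ 2) : ℝ) : ℂ) + (((q.1⁻¹ * p.1).u : ℝ) : ℂ) * Complex.I := by
  have h2 : ((√2 : ℝ) : ℂ) * ((√2 : ℝ) : ℂ) = 2 := by
    rw [← Complex.ofReal_mul, Real.mul_self_sqrt (by norm_num)]; simp
  have hs : ∑ i : Fin m, ((√2 : ℝ) : ℂ) * p.1.ζ i * conj (((√2 : ℝ) : ℂ) * q.1.ζ i)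
      = 2 * Heis.herm p.1.ζ q.1.ζ := by
    rw [Heis.herm, Finset.mul_sum]
    refine Finset.sum_congr rfl fun i _ => ?_
    rw [map_mul, Complex.conj_ofReal, ← h2]
    ring
  have hn : ‖(q.1⁻¹ * p.1).ζ‖ ^ 2 =
      ‖p.1.ζ‖ ^ 2 + ‖q.1.ζ‖ ^ 2 - 2 * (Heis.herm p.1.ζ q.1.ζ).re := by
    rw [Heis.mul_ζ, Heis.inv_ζ, neg_add_eq_sub, @norm_sub_sq ℂ, Heis.herm_eq_inner,
      ← inner_conj_symm, RCLike.re_eq_complex_re, Complex.conj_re]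
    ring
  have hu : (q.1⁻¹ * p.1).u = p.1.u - q.1.u + 2 * (Heis.herm p.1.ζ q.1.ζ).im := by
    rw [Heis.mul_u, Heis.inv_u, Heis.inv_ζ, Heis.herm_neg_left, Complex.neg_im,
      Heis.herm_im_swap p.1.ζ]
    ring
  rw [siegelForm_apply]
  simp only [siegelVector_zero, siegelVector_one, siegelVector_succ_succ]
  rw [hs, hn, hu]
  apply Complex.ext
  · simp [-Complex.ofReal_pow]; ring
  · simp [-Complex.ofReal_pow]; ring

lemma hypDist_horosphericalSqrt (p q : Heis m × PosReal) :
    NegativePoints.hypDist (horosphericalSqrt p) (horosphericalSqrt q) =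
      Real.arcosh √(coshSqDist (q.1⁻¹ * p.1) p.2 q.2) := by
  obtain ⟨a, ha⟩ := Projectivization.exists_smul_eq_mk_rep ℂ (siegelVector (p.1, p.2.sq))
    (siegelVector_ne_zero _)
  obtain ⟨b, hb⟩ := Projectivization.exists_smul_eq_mk_rep ℂ (siegelVector (q.1, q.2.sq))
    (siegelVector_ne_zero _)
  rw [NegativePoints.hypDist, horosphericalSqrt_eq, horosphericalSqrt_eq, horospherical_val,
    horospherical_val, ← ha, ← hb]
  simp only [Units.smul_def, siegelForm_smul_smul]
  have ha0 : (a : ℂ) ≠ 0 := a.ne_zero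
  have hb0 : (b : ℂ) ≠ 0 := b.ne_zero
  have ha1 : conj (a : ℂ) ≠ 0 := by simp
  have hb1 : conj (b : ℂ) ≠ 0 := by simp
  have hp : ((p.2 : ℝ) : ℂ) ≠ 0 := Complex.ofReal_ne_zero.2 (mem_Ioi.1 p.2.2).ne'
  have hq : ((q.2 : ℝ) : ℂ) ≠ 0 := Complex.ofReal_ne_zero.2 (mem_Ioi.1 q.2.2).ne'
  congr 2
  rw [← siegelForm_conj (siegelVector (p.1, p.2.sq)), siegelForm_siegelVector,
    siegelForm_siegelVector, ← Complex.ofReal_re (coshSqDist _ _ _)]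
  congr 1
  have hnum : siegelForm m (siegelVector (p.1, p.2.sq)) (siegelVector (q.1, q.2.sq)) *
      conj (siegelForm m (siegelVector (p.1, p.2.sq)) (siegelVector (q.1, q.2.sq))) =
      ((((p.2 : ℝ) ^ 2 + (q.2 : ℝ) ^ 2 + ‖(q.1⁻¹ * p.1).ζ‖ ^ 2) ^ 2 + (q.1⁻¹ * p.1).u ^ 2 : ℝ) : ℂ) := by
    rw [Complex.mul_conj, siegelForm_siegelVector_siegelVector, Complex.normSq_add_mul_I]
    simp only [PosReal.coe_sq]
    congr 1
    ring
  rw [show ∀ S : ℂ, (a : ℂ) * conj (b : ℂ) * S * (b * conj (a : ℂ) * conj S) =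
    a * conj (b : ℂ) * b * conj (a : ℂ) * (S * conj S) from fun S => by ring, hnum]
  rw [coshSqDist]
  simp only [PosReal.coe_sq]
  push_cast
  field_simp
  norm_num

lemma hypDist_smul (g : Heis m) (p q : Heis m × PosReal) :
    NegativePoints.hypDist (horosphericalSqrt (g * p.1, p.2)) (horosphericalSqrt (g * q.1, q.2)) =
      NegativePoints.hypDist (horosphericalSqrt p) (horosphericalSqrt q) := by
  simp only [hypDist_horosphericalSqrt]
  rw [mul_inv_rev, mul_assoc, inv_mul_cancel_left]

lemma Heis.dilation_inv (s : ℝ) (g : Heis m) : dilation s g⁻¹ = (dilation s g)⁻¹ := by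
  ext1 <;> simp [dilation, inv_ζ, inv_u]

lemma coshSqDist_dilation {s : ℝ} (hs : 0 < s) (x : Heis m) (t t' : ℝ) :
    coshSqDist (Heis.dilation s x) (s * t) (s * t') = coshSqDist x t t' := by
  simp only [coshSqDist, Heis.dilation, norm_smul, Real.norm_eq_abs, mul_pow, sq_abs]
  rw [← mul_div_mul_left _ (4 * t ^ 2 * t' ^ 2) (pow_pos hs 4).ne']
  congr 1 <;> ring

lemma hypDist_dilation {s : ℝ} (hs : 0 < s) (p q : Heis m × PosReal) :
    NegativePoints.hypDist (horosphericalSqrt (Heis.dilation s p.1, PosReal.scale s hs p.2))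
      (horosphericalSqrt (Heis.dilation s q.1, PosReal.scale s hs q.2)) =
      NegativePoints.hypDist (horosphericalSqrt p) (horosphericalSqrt q) := by
  simp only [hypDist_horosphericalSqrt]
  rw [← Heis.dilation_inv, ← Heis.dilation_mul, PosReal.scale, PosReal.scale,
    coshSqDist_dilation hs]

lemma one_le_coshSqDist (x : Heis m) {t t' : ℝ} (ht : 0 < t) (ht' : 0 < t') :
    1 ≤ coshSqDist x t t' := by
  rw [coshSqDist, one_le_div (by positivity)]
  nlinarith [sq_nonneg (t ^ 2 - t' ^ 2), sq_nonneg ‖x.ζ‖, sq_nonneg x.u,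
    mul_nonneg (sq_nonneg ‖x.ζ‖) (add_nonneg (sq_nonneg t) (sq_nonneg t')), sq_nonneg (‖x.ζ‖ ^ 2)]

end Siegel

/-! ### The hyperbolic metric in horospherical coordinates: lower bound for lengths -/

section LowerBound

variable {m : ℕ}

/-- The squared norm of the tangent vector `v` at the point with coordinates `x = (ζ, u, t)`. -/
noncomputable def hypNormSq (x v : EuclideanSpace ℂ (Fin m) × ℝ × ℝ) : ℝ :=
  (‖v.1‖ ^ 2 + v.2.2 ^ 2) / x.2.2 ^ 2 +
    (v.2.1 - 2 * (Heis.herm x.1 v.1).im) ^ 2 / (4 * x.2.2 ^ 4)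

lemma hypNormSq_nonneg (x v : EuclideanSpace ℂ (Fin m) × ℝ × ℝ) : 0 ≤ hypNormSq x v := by
  unfold hypNormSq
  positivity

/-- Cauchy–Schwarz in which the third product is known only through a bound; it will be a pairing of
vectors. -/
lemma three_term_cauchy_schwarz {a₁ b₁ a₂ b₂ x p q : ℝ} (hp : 0 ≤ p) (hq : 0 ≤ q)
    (hx : x ^ 2 ≤ p * q) :
    (a₁ * b₁ + a₂ * b₂ + x) ^ 2 ≤ (a₁ ^ 2 + a₂ ^ 2 + p) * (b₁ ^ 2 + b₂ ^ 2 + q) := by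
  set y := a₁ * b₁ + a₂ * b₂
  set α := a₁ ^ 2 + a₂ ^ 2
  set β := b₁ ^ 2 + b₂ ^ 2
  have hα : 0 ≤ α := by positivity
  have hβ : 0 ≤ β := by positivity
  have hy : y ^ 2 ≤ α * β := by
    simp only [y, α, β]
    nlinarith [sq_nonneg (a₁ * b₂ - a₂ * b₁)]
  have h1 : (2 * (y * x)) ^ 2 ≤ (α * q + p * β) ^ 2 := by
    have : (y * x) ^ 2 ≤ (α * β) * (p * q) := by
      rw [mul_pow]
      exact mul_le_mul hy hx (sq_nonneg x) (by positivity)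
    nlinarith [sq_nonneg (α * q - p * β)]
  have h2 := abs_le_of_sq_le_sq h1 (by positivity)
  nlinarith [(le_abs_self _).trans h2]

/-- This is |d'| ≤ speed in terms of F = cosh² d: the left side is F'² and d(cosh² d) = 2 cosh d
sinh d · dd, whence the factor 4F(F − 1). Here η and τ are the ζ and t velocities, and θ is the
value of the contact form. -/
lemma coshSq_deriv_sq_le (D η : EuclideanSpace ℂ (Fin m)) (δ θ τ : ℝ) {t t' : ℝ} (ht : 0 < t)
    (ht' : 0 < t') {A F : ℝ} (hA : A = t ^ 2 + t' ^ 2 + ‖D‖ ^ 2)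
    (hF : F = (A ^ 2 + δ ^ 2) / (4 * t ^ 2 * t' ^ 2)) :
    ((2 * A * (2 * t * τ + 2 * (Heis.herm D η).re) + 2 * δ * (θ + 2 * (Heis.herm D η).im)) /
      (4 * t ^ 2 * t' ^ 2) - 2 * τ / t * F) ^ 2 ≤
      4 * F * (F - 1) * ((‖η‖ ^ 2 + τ ^ 2) / t ^ 2 + θ ^ 2 / (4 * t ^ 4)) := by
  set r := (Heis.herm D η).re
  set i := (Heis.herm D η).im
  have hri : r ^ 2 + i ^ 2 ≤ ‖D‖ ^ 2 * ‖η‖ ^ 2 := by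
    have h1 : r ^ 2 + i ^ 2 = ‖Heis.herm D η‖ ^ 2 := by
      rw [Complex.sq_norm, Complex.normSq_apply]; ring
    rw [h1, ← mul_pow, Heis.herm_eq_inner, mul_comm]
    gcongr
    exact norm_inner_le_norm _ _
  have hF0 : 0 ≤ F := by rw [hF]; positivity
  have hF4 : A ^ 2 + δ ^ 2 = 4 * t ^ 2 * t' ^ 2 * F := by rw [hF]; field_simp
  have hS : (A * r + δ * i) ^ 2 ≤ 4 * t ^ 2 * t' ^ 2 * F * (‖D‖ ^ 2 * ‖η‖ ^ 2) := by
    calc (A * r + δ * i) ^ 2 ≤ (A ^ 2 + δ ^ 2) * (r ^ 2 + i ^ 2) := by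
          nlinarith [sq_nonneg (A * i - δ * r)]
      _ ≤ (A ^ 2 + δ ^ 2) * (‖D‖ ^ 2 * ‖η‖ ^ 2) := by gcongr
      _ = _ := by rw [hF4]
  have hx : ((A * r + δ * i) / (t ^ 2 * t' ^ 2)) ^ 2 ≤
      (4 * F * ‖D‖ ^ 2 / t' ^ 2) * (‖η‖ ^ 2 / t ^ 2) := by
    rw [div_pow, div_le_iff₀ (by positivity)]
    refine hS.trans (le_of_eq ?_)
    field_simp
  -- F' is grouped as a linear form in θ/(2t²), τ/t and η/t; the squared norms of its coefficients
  -- sum to at most 4F(F − 1), by `e2`.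
  have key := three_term_cauchy_schwarz (a₁ := δ / t' ^ 2) (b₁ := θ / (2 * t ^ 2))
    (a₂ := A / t' ^ 2 - 2 * F) (b₂ := τ / t) (by positivity) (by positivity) hx
  have e1 : δ / t' ^ 2 * (θ / (2 * t ^ 2)) + (A / t' ^ 2 - 2 * F) * (τ / t) +
      (A * r + δ * i) / (t ^ 2 * t' ^ 2) =
      (2 * A * (2 * t * τ + 2 * r) + 2 * δ * (θ + 2 * i)) /
      (4 * t ^ 2 * t' ^ 2) - 2 * τ / t * F := by
    field_simp
    ring
  have e2 : (δ / t' ^ 2) ^ 2 + (A / t' ^ 2 - 2 * F) ^ 2 + 4 * F * ‖D‖ ^ 2 / t' ^ 2 =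
      4 * F * (F - 1) := by
    have : (δ / t' ^ 2) ^ 2 + (A / t' ^ 2) ^ 2 = 4 * t ^ 2 * F / t' ^ 2 := by
      rw [div_pow, div_pow, ← add_div, add_comm, hF4]
      field_simp
    have h3 : ‖D‖ ^ 2 = A - t ^ 2 - t' ^ 2 := by rw [hA]; ring
    rw [h3]
    have : (δ / t' ^ 2) ^ 2 = 4 * t ^ 2 * F / t' ^ 2 - (A / t' ^ 2) ^ 2 := by linarith
    rw [this]
    field_simp
    ring
  have e3 : (θ / (2 * t ^ 2)) ^ 2 + (τ / t) ^ 2 + ‖η‖ ^ 2 / t ^ 2 =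
      (‖η‖ ^ 2 + τ ^ 2) / t ^ 2 + θ ^ 2 / (4 * t ^ 4) := by
    field_simp
    ring
  rwa [e1, e2, e3] at key

/-- A regularised arcosh: arcosh itself is not differentiable at 1, the value at the start of the
curve and at any return to its initial point. -/
lemma hasDerivAt_log_add_sqrt {ε x : ℝ} (hε : 0 < ε) (hx : 1 ≤ x) :
    HasDerivAt (fun x => Real.log (x + √(x ^ 2 - 1 + ε))) (1 / √(x ^ 2 - 1 + ε)) x := by
  have hpos : 0 < x ^ 2 - 1 + ε := by nlinarith
  have hs : 0 < √(x ^ 2 - 1 + ε) := Real.sqrt_pos.2 hpos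
  have h1 : HasDerivAt (fun x : ℝ => x ^ 2 - 1 + ε) (2 * x) x := by
    simpa using ((hasDerivAt_pow 2 x).sub_const 1).add_const ε
  have h2 := ((hasDerivAt_id x).add (h1.sqrt hpos.ne')).log (by simp only [Pi.add_apply, id]; positivity)
  refine h2.congr_deriv ?_
  simp only [Pi.add_apply, id]
  field_simp
  ring

/-- A function that grows at most as fast as `cosh` of twice the arc length. -/
lemma ofReal_log_sub_le {h h' v : ℝ → ℝ} {ε : ℝ} (hε : 0 < ε)
    (hC : ContDiffOn ℝ 1 h (Icc 0 1)) (h1 : ∀ s ∈ Icc (0 : ℝ) 1, 1 ≤ h s)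
    (hd : ∀ s ∈ Ioo (0 : ℝ) 1, HasDerivAt h (h' s) s)
    (hle : ∀ s ∈ Ioo (0 : ℝ) 1, |h' s| ≤ 2 * √(h s ^ 2 - 1) * v s) (hv : ∀ s, 0 ≤ v s) :
    ENNReal.ofReal (Real.log (h 1 + √(h 1 ^ 2 - 1 + ε)) - Real.log (h 0 + √(h 0 ^ 2 - 1 + ε))) ≤
      2 * ∫⁻ s in Icc (0 : ℝ) 1, ENNReal.ofReal (v s) := by
  have hpos : ∀ s ∈ Icc (0 : ℝ) 1, 0 < h s ^ 2 - 1 + ε := fun s hs => by nlinarith [h1 s hs]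
  let G : ℝ → ℝ := fun s => Real.log (h s + √(h s ^ 2 - 1 + ε))
  have hG : ContDiffOn ℝ 1 G (Icc 0 1) := by
    refine ContDiffOn.log (hC.add (ContDiffOn.sqrt
      (((hC.pow 2).sub contDiffOn_const).add contDiffOn_const) fun s hs => (hpos s hs).ne')) ?_
    intro s hs
    have := h1 s hs
    positivity
  have hAC : AbsolutelyContinuousOnInterval G 0 1 :=
    ContDiffOn.absolutelyContinuousOnInterval (by rwa [uIcc_of_le zero_le_one])
  have hbound : ∀ᵐ s ∂(volume.restrict (Icc (0 : ℝ) 1)),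
      ‖deriv G s‖ₑ ≤ 2 * ENNReal.ofReal (v s) := by
    rw [← restrict_Ioo_eq_restrict_Icc]
    filter_upwards [ae_restrict_mem measurableSet_Ioo] with s hs
    have hs' := Ioo_subset_Icc_self hs
    have hder : HasDerivAt G (1 / √(h s ^ 2 - 1 + ε) * h' s) s :=
      (hasDerivAt_log_add_sqrt hε (h1 s hs')).comp s (hd s hs)
    have hsq := Real.sqrt_pos.2 (hpos s hs')
    rw [hder.deriv, ← ofReal_norm, ← ENNReal.ofReal_ofNat 2, ← ENNReal.ofReal_mul (by norm_num)]
    refine ENNReal.ofReal_le_ofReal ?_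
    rw [Real.norm_eq_abs, abs_mul, abs_of_pos (by positivity), one_div, inv_mul_le_iff₀ hsq]
    refine (hle s hs).trans ?_
    have : √(h s ^ 2 - 1) ≤ √(h s ^ 2 - 1 + ε) := Real.sqrt_le_sqrt (by linarith)
    nlinarith [mul_le_mul_of_nonneg_right this (hv s)]
  have key := hAC.enorm_sub_le_lintegral hbound (t := 1) ⟨zero_le_one, le_rfl⟩
  rw [lintegral_const_mul' _ _ (by simp)] at key
  refine le_trans ?_ key
  rw [← ofReal_norm]
  exact ENNReal.ofReal_le_ofReal (le_abs_self _)

/-- Let ε tend to 0 in the regularised estimate; only h 1 and h 0 = 1 depend on the limit, not the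
integral. -/
lemma ofReal_arcosh_le {h h' v : ℝ → ℝ} (h0 : h 0 = 1)
    (hC : ContDiffOn ℝ 1 h (Icc 0 1)) (h1 : ∀ s ∈ Icc (0 : ℝ) 1, 1 ≤ h s)
    (hd : ∀ s ∈ Ioo (0 : ℝ) 1, HasDerivAt h (h' s) s)
    (hle : ∀ s ∈ Ioo (0 : ℝ) 1, |h' s| ≤ 2 * √(h s ^ 2 - 1) * v s) (hv : ∀ s, 0 ≤ v s) :
    ENNReal.ofReal (Real.arcosh (h 1)) ≤ 2 * ∫⁻ s in Icc (0 : ℝ) 1, ENNReal.ofReal (v s) := by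
  let f : ℝ → ℝ := fun ε =>
    Real.log (h 1 + √(h 1 ^ 2 - 1 + ε)) - Real.log (h 0 + √(h 0 ^ 2 - 1 + ε))
  have hf0 : f 0 = Real.arcosh (h 1) := by simp [f, Real.arcosh, h0]
  have hcont : ContinuousAt f 0 := by
    have h11 := h1 1 ⟨zero_le_one, le_rfl⟩
    refine ContinuousAt.sub (ContinuousAt.log (by fun_prop) ?_) (ContinuousAt.log (by fun_prop) ?_)
    · positivity
    · rw [h0]; positivity
  rw [← hf0]
  refine le_of_tendsto ((ENNReal.continuous_ofReal.continuousAt.comp hcont).mono_left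
    (nhdsWithin_le_nhds (s := Ioi 0))) ?_
  filter_upwards [self_mem_nhdsWithin] with ε hε
  exact ofReal_log_sub_le hε hC h1 hd hle hv

/-- The identity cosh 2d = 2 cosh² d − 1 replaces cosh d, which needs a square root, by the rational
function 2F − 1. -/
lemma arcosh_two_mul_sub_one {F : ℝ} (hF : 1 ≤ F) :
    Real.arcosh (2 * F - 1) = 2 * Real.arcosh √F := by
  have h1 : 1 ≤ √F := Real.one_le_sqrt.2 hF
  have h2 : 2 * F - 1 = Real.cosh (2 * Real.arcosh √F) := by
    rw [Real.cosh_two_mul, Real.sinh_sq, Real.cosh_arcosh h1, Real.sq_sqrt (by linarith)]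
    ring
  rw [h2, Real.arcosh_cosh (mul_nonneg two_pos.le (Real.arcosh_nonneg h1))]

lemma real_inner_eq_herm_re (z w : EuclideanSpace ℂ (Fin m)) :
    inner ℝ z w = (Heis.herm z w).re := by
  simp only [PiLp.inner_apply, Heis.herm, Complex.inner, Complex.re_sum]
  refine Finset.sum_congr rfl fun i _ => ?_
  simp
  ring

/-- The length of a curve is at least the hyperbolic distance of its end points. -/
theorem ofReal_arcosh_coshSqDist_le {c : ℝ → EuclideanSpace ℂ (Fin m) × ℝ × ℝ}
    (hc : ContDiffOn ℝ 1 c (Icc 0 1)) (hpos : ∀ s ∈ Icc (0 : ℝ) 1, 0 < (c s).2.2)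
    {x y : Heis m} {t t' : ℝ} (h0 : c 0 = (x.ζ, x.u, t)) (h1 : c 1 = (y.ζ, y.u, t')) :
    ENNReal.ofReal (Real.arcosh √(coshSqDist (x⁻¹ * y) t' t)) ≤
      ∫⁻ s in Icc (0 : ℝ) 1, ENNReal.ofReal √(hypNormSq (c s) (derivWithin c (Icc 0 1) s)) := by
  have ht : 0 < t := by simpa [h0] using hpos 0 ⟨le_rfl, zero_le_one⟩
  have ht' : 0 < t' := by simpa [h1] using hpos 1 ⟨zero_le_one, le_rfl⟩
  let D : ℝ → EuclideanSpace ℂ (Fin m) := fun s => (c s).1 - x.ζ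
  let δ : ℝ → ℝ := fun s => (c s).2.1 - x.u - 2 * (Heis.herm x.ζ (c s).1).im
  let A : ℝ → ℝ := fun s => (c s).2.2 ^ 2 + t ^ 2 + ‖D s‖ ^ 2
  -- F(s) is cosh² of the distance from the initial point to c(s); D and δ are the coordinates of
  -- x⁻¹·c(s).
  let F : ℝ → ℝ := fun s => (A s ^ 2 + δ s ^ 2) / (4 * (c s).2.2 ^ 2 * t ^ 2)
  have hF : ∀ s, F s = coshSqDist (x⁻¹ * ⟨(c s).1, (c s).2.1⟩) (c s).2.2 t := fun s => by
    simp only [F, A, D, δ, coshSqDist, Heis.mul_ζ, Heis.mul_u, Heis.inv_ζ, Heis.inv_u,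
      Heis.herm_neg_left, Complex.neg_im]
    rw [neg_add_eq_sub]
    congr 2
    ring
  have hF1 : ∀ s ∈ Icc (0 : ℝ) 1, 1 ≤ F s := fun s hs => by
    rw [hF]
    exact one_le_coshSqDist _ (hpos s hs) ht
  have hF0 : F 0 = 1 := by
    simp only [F, A, D, δ, h0, Heis.herm_self_im]
    field_simp
    norm_num
    ring
  have hFy : F 1 = coshSqDist (x⁻¹ * y) t' t := by rw [hF, h1]
  have hc1 : ContDiffOn ℝ 1 (fun s => (c s).1) (Icc 0 1) := contDiff_fst.comp_contDiffOn hc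
  have hc2 : ContDiffOn ℝ 1 (fun s => (c s).2.1) (Icc 0 1) :=
    (contDiff_fst.comp contDiff_snd).comp_contDiffOn hc
  have hc3 : ContDiffOn ℝ 1 (fun s => (c s).2.2) (Icc 0 1) :=
    (contDiff_snd.comp contDiff_snd).comp_contDiffOn hc
  have hCF : ContDiffOn ℝ 1 F (Icc 0 1) := by
    have hD : ContDiffOn ℝ 1 D (Icc 0 1) := hc1.sub contDiffOn_const
    have hδ : ContDiffOn ℝ 1 δ (Icc 0 1) := (hc2.sub contDiffOn_const).sub (contDiffOn_const.mul
      ((Heis.hermImCLM x.ζ).contDiff.comp_contDiffOn hc1))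
    have hA : ContDiffOn ℝ 1 A (Icc 0 1) :=
      ((hc3.pow 2).add contDiffOn_const).add (hD.norm_sq ℝ)
    refine ((hA.pow 2).add (hδ.pow 2)).div ((contDiffOn_const.mul (hc3.pow 2)).mul
      contDiffOn_const) fun s hs => ?_
    have := hpos s hs
    positivity
  let F' : ℝ → ℝ := fun s =>
    (2 * A s * (2 * (c s).2.2 * (deriv c s).2.2 + 2 * (Heis.herm (D s) (deriv c s).1).re) +
      2 * δ s * (((deriv c s).2.1 - 2 * (Heis.herm (c s).1 (deriv c s).1).im) +
        2 * (Heis.herm (D s) (deriv c s).1).im)) /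
      (4 * (c s).2.2 ^ 2 * t ^ 2) - 2 * (deriv c s).2.2 / (c s).2.2 * F s
  have hdc : ∀ s ∈ Ioo (0 : ℝ) 1, HasDerivAt c (deriv c s) s := fun s hs =>
    ((hc.differentiableOn one_ne_zero).differentiableAt (Icc_mem_nhds hs.1 hs.2)).hasDerivAt
  have hdF : ∀ s ∈ Ioo (0 : ℝ) 1, HasDerivAt F (F' s) s := fun s hs => by
    have d1 : HasDerivAt (fun s => (c s).1) (deriv c s).1 s := (hdc s hs).fst
    have d2 : HasDerivAt (fun s => (c s).2.1) (deriv c s).2.1 s := (hdc s hs).snd.fst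
    have d3 : HasDerivAt (fun s => (c s).2.2) (deriv c s).2.2 s := (hdc s hs).snd.snd
    have dD : HasDerivAt D (deriv c s).1 s := d1.sub_const _
    have dδ : HasDerivAt δ _ s := (d2.sub_const x.u).sub
      (((Heis.hermImCLM x.ζ).hasFDerivAt.comp_hasDerivAt s d1).const_mul 2)
    have dA : HasDerivAt A _ s := ((d3.pow 2).add_const (t ^ 2)).add dD.norm_sq
    have hs0 := hpos s (Ioo_subset_Icc_self hs)
    have hne : 4 * (c s).2.2 ^ 2 * t ^ 2 ≠ 0 := by positivity
    refine (((dA.pow 2).add (dδ.pow 2)).div (((d3.pow 2).const_mul 4).mul_const (t ^ 2))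
      hne).congr_deriv ?_
    simp only [F', F, Pi.add_apply, Pi.pow_apply, real_inner_eq_herm_re, Heis.hermImCLM_apply]
    have hherm : (Heis.herm x.ζ (deriv c s).1).im =
        (Heis.herm (c s).1 (deriv c s).1).im - (Heis.herm (D s) (deriv c s).1).im := by
      have : x.ζ = (c s).1 + -D s := by simp [D]
      rw [this, Heis.herm_add_left, Heis.herm_neg_left, Complex.add_im, Complex.neg_im]
      ring
    rw [hherm]
    field_simp
    ring
  have hle : ∀ s ∈ Ioo (0 : ℝ) 1, |2 * F' s| ≤
      2 * √((2 * F s - 1) ^ 2 - 1) * √(hypNormSq (c s) (deriv c s)) := fun s hs => by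
    have hs0 := hpos s (Ioo_subset_Icc_self hs)
    have key := coshSq_deriv_sq_le (D s) (deriv c s).1 (δ s)
      ((deriv c s).2.1 - 2 * (Heis.herm (c s).1 (deriv c s).1).im) (deriv c s).2.2 hs0 ht
      (A := A s) (F := F s) rfl rfl
    -- With h = 2F − 1 one has h² − 1 = 4F(F − 1).
    have key' : F' s ^ 2 ≤ ((2 * F s - 1) ^ 2 - 1) * hypNormSq (c s) (deriv c s) := by
      refine key.trans (le_of_eq ?_)
      rw [hypNormSq]
      ring
    have hnn : 0 ≤ (2 * F s - 1) ^ 2 - 1 := by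
      nlinarith [hF1 s (Ioo_subset_Icc_self hs)]
    rw [abs_mul, abs_two, mul_assoc, ← Real.sqrt_mul hnn]
    exact mul_le_mul_of_nonneg_left (Real.abs_le_sqrt key') two_pos.le
  have main := ofReal_arcosh_le (h := fun s => 2 * F s - 1) (h' := fun s => 2 * F' s)
    (v := fun s => √(hypNormSq (c s) (deriv c s))) (by simp [hF0]; norm_num)
    ((contDiffOn_const.mul hCF).sub contDiffOn_const)
    (fun s hs => by linarith [hF1 s hs])
    (fun s hs => ((hdF s hs).const_mul 2).sub_const 1) hle (fun s => Real.sqrt_nonneg _)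
  rw [hFy, arcosh_two_mul_sub_one (one_le_coshSqDist _ ht' ht), ENNReal.ofReal_mul (by norm_num),
    ENNReal.ofReal_ofNat, ENNReal.mul_le_mul_iff_right (by simp) (by simp)] at main
  refine main.trans (le_of_eq ?_)
  -- Dropping the two endpoints turns the derivative within [0, 1] into the ordinary one.
  rw [← restrict_Ioo_eq_restrict_Icc]
  refine setLIntegral_congr_fun measurableSet_Ioo fun s hs => ?_
  rw [derivWithin_of_mem_nhds (Icc_mem_nhds hs.1 hs.2)]

end LowerBound

/-! ### Geodesics -/

section Geodesic

variable {m : ℕ}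

/-- The square of the absolute value of `1 + s l`. -/
noncomputable def rayDenom (l : ℂ) (s : ℝ) : ℝ := (1 + s * l.re) ^ 2 + (s * l.im) ^ 2

/-- The geodesic from the point `(0, 0, 1)` that is, in the unit ball, the radius with
direction `(l, η)`. -/
noncomputable def geodesicRay (l : ℂ) (η : EuclideanSpace ℂ (Fin m)) (s : ℝ) :
    EuclideanSpace ℂ (Fin m) × ℝ × ℝ :=
  (((s : ℂ) / (1 + s * l)) • η, 2 * l.im * s / rayDenom l s,
    √((1 - s ^ 2 * (‖l‖ ^ 2 + ‖η‖ ^ 2)) / rayDenom l s))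

lemma normSq_one_add_mul (l : ℂ) (s : ℝ) : Complex.normSq (1 + s * l) = rayDenom l s := by
  simp [Complex.normSq_apply, rayDenom]
  ring

lemma sq_norm_eq_re_im (l : ℂ) : ‖l‖ ^ 2 = l.re ^ 2 + l.im ^ 2 := by
  rw [Complex.sq_norm, Complex.normSq_apply]; ring

lemma rayDenom_pos {l : ℂ} (hl : ‖l‖ ^ 2 < 1) {s : ℝ} (hs : s ∈ Icc (0 : ℝ) 1) :
    0 < rayDenom l s := by
  have h1 : |l.re| < 1 := by
    rw [← abs_one, ← sq_lt_sq]
    nlinarith [sq_norm_eq_re_im l, sq_nonneg l.im]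
  have h2 : 0 < 1 + s * l.re := by
    have h3 : |s * l.re| ≤ |l.re| := by
      rw [abs_mul, abs_of_nonneg hs.1]
      exact mul_le_of_le_one_left (abs_nonneg _) hs.2
    linarith [neg_abs_le (s * l.re)]
  rw [rayDenom]
  positivity

lemma one_add_mul_ne_zero {l : ℂ} (hl : ‖l‖ ^ 2 < 1) {s : ℝ} (hs : s ∈ Icc (0 : ℝ) 1) :
    (1 + s * l : ℂ) ≠ 0 := by
  rw [← Complex.normSq_pos, normSq_one_add_mul]
  exact rayDenom_pos hl hs

lemma one_sub_sq_mul_pos {R : ℝ} (hR : R < 1) {s : ℝ} (hs : s ∈ Icc (0 : ℝ) 1) :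
    0 < 1 - s ^ 2 * R := by
  have : s ^ 2 ≤ 1 := by nlinarith [hs.1, hs.2]
  rcases le_total R 0 with h | h
  · nlinarith [mul_nonneg (sq_nonneg s) (neg_nonneg.2 h)]
  · nlinarith [mul_le_mul_of_nonneg_right this h]

lemma hasDerivAt_rayDenom (l : ℂ) (s : ℝ) :
    HasDerivAt (rayDenom l) (2 * l.re + 2 * s * ‖l‖ ^ 2) s := by
  have h1 : HasDerivAt (fun s : ℝ => 1 + s * l.re) l.re s := by
    simpa using ((hasDerivAt_id s).mul_const l.re).const_add 1
  have h2 : HasDerivAt (fun s : ℝ => s * l.im) l.im s := by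
    simpa using (hasDerivAt_id s).mul_const l.im
  refine ((h1.pow 2).add (h2.pow 2)).congr_deriv ?_
  rw [sq_norm_eq_re_im]
  push_cast
  ring

/-- The velocity of a geodesic ray. -/
noncomputable def geodesicRayVelocity (l : ℂ) (η : EuclideanSpace ℂ (Fin m)) (s : ℝ) :
    EuclideanSpace ℂ (Fin m) × ℝ × ℝ :=
  ((1 / (1 + s * l) ^ 2) • η, 2 * l.im * (1 - s ^ 2 * ‖l‖ ^ 2) / rayDenom l s ^ 2,
    -(l.re * (1 + s ^ 2 * (‖l‖ ^ 2 + ‖η‖ ^ 2)) + s * (‖l‖ ^ 2 + (‖l‖ ^ 2 + ‖η‖ ^ 2))) /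
      rayDenom l s ^ 2 / (geodesicRay l η s).2.2)

lemma hasDerivAt_geodesicRay {l : ℂ} {η : EuclideanSpace ℂ (Fin m)}
    (hR : ‖l‖ ^ 2 + ‖η‖ ^ 2 < 1) {s : ℝ} (hs : s ∈ Icc (0 : ℝ) 1) :
    HasDerivAt (geodesicRay l η) (geodesicRayVelocity l η s) s := by
  have hl : ‖l‖ ^ 2 < 1 := by nlinarith [sq_nonneg ‖η‖]
  have hn := rayDenom_pos hl hs
  have hQ := one_sub_sq_mul_pos hR hs
  have hne := one_add_mul_ne_zero hl hs
  refine HasDerivAt.prodMk ?_ (HasDerivAt.prodMk ?_ ?_)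
  · have h1 : HasDerivAt (fun s : ℝ => (s : ℂ)) 1 s := (hasDerivAt_id s).ofReal_comp
    have h2 : HasDerivAt (fun s : ℝ => (1 + s * l : ℂ)) l s := by
      simpa using (h1.mul_const l).const_add 1
    refine ((h1.div h2 hne).congr_deriv ?_).smul_const η
    congr 1
    ring
  · refine (((hasDerivAt_id s).const_mul (2 * l.im)).div (hasDerivAt_rayDenom l s)
      hn.ne').congr_deriv ?_
    congr 1
    simp only [id, rayDenom, sq_norm_eq_re_im]
    ring
  · have h1 : HasDerivAt (fun s : ℝ => 1 - s ^ 2 * (‖l‖ ^ 2 + ‖η‖ ^ 2))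
        (-(2 * s * (‖l‖ ^ 2 + ‖η‖ ^ 2))) s := by
      simpa using ((hasDerivAt_pow 2 s).mul_const (‖l‖ ^ 2 + ‖η‖ ^ 2)).const_sub 1
    have hsq : 0 < √((1 - s ^ 2 * (‖l‖ ^ 2 + ‖η‖ ^ 2)) / rayDenom l s) :=
      Real.sqrt_pos.2 (by positivity)
    refine ((h1.div (hasDerivAt_rayDenom l s) hn.ne').sqrt (div_pos hQ hn).ne').congr_deriv ?_
    simp only [geodesicRay, Pi.div_apply]
    generalize √((1 - s ^ 2 * (‖l‖ ^ 2 + ‖η‖ ^ 2)) / rayDenom l s) = q at hsq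
    field_simp
    simp only [rayDenom, sq_norm_eq_re_im]
    ring

lemma contDiffOn_geodesicRay {l : ℂ} {η : EuclideanSpace ℂ (Fin m)}
    (hR : ‖l‖ ^ 2 + ‖η‖ ^ 2 < 1) : ContDiffOn ℝ 1 (geodesicRay l η) (Icc 0 1) := by
  have hl : ‖l‖ ^ 2 < 1 := by nlinarith [sq_nonneg ‖η‖]
  have hden : ContDiffOn ℝ 1 (rayDenom l) (Icc 0 1) := by
    unfold rayDenom
    fun_prop
  have hof : ContDiffOn ℝ 1 (fun s : ℝ => (s : ℂ)) (Icc 0 1) :=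
    Complex.ofRealCLM.contDiff.contDiffOn
  refine ContDiffOn.prodMk ?_ (ContDiffOn.prodMk ?_ ?_)
  · simp only [div_eq_mul_inv]
    exact ((ContinuousLinearMap.toSpanSingleton ℂ η).restrictScalars ℝ).contDiff.comp_contDiffOn
      (hof.mul ((contDiffOn_const.add (hof.mul contDiffOn_const)).inv
        fun s hs => one_add_mul_ne_zero hl hs))
  · exact (contDiffOn_const.mul contDiffOn_id).div hden fun s hs => (rayDenom_pos hl hs).ne'
  · refine ContDiffOn.sqrt (ContDiffOn.div (by fun_prop) hden
      fun s hs => (rayDenom_pos hl hs).ne') fun s hs => ?_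
    exact (div_pos (one_sub_sq_mul_pos hR hs) (rayDenom_pos hl hs)).ne'

lemma geodesicRay_height_pos {l : ℂ} {η : EuclideanSpace ℂ (Fin m)}
    (hR : ‖l‖ ^ 2 + ‖η‖ ^ 2 < 1) {s : ℝ} (hs : s ∈ Icc (0 : ℝ) 1) :
    0 < (geodesicRay l η s).2.2 :=
  Real.sqrt_pos.2 (div_pos (one_sub_sq_mul_pos hR hs)
    (rayDenom_pos (by nlinarith [sq_nonneg ‖η‖]) hs))

lemma herm_geodesicRay_im {l : ℂ} (hl : ‖l‖ ^ 2 < 1) (η : EuclideanSpace ℂ (Fin m)) {s : ℝ}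
    (hs : s ∈ Icc (0 : ℝ) 1) :
    (Heis.herm (geodesicRay l η s).1 (geodesicRayVelocity l η s).1).im =
      s ^ 2 * l.im * ‖η‖ ^ 2 / rayDenom l s ^ 2 := by
  have hne := one_add_mul_ne_zero hl hs
  have hself : Heis.herm η η = ((‖η‖ ^ 2 : ℝ) : ℂ) := by
    rw [Heis.herm_eq_inner, inner_self_eq_norm_sq_to_K]
    simp
  have hc : ((1 + s * l) * conj (1 + s * l) : ℂ) = ((rayDenom l s : ℝ) : ℂ) := by
    rw [Complex.mul_conj, normSq_one_add_mul]
  have hne' : conj (1 + s * l : ℂ) ≠ 0 := (map_ne_zero _).2 hne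
  have : Heis.herm (geodesicRay l η s).1 (geodesicRayVelocity l η s).1 =
      ((s * ‖η‖ ^ 2 / rayDenom l s ^ 2 : ℝ) : ℂ) * (1 + s * l) := by
    simp only [geodesicRay, geodesicRayVelocity]
    rw [Heis.herm_eq_inner, inner_smul_left, inner_smul_right, ← Heis.herm_eq_inner, hself]
    rw [Complex.ofReal_div, Complex.ofReal_pow (rayDenom l s), ← hc, map_div₀, map_pow, map_one]
    push_cast
    field_simp
  rw [this, Complex.im_ofReal_mul]
  simp
  ring

/-- The speed depends only on the Euclidean length of (l, η): it is that of a radius of the unit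
ball. -/
lemma hypNormSq_geodesicRay {l : ℂ} {η : EuclideanSpace ℂ (Fin m)}
    (hR : ‖l‖ ^ 2 + ‖η‖ ^ 2 < 1) {s : ℝ} (hs : s ∈ Icc (0 : ℝ) 1) :
    hypNormSq (geodesicRay l η s) (geodesicRayVelocity l η s) =
      (‖l‖ ^ 2 + ‖η‖ ^ 2) / (1 - s ^ 2 * (‖l‖ ^ 2 + ‖η‖ ^ 2)) ^ 2 := by
  have hl : ‖l‖ ^ 2 < 1 := by nlinarith [sq_nonneg ‖η‖]
  have hn := rayDenom_pos hl hs
  have hQ := one_sub_sq_mul_pos hR hs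
  have hnorm : ‖(geodesicRayVelocity l η s).1‖ ^ 2 = ‖η‖ ^ 2 / rayDenom l s ^ 2 := by
    simp only [geodesicRayVelocity]
    rw [norm_smul, mul_pow, norm_div, norm_pow, norm_one, ← normSq_one_add_mul,
      Complex.normSq_eq_norm_sq]
    ring
  have ht2 : (geodesicRay l η s).2.2 ^ 2 = (1 - s ^ 2 * (‖l‖ ^ 2 + ‖η‖ ^ 2)) / rayDenom l s :=
    Real.sq_sqrt (by positivity)
  have ht4 : (geodesicRay l η s).2.2 ^ 4 =
      ((1 - s ^ 2 * (‖l‖ ^ 2 + ‖η‖ ^ 2)) / rayDenom l s) ^ 2 := by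
    rw [← ht2]; ring
  have hτ : (geodesicRayVelocity l η s).2.2 ^ 2 =
      (l.re * (1 + s ^ 2 * (‖l‖ ^ 2 + ‖η‖ ^ 2)) + s * (‖l‖ ^ 2 + (‖l‖ ^ 2 + ‖η‖ ^ 2))) ^ 2 /
      rayDenom l s ^ 4 / ((1 - s ^ 2 * (‖l‖ ^ 2 + ‖η‖ ^ 2)) / rayDenom l s) := by
    rw [← ht2]
    simp only [geodesicRayVelocity]
    rw [div_pow, div_pow, neg_sq, ← pow_mul]
  have hu : (geodesicRayVelocity l η s).2.1 =
    2 * l.im * (1 - s ^ 2 * ‖l‖ ^ 2) / rayDenom l s ^ 2 := rfl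
  rw [hypNormSq, hnorm, hτ, ht2, ht4, hu, herm_geodesicRay_im hl η hs]
  have key : (l.re * (1 + s ^ 2 * (‖l‖ ^ 2 + ‖η‖ ^ 2)) +
      s * (‖l‖ ^ 2 + (‖l‖ ^ 2 + ‖η‖ ^ 2))) ^ 2 +
      l.im ^ 2 * (1 - s ^ 2 * (‖l‖ ^ 2 + ‖η‖ ^ 2)) ^ 2 +
      (1 - s ^ 2 * (‖l‖ ^ 2 + ‖η‖ ^ 2)) * ‖η‖ ^ 2 * rayDenom l s =
      (‖l‖ ^ 2 + ‖η‖ ^ 2) * rayDenom l s ^ 2 := by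
    simp only [rayDenom, sq_norm_eq_re_im]
    ring
  rw [eq_div_iff (by positivity), ← mul_left_inj' (pow_pos hn 2).ne', ← key]
  field_simp
  ring

/-- The length of a geodesic ray. -/
lemma lintegral_geodesicRay {l : ℂ} {η : EuclideanSpace ℂ (Fin m)}
    (hR : ‖l‖ ^ 2 + ‖η‖ ^ 2 < 1) :
    ∫⁻ s in Icc (0 : ℝ) 1,
      ENNReal.ofReal √(hypNormSq (geodesicRay l η s) (geodesicRayVelocity l η s)) =
      ENNReal.ofReal (Real.arcosh √(1 / (1 - (‖l‖ ^ 2 + ‖η‖ ^ 2)))) := by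
  set R := ‖l‖ ^ 2 + ‖η‖ ^ 2
  have hR0 : 0 ≤ R := by positivity
  set ρ := √R
  have hρ0 : 0 ≤ ρ := Real.sqrt_nonneg _
  have hρ2 : ρ ^ 2 = R := Real.sq_sqrt hR0
  have hρ1 : ρ < 1 := by rw [Real.sqrt_lt' one_pos]; simpa using hR
  have e1 : ∫⁻ s in Icc (0 : ℝ) 1,
      ENNReal.ofReal √(hypNormSq (geodesicRay l η s) (geodesicRayVelocity l η s)) =
      ∫⁻ s in Icc (0 : ℝ) 1, ENNReal.ofReal (ρ / (1 - s ^ 2 * R)) := by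
    refine setLIntegral_congr_fun measurableSet_Icc fun s hs => ?_
    rw [hypNormSq_geodesicRay hR hs, Real.sqrt_div hR0,
      Real.sqrt_sq (one_sub_sq_mul_pos hR hs).le]
  have hcont : ContinuousOn (fun s : ℝ => ρ / (1 - s ^ 2 * R)) (Icc 0 1) :=
    continuousOn_const.div (by fun_prop) fun s hs => (one_sub_sq_mul_pos hR hs).ne'
  have hder : ∀ s ∈ Icc (0 : ℝ) 1, HasDerivAt
      (fun s => (Real.log (1 + ρ * s) - Real.log (1 - ρ * s)) / 2) (ρ / (1 - s ^ 2 * R)) s := by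
    intro s hs
    have hps : ρ * s < 1 := by nlinarith [hs.1, hs.2]
    have hps0 : 0 ≤ ρ * s := mul_nonneg hρ0 hs.1
    have h0 : HasDerivAt (fun s : ℝ => ρ * s) ρ s := by simpa using (hasDerivAt_id s).const_mul ρ
    refine ((((h0.const_add 1).log (by positivity)).sub
      ((h0.const_sub 1).log (by linarith))).div_const 2).congr_deriv ?_
    have h1 : 1 + ρ * s ≠ 0 := by positivity
    have h2 : 1 - ρ * s ≠ 0 := by linarith
    have h3 : 1 - s ^ 2 * R = (1 + ρ * s) * (1 - ρ * s) := by rw [← hρ2]; ring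
    rw [h3]
    field_simp
    ring
  -- The speed ρ/(1 − ρ²s²) integrates to artanh ρ, and cosh(artanh ρ) = 1/√(1 − ρ²).
  have e2 : ∫ s in Icc (0 : ℝ) 1, ρ / (1 - s ^ 2 * R) = Real.artanh ρ := by
    rw [integral_Icc_eq_integral_Ioc, ← intervalIntegral.integral_of_le zero_le_one,
      intervalIntegral.integral_eq_sub_of_hasDerivAt
        (by rwa [uIcc_of_le zero_le_one])
        (by rw [← uIcc_of_le (zero_le_one' ℝ)] at hcont; exact hcont.intervalIntegrable),
      Real.artanh_eq_half_log ⟨by linarith, hρ1.le⟩,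
      Real.log_div (by linarith) (by linarith)]
    simp
    ring
  rw [e1, ← ofReal_integral_eq_lintegral_ofReal (hcont.integrableOn_Icc) ?_, e2]
  · congr 1
    rw [← Real.arcosh_cosh (Real.artanh_nonneg hρ0), Real.cosh_artanh ⟨by linarith, hρ1⟩, hρ2,
      Real.sqrt_div zero_le_one, Real.sqrt_one]
  · filter_upwards [ae_restrict_mem measurableSet_Icc] with s hs
    exact div_nonneg hρ0 (one_sub_sq_mul_pos hR hs).le

/-- The point `(ζ, u, t)` is the end point of a geodesic ray from `(0, 0, 1)`. -/
lemma exists_geodesicRay_one_eq (x : Heis m) {t : ℝ} (ht : 0 < t) :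
    ∃ (l : ℂ) (η : EuclideanSpace ℂ (Fin m)), ‖l‖ ^ 2 + ‖η‖ ^ 2 < 1 ∧
      geodesicRay l η 1 = (x.ζ, x.u, t) ∧
      1 / (1 - (‖l‖ ^ 2 + ‖η‖ ^ 2)) = coshSqDist x t 1 := by
  set A := 1 + t ^ 2 + ‖x.ζ‖ ^ 2 with hA
  -- With z₁ = −t² − ‖ζ‖² + iu the second homogeneous coordinate, g = (1 − z₁)/2, so that l = g⁻¹ −
  -- 1 = (1 + z₁)/(1 − z₁) is a Cayley transform.
  let g : ℂ := ⟨A / 2, -x.u / 2⟩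
  have hA0 : 0 < A := by positivity
  have hN : Complex.normSq g = (A ^ 2 + x.u ^ 2) / 4 := by
    simp [g, Complex.normSq_apply]; ring
  have hN0 : 0 < (A ^ 2 + x.u ^ 2) / 4 := by positivity
  have hg : g ≠ 0 := Complex.normSq_pos.1 (hN ▸ hN0)
  have hR : 1 - (‖g⁻¹ - 1‖ ^ 2 + ‖g⁻¹ • x.ζ‖ ^ 2) = t ^ 2 / Complex.normSq g := by
    have h1 : g⁻¹ - 1 = g⁻¹ * (1 - g) := by field_simp
    have h2 : Complex.normSq (1 - g) = Complex.normSq g + 1 - A := by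
      simp [g, Complex.normSq_apply]; ring
    rw [h1, norm_smul, norm_mul, mul_pow, mul_pow, Complex.sq_norm, Complex.sq_norm,
      Complex.normSq_inv, h2]
    have := Complex.normSq_pos.2 hg
    field_simp
    rw [hA]
    ring
  have hden : rayDenom (g⁻¹ - 1) 1 = 1 / Complex.normSq g := by
    rw [← normSq_one_add_mul]
    simp
  refine ⟨g⁻¹ - 1, g⁻¹ • x.ζ, ?_, ?_, ?_⟩
  · have : 0 < t ^ 2 / Complex.normSq g := by rw [hN]; positivity
    linarith
  · rw [geodesicRay, one_pow, one_mul, hR, hden]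
    refine Prod.ext ?_ (Prod.ext ?_ ?_)
    · simp [smul_smul, hg]
    · simp [Complex.inv_im]
      have := Complex.normSq_pos.2 hg
      field_simp
      simp [g]
      ring
    · have := Complex.normSq_pos.2 hg
      rw [show t ^ 2 / Complex.normSq g / (1 / Complex.normSq g) = t ^ 2 by field_simp,
        Real.sqrt_sq ht.le]
  · rw [hR, hN, coshSqDist, one_div_div]
    rw [hA]
    field_simp
    ring

/-- The action of `(x, t₀)` on coordinates: the dilation with factor `t₀` followed by the left
translation by `x`. -/
noncomputable def coordsAction (x : Heis m) (t₀ : ℝ) (p : EuclideanSpace ℂ (Fin m) × ℝ × ℝ) :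
    EuclideanSpace ℂ (Fin m) × ℝ × ℝ :=
  (x.ζ + t₀ • p.1, x.u + t₀ ^ 2 * p.2.1 + 2 * t₀ * (Heis.herm x.ζ p.1).im, t₀ * p.2.2)

/-- The derivative of `coordsAction`. -/
noncomputable def coordsActionDeriv (x : Heis m) (t₀ : ℝ) (v : EuclideanSpace ℂ (Fin m) × ℝ × ℝ) :
    EuclideanSpace ℂ (Fin m) × ℝ × ℝ :=
  (t₀ • v.1, t₀ ^ 2 * v.2.1 + 2 * t₀ * (Heis.herm x.ζ v.1).im, t₀ * v.2.2)

/-- Translation leaves the contact form unchanged; dilation multiplies it by t₀² and dζ, dt and the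
height by t₀. -/
lemma hypNormSq_coordsAction (x : Heis m) {t₀ : ℝ} (ht₀ : 0 < t₀)
    (p v : EuclideanSpace ℂ (Fin m) × ℝ × ℝ) :
    hypNormSq (coordsAction x t₀ p) (coordsActionDeriv x t₀ v) = hypNormSq p v := by
  simp only [hypNormSq, coordsAction, coordsActionDeriv]
  rw [Heis.herm_add_left, Heis.herm_smul_left, Heis.herm_smul_right, Heis.herm_smul_right,
    norm_smul, Real.norm_eq_abs, abs_of_pos ht₀]
  simp only [Complex.add_im, Complex.im_ofReal_mul]
  congr 1
  · rw [mul_pow, mul_pow, mul_pow, ← mul_add, mul_div_mul_left _ _ (pow_pos ht₀ 2).ne']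
  · rw [mul_pow, mul_left_comm 4, ← mul_div_mul_left _ (4 * p.2.2 ^ 4) (pow_pos ht₀ 4).ne']
    congr 1
    ring

lemma hasDerivAt_coordsAction (x : Heis m) (t₀ : ℝ) {c : ℝ → EuclideanSpace ℂ (Fin m) × ℝ × ℝ}
    {c' : EuclideanSpace ℂ (Fin m) × ℝ × ℝ} {s : ℝ} (hc : HasDerivAt c c' s) :
    HasDerivAt (fun s => coordsAction x t₀ (c s)) (coordsActionDeriv x t₀ c') s := by
  have h1 : HasDerivAt (fun s => (c s).1) c'.1 s := hc.fst
  have h2 : HasDerivAt (fun s => (c s).2.1) c'.2.1 s := hc.snd.fst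
  have h3 : HasDerivAt (fun s => (c s).2.2) c'.2.2 s := hc.snd.snd
  refine HasDerivAt.prodMk ((h1.const_smul t₀).const_add x.ζ) (HasDerivAt.prodMk ?_
    (h3.const_mul t₀))
  exact ((h2.const_mul (t₀ ^ 2)).const_add x.u).add
    (((Heis.hermImCLM x.ζ).hasFDerivAt.comp_hasDerivAt s h1).const_mul (2 * t₀))

lemma contDiff_coordsAction (x : Heis m) (t₀ : ℝ) : ContDiff ℝ 1 (coordsAction x t₀) := by
  refine ContDiff.prodMk (by fun_prop) (ContDiff.prodMk (ContDiff.add (by fun_prop) ?_)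
    (by fun_prop))
  exact contDiff_const.mul ((Heis.hermImCLM x.ζ).contDiff.comp contDiff_fst)

/-- Any two points are joined by a curve whose length is their hyperbolic distance. -/
theorem exists_contDiffOn_lintegral_eq (x y : Heis m) {t t' : ℝ} (ht : 0 < t) (ht' : 0 < t') :
    ∃ c : ℝ → EuclideanSpace ℂ (Fin m) × ℝ × ℝ, ContDiffOn ℝ 1 c (Icc 0 1) ∧
      (∀ s ∈ Icc (0 : ℝ) 1, 0 < (c s).2.2) ∧ c 0 = (x.ζ, x.u, t) ∧ c 1 = (y.ζ, y.u, t') ∧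
      ∫⁻ s in Icc (0 : ℝ) 1, ENNReal.ofReal √(hypNormSq (c s) (derivWithin c (Icc 0 1) s)) =
        ENNReal.ofReal (Real.arcosh √(coshSqDist (x⁻¹ * y) t' t)) := by
  -- The isometry `coordsAction x t` sends (0, 0, 1) to (x, t), so the ray is aimed at the preimage
  -- of (y, t').
  obtain ⟨l, η, hR, h1, hF⟩ := exists_geodesicRay_one_eq (Heis.dilation t⁻¹ (x⁻¹ * y))
    (mul_pos (inv_pos.2 ht) ht')
  refine ⟨fun s => coordsAction x t (geodesicRay l η s),
    (contDiff_coordsAction x t).comp_contDiffOn (contDiffOn_geodesicRay hR),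
    fun s hs => mul_pos ht (geodesicRay_height_pos hR hs), ?_, ?_, ?_⟩
  · have : geodesicRay l η 0 = (0, 0, 1) := by simp [geodesicRay, rayDenom]
    simp [this, coordsAction, Heis.herm_zero_right]
  · simp only [h1, coordsAction, Heis.dilation, smul_smul, mul_inv_cancel₀ ht.ne', one_smul,
      mul_inv_cancel_left₀ ht.ne', Heis.herm_smul_right, Complex.im_ofReal_mul]
    simp only [Heis.mul_ζ, Heis.mul_u, Heis.inv_ζ, Heis.inv_u, Heis.herm_add_right,
      Heis.herm_neg_left, Heis.herm_neg_right, Complex.add_im, Complex.neg_im, Heis.herm_self_im]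
    refine Prod.ext (by simp) (Prod.ext ?_ rfl)
    simp only
    field_simp
    ring
  · rw [← coshSqDist_dilation (inv_pos.2 ht), inv_mul_cancel₀ ht.ne', ← hF,
      ← lintegral_geodesicRay hR, ← restrict_Ioo_eq_restrict_Icc]
    refine setLIntegral_congr_fun measurableSet_Ioo fun s hs => ?_
    rw [derivWithin_of_mem_nhds (Icc_mem_nhds hs.1 hs.2), (hasDerivAt_coordsAction x t
      (hasDerivAt_geodesicRay hR (Ioo_subset_Icc_self hs))).deriv, hypNormSq_coordsAction x ht]

end Geodesic

/-! ### Riemannian distances on manifolds with a global chart -/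

section GlobalChart

variable {E : Type*} [NormedAddCommGroup E] [NormedSpace ℝ E]

/-- The minimum c of G on the unit sphere gives c‖v‖² ≤ G(v, v); this is the boundedness demanded of
a Riemannian metric. -/
lemma isVonNBounded_of_pos [FiniteDimensional ℝ E] (G : E →L[ℝ] E →L[ℝ] ℝ)
    (hG : ∀ v, v ≠ 0 → 0 < G v v) : Bornology.IsVonNBounded ℝ {v : E | G v v < 1} := by
  obtain hE | hE := subsingleton_or_nontrivial E
  · exact (NormedSpace.isVonNBounded_iff ℝ).2 (Set.toFinite _).isBounded
  obtain ⟨v₀, hv₀, hmin⟩ := (isCompact_sphere (0 : E) 1).exists_isMinOn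
    (NormedSpace.sphere_nonempty.2 zero_le_one)
    (f := fun v => G v v) (G.continuous.clm_apply continuous_id).continuousOn
  have hc : 0 < G v₀ v₀ := hG v₀ (ne_zero_of_mem_unit_sphere ⟨v₀, hv₀⟩)
  have hle : ∀ v, G v₀ v₀ * ‖v‖ ^ 2 ≤ G v v := fun v => by
    rcases eq_or_ne v 0 with rfl | hv
    · simp
    have hn : 0 < ‖v‖ := norm_pos_iff.2 hv
    have h1 := hmin (show ‖v‖⁻¹ • v ∈ Metric.sphere (0 : E) 1 by
      rw [mem_sphere_zero_iff_norm, norm_smul, norm_inv, norm_norm, inv_mul_cancel₀ hn.ne'])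
    simp only [mem_ofPred_eq, map_smul, smul_apply, smul_eq_mul] at h1
    calc G v₀ v₀ * ‖v‖ ^ 2 ≤ ‖v‖⁻¹ * (‖v‖⁻¹ * G v v) * ‖v‖ ^ 2 := by gcongr
      _ = G v v := by field_simp
  rw [NormedSpace.isVonNBounded_iff, isBounded_iff_forall_norm_le]
  refine ⟨√(1 / G v₀ v₀), fun v hv => Real.le_sqrt_of_sq_le ?_⟩
  rw [le_div_iff₀ hc, mul_comm]
  exact (hle v).trans (show G v v < 1 from hv).le

variable {M : Type*} [TopologicalSpace M] [Nonempty M] {φ : M → E}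

/-- There is only one chart, so the tangent coordinate change is from that chart to itself. -/
lemma trivializationAt_symm_of_globalChart (hφ : Topology.IsOpenEmbedding φ) (p q : M) (v : E) :
    letI := hφ.singletonChartedSpace
    haveI := hφ.isManifold_singleton (I := 𝓘(ℝ, E)) (n := 1)
    (trivializationAt E (fun x : M => TangentSpace 𝓘(ℝ, E) x) p).symm q v = v := by
  let := hφ.singletonChartedSpace
  have := hφ.isManifold_singleton (I := 𝓘(ℝ, E)) (n := 1)
  have h := TangentBundle.symmL_trivializationAt_eq_core (I := 𝓘(ℝ, E)) (b₀ := p) (b := q)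
    (mem_chart_source E q)
  have h2 := congrArg (fun L : E →L[ℝ] E => L v) h
  exact (Bundle.Trivialization.symmL_apply _ (mem_chart_source E q) v).symm.trans (h2.trans
    ((tangentBundleCore 𝓘(ℝ, E) M).coordChange_self (achart E q) q (mem_chart_source E q) v))

/-- The bilinear form on the tangent spaces given, in a global chart, by a family of forms. -/
noncomputable def tangentFormOfGlobalChart (hφ : Topology.IsOpenEmbedding φ)
    (G : E → E →L[ℝ] E →L[ℝ] ℝ) (p : M) :
    letI := hφ.singletonChartedSpace
    TangentSpace 𝓘(ℝ, E) p →L[ℝ] TangentSpace 𝓘(ℝ, E) p →L[ℝ] ℝ :=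
  G (φ p)

/-- All trivialisations being the identity, smoothness of the section is smoothness of `G ∘ φ`. -/
lemma contMDiff_tangentFormOfGlobalChart (hφ : Topology.IsOpenEmbedding φ)
    (G : E → E →L[ℝ] E →L[ℝ] ℝ)
    (hG : ContDiffOn ℝ ∞ G (range φ)) :
    letI := hφ.singletonChartedSpace
    haveI := hφ.isManifold_singleton (I := 𝓘(ℝ, E)) (n := ∞)
    ContMDiff 𝓘(ℝ, E) (𝓘(ℝ, E).prod 𝓘(ℝ, E →L[ℝ] E →L[ℝ] ℝ)) ∞
      (fun p : M => Bundle.TotalSpace.mk' (E →L[ℝ] E →L[ℝ] ℝ)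
        (E := fun p : M => TangentSpace 𝓘(ℝ, E) p →L[ℝ] TangentSpace 𝓘(ℝ, E) p →L[ℝ] ℝ) p
        (tangentFormOfGlobalChart hφ G p)) := by
  let := hφ.singletonChartedSpace
  have := hφ.isManifold_singleton (I := 𝓘(ℝ, E)) (n := ∞)
  intro p
  rw [Bundle.contMDiffAt_section]
  have h1 : ContMDiffAt 𝓘(ℝ, E) 𝓘(ℝ, E →L[ℝ] E →L[ℝ] ℝ) ∞ (fun q => G (φ q)) p :=
    ((hG.contDiffAt (hφ.isOpen_range.mem_nhds (mem_range_self p))).contMDiffAt).comp p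
      (contMDiff_isOpenEmbedding hφ p)
  convert! h1 using 1
  ext q v w
  rw [hom_trivializationAt_apply]
  refine (inCoordinates_apply_eq₂ (mem_chart_source E q)
    (mem_chart_source E q) (mem_univ _)).trans ?_
  rw [trivializationAt_symm_of_globalChart hφ, trivializationAt_symm_of_globalChart hφ]
  simp
  rfl

/-- The Riemannian metric given, in a global chart, by a family of inner products. -/
noncomputable def riemannianMetricOfGlobalChart [FiniteDimensional ℝ E]
    (hφ : Topology.IsOpenEmbedding φ) (G : E → E →L[ℝ] E →L[ℝ] ℝ)
    (hsymm : ∀ x v w, G x v w = G x w v)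
    (hpos : ∀ x ∈ range φ, ∀ v, v ≠ 0 → 0 < G x v v) (hG : ContDiffOn ℝ ∞ G (range φ)) :
    letI := hφ.singletonChartedSpace
    haveI := hφ.isManifold_singleton (I := 𝓘(ℝ, E)) (n := ∞)
    Bundle.ContMDiffRiemannianMetric 𝓘(ℝ, E) ∞ E (fun x : M => TangentSpace 𝓘(ℝ, E) x) :=
  letI := hφ.singletonChartedSpace
  haveI := hφ.isManifold_singleton (I := 𝓘(ℝ, E)) (n := ∞)
  { inner := tangentFormOfGlobalChart hφ G
    symm := fun p v w => hsymm (φ p) v w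
    pos := fun p v hv => hpos (φ p) (mem_range_self p) v hv
    isVonNBounded := fun p => isVonNBounded_of_pos (G (φ p)) (hpos (φ p) (mem_range_self p))
    contMDiff := contMDiff_tangentFormOfGlobalChart hφ G hG }

/-- The derivative of a curve, read in a global chart. -/
lemma mfderivWithin_of_globalChart (hφ : Topology.IsOpenEmbedding φ) {γ : ℝ → M} {s : ℝ}
    {I : Set ℝ} :
    letI := hφ.singletonChartedSpace
    MDifferentiableWithinAt 𝓘(ℝ, ℝ) 𝓘(ℝ, E) γ I s →
      (mfderivWithin 𝓘(ℝ, ℝ) 𝓘(ℝ, E) γ I s : ℝ → E) 1 = derivWithin (φ ∘ γ) I s := by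
  let := hφ.singletonChartedSpace
  intro h
  have h1 : mfderivWithin 𝓘(ℝ, ℝ) 𝓘(ℝ, E) γ I s = fderivWithin ℝ (φ ∘ γ) I s := by
    simp only [mfderivWithin, h, mfld_simps]
    rfl
  rw [h1, ← fderivWithin_derivWithin]
  rfl

/-- A distance function is Riemannian if, in a global chart, it is a lower bound for the lengths
of curves and is the length of a curve. -/
theorem isRiemannianDistance_of_globalChart [FiniteDimensional ℝ E]
    (hφ : Topology.IsOpenEmbedding φ) (G : E → E →L[ℝ] E →L[ℝ] ℝ)
    (hsymm : ∀ x v w, G x v w = G x w v)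
    (hpos : ∀ x ∈ range φ, ∀ v, v ≠ 0 → 0 < G x v v) (hG : ContDiffOn ℝ ∞ G (range φ))
    {d : M → M → ℝ} (hd : ∀ p q, 0 ≤ d p q)
    (hlower : ∀ p q (c : ℝ → E), ContDiffOn ℝ 1 c (Icc 0 1) → (∀ s ∈ Icc (0 : ℝ) 1, c s ∈ range φ) →
      c 0 = φ p → c 1 = φ q → ENNReal.ofReal (d p q) ≤ ∫⁻ s in Icc (0 : ℝ) 1,
        ENNReal.ofReal √(G (c s) (derivWithin c (Icc 0 1) s) (derivWithin c (Icc 0 1) s)))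
    (hupper : ∀ p q, ∃ c : ℝ → E, ContDiffOn ℝ 1 c (Icc 0 1) ∧
      (∀ s ∈ Icc (0 : ℝ) 1, c s ∈ range φ) ∧ c 0 = φ p ∧ c 1 = φ q ∧ ∫⁻ s in Icc (0 : ℝ) 1,
        ENNReal.ofReal √(G (c s) (derivWithin c (Icc 0 1) s) (derivWithin c (Icc 0 1) s)) ≤
        ENNReal.ofReal (d p q)) :
    letI := hφ.singletonChartedSpace
    haveI := hφ.isManifold_singleton (I := 𝓘(ℝ, E)) (n := ∞)
    IsRiemannianDistance (E := E) d := by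
  let := hφ.singletonChartedSpace
  have := hφ.isManifold_singleton (I := 𝓘(ℝ, E)) (n := ∞)
  let g := riemannianMetricOfGlobalChart hφ G hsymm hpos hG
  refine ⟨g, ?_⟩
  let : Bundle.RiemannianBundle (fun x : M => TangentSpace 𝓘(ℝ, E) x) := ⟨g.toRiemannianMetric⟩
  have hnorm : ∀ (p : M) (v : TangentSpace 𝓘(ℝ, E) p),
      ‖v‖ₑ = ENNReal.ofReal √(G (φ p) (v : E) (v : E)) := fun p v => by
    rw [← ofReal_norm, norm_eq_sqrt_real_inner]
    rfl
  have hlength : ∀ γ : ℝ → M, ContMDiffOn 𝓘(ℝ, ℝ) 𝓘(ℝ, E) 1 γ (Icc 0 1) →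
      pathELength 𝓘(ℝ, E) γ 0 1 = ∫⁻ s in Icc (0 : ℝ) 1, ENNReal.ofReal
        √(G ((φ ∘ γ) s) (derivWithin (φ ∘ γ) (Icc 0 1) s) (derivWithin (φ ∘ γ) (Icc 0 1) s)) := by
    intro γ hγ
    rw [pathELength_eq_lintegral_mfderivWithin_Icc]
    refine setLIntegral_congr_fun measurableSet_Icc fun s hs => ?_
    have := mfderivWithin_of_globalChart hφ ((hγ s hs).mdifferentiableWithinAt one_ne_zero)
    rw [← this]
    exact hnorm _ _
  intro p q
  refine ⟨hd p q, le_antisymm ?_ ?_⟩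
  · obtain ⟨c, hc, hrange, h0, h1, hle⟩ := hupper p q
    refine le_trans ?_ hle
    -- The minimising curve is given in coordinates and is lifted to the manifold by the inverse
    -- chart.
    let ψ := (hφ.toOpenPartialHomeomorph φ).symm
    have hψ : ∀ p, ψ (φ p) = p := fun p => hφ.toOpenPartialHomeomorph_left_inv
    have hψ' : ∀ s ∈ Icc (0 : ℝ) 1, φ (ψ (c s)) = c s := fun s hs =>
      hφ.toOpenPartialHomeomorph_right_inv φ (hrange s hs)
    have hγ : ContMDiffOn 𝓘(ℝ, ℝ) 𝓘(ℝ, E) 1 (ψ ∘ c) (Icc 0 1) :=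
      (contMDiffOn_isOpenEmbedding_symm hφ).comp hc.contMDiffOn hrange
    refine (riemannianEDist_le_pathELength hγ (by simp [h0, hψ]) (by simp [h1, hψ])
      zero_le_one).trans ?_
    rw [hlength _ hγ]
    refine le_of_eq (setLIntegral_congr_fun measurableSet_Icc fun s hs => ?_)
    have e1 : (φ ∘ ψ ∘ c) s = c s := hψ' s hs
    have e2 : derivWithin (φ ∘ ψ ∘ c) (Icc 0 1) s = derivWithin c (Icc 0 1) s :=
      derivWithin_congr hψ' e1
    rw [e1, e2]
  · refine le_of_forall_gt fun r hr => ?_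
    obtain ⟨γ, h0, h1, hγ, hlt⟩ := exists_lt_of_riemannianEDist_lt hr
    refine lt_of_le_of_lt ?_ hlt
    rw [hlength γ hγ]
    refine hlower p q (φ ∘ γ) ?_ (fun s _ => mem_range_self _) (by simp [h0]) (by simp [h1])
    exact ((contMDiff_isOpenEmbedding hφ).comp_contMDiffOn hγ).contDiffOn

end GlobalChart

/-! ### The metric similarity space -/

section SimilaritySpace

variable {m : ℕ}

lemma ContDiffOn.smul_add_smul {E F : Type*} [NormedAddCommGroup E] [NormedSpace ℝ E]
    [NormedAddCommGroup F] [NormedSpace ℝ F] {n : WithTop ℕ∞} {s : Set E} {a b : E → ℝ}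
    {f g : E → F} (ha : ContDiffOn ℝ n a s) (hf : ContDiffOn ℝ n f s) (hb : ContDiffOn ℝ n b s)
    (hg : ContDiffOn ℝ n g s) : ContDiffOn ℝ n (fun x => a x • f x + b x • g x) s :=
  (ha.smul hf).add (hb.smul hg)

/-- Linear in the base point, on a finite-dimensional space. -/
lemma Heis.contDiff_hermImCLM : ContDiff ℝ ∞ (Heis.hermImCLM (m := m)) :=
  (LinearMap.toContinuousLinearMap
    { toFun := Heis.hermImCLM (m := m)
      map_add' := fun x y => by ext w; simp [Heis.herm_add_left]
      map_smul' := fun r x => by ext w; simp [Heis.herm_smul_left] }).contDiff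

/-- The contact form `du - 2 Im ⟨ζ, dζ⟩`. -/
noncomputable def contactForm (x : EuclideanSpace ℂ (Fin m) × ℝ × ℝ) :
    EuclideanSpace ℂ (Fin m) × ℝ × ℝ →L[ℝ] ℝ :=
  (ContinuousLinearMap.fst ℝ ℝ ℝ).comp (ContinuousLinearMap.snd ℝ _ _) -
    (2 : ℝ) • (Heis.hermImCLM x.1).comp (ContinuousLinearMap.fst ℝ _ _)

/-- The differential of the height. -/
noncomputable def heightForm (m : ℕ) : EuclideanSpace ℂ (Fin m) × ℝ × ℝ →L[ℝ] ℝ :=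
  (ContinuousLinearMap.snd ℝ ℝ ℝ).comp (ContinuousLinearMap.snd ℝ _ _)

/-- The complex hyperbolic metric in horospherical coordinates. -/
noncomputable def hypForm (x : EuclideanSpace ℂ (Fin m) × ℝ × ℝ) :
    EuclideanSpace ℂ (Fin m) × ℝ × ℝ →L[ℝ] EuclideanSpace ℂ (Fin m) × ℝ × ℝ →L[ℝ] ℝ :=
  (x.2.2 ^ 2)⁻¹ • ((innerSL ℝ).bilinearComp (ContinuousLinearMap.fst ℝ _ _)
    (ContinuousLinearMap.fst ℝ _ _) + (heightForm m).smulRight (heightForm m)) +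
    (4 * x.2.2 ^ 4)⁻¹ • (contactForm x).smulRight (contactForm x)

lemma hypForm_apply (x v w : EuclideanSpace ℂ (Fin m) × ℝ × ℝ) : hypForm x v w =
    (x.2.2 ^ 2)⁻¹ * (inner ℝ v.1 w.1 + v.2.2 * w.2.2) + (4 * x.2.2 ^ 4)⁻¹ *
      ((v.2.1 - 2 * (Heis.herm x.1 v.1).im) * (w.2.1 - 2 * (Heis.herm x.1 w.1).im)) := by
  simp [hypForm, contactForm, heightForm, mul_add]

lemma hypForm_self (x v : EuclideanSpace ℂ (Fin m) × ℝ × ℝ) : hypForm x v v = hypNormSq x v := by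
  rw [hypForm_apply, hypNormSq, real_inner_self_eq_norm_sq]
  ring

lemma hypForm_symm (x v w : EuclideanSpace ℂ (Fin m) × ℝ × ℝ) : hypForm x v w = hypForm x w v := by
  rw [hypForm_apply, hypForm_apply, real_inner_comm]
  ring

lemma hypForm_pos {x : EuclideanSpace ℂ (Fin m) × ℝ × ℝ} (hx : 0 < x.2.2)
    (v : EuclideanSpace ℂ (Fin m) × ℝ × ℝ) (hv : v ≠ 0) : 0 < hypForm x v v := by
  rw [hypForm_self]
  refine (hypNormSq_nonneg x v).lt_of_ne' fun h => hv ?_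
  rw [hypNormSq, add_eq_zero_iff_of_nonneg (by positivity) (by positivity), div_eq_zero_iff,
    div_eq_zero_iff, or_iff_left (by positivity), or_iff_left (by positivity),
    add_eq_zero_iff_of_nonneg (by positivity) (by positivity)] at h
  obtain ⟨⟨h1, h2⟩, h3⟩ := h
  have h1' : v.1 = 0 := by simpa using h1
  have h2' : v.2.2 = 0 := by simpa using h2
  rw [h1', Heis.herm_zero_right] at h3
  exact Prod.ext h1' (Prod.ext (by simpa using h3) h2')

lemma contDiffOn_hypForm :
    ContDiffOn ℝ ∞ (hypForm (m := m)) {x | 0 < x.2.2} := by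
  have hA : ContDiff ℝ ∞ (contactForm (m := m)) :=
    contDiff_const.sub
      (((Heis.contDiff_hermImCLM.comp contDiff_fst).clm_comp contDiff_const).const_smul (2 : ℝ))
  have ht : ContDiff ℝ ∞ fun x : EuclideanSpace ℂ (Fin m) × ℝ × ℝ => x.2.2 :=
    contDiff_snd.comp contDiff_snd
  refine ((ht.pow 2).contDiffOn.inv fun x hx => ?_).smul_add_smul contDiffOn_const
    ((contDiff_const.mul (ht.pow 4)).contDiffOn.inv fun x hx => ?_) (hA.smulRight hA).contDiffOn
  · exact pow_ne_zero 2 (ne_of_gt hx)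
  · exact mul_ne_zero four_ne_zero (pow_ne_zero 4 (ne_of_gt hx))

/-- Symmetry of the distance, used to match q⁻¹p with the displacement x⁻¹y from the start of a
curve to its end. -/
lemma coshSqDist_inv (x : Heis m) (t t' : ℝ) : coshSqDist x⁻¹ t t' = coshSqDist x t' t := by
  simp only [coshSqDist, Heis.inv_ζ, Heis.inv_u, norm_neg, neg_sq]
  congr 1 <;> ring

lemma range_heisPlusCoords : range (heisPlusCoords (m := m)) = {x | 0 < x.2.2} := by
  ext x
  exact ⟨by rintro ⟨p, rfl⟩; exact p.2.2, fun hx => ⟨(⟨x.1, x.2.1⟩, ⟨x.2.2, hx⟩), rfl⟩⟩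

instance : Nonempty (Heis m × PosReal) := ⟨(1, ⟨1, mem_Ioi.2 one_pos⟩)⟩

variable [MetricSpace (Heis m)]

lemma Heis.IsHomogeneousMetric.isOpenEmbedding_heisPlusCoords (h : Heis.IsHomogeneousMetric m) :
    Topology.IsOpenEmbedding (heisPlusCoords (m := m)) := by
  let f : Heis m ≃ₜ EuclideanSpace ℂ (Fin m) × ℝ :=
    { toFun := Heis.coords
      invFun := fun p => ⟨p.1, p.2⟩
      left_inv := fun _ => rfl
      right_inv := fun _ => rfl
      continuous_toFun := h.continuous_coords
      continuous_invFun := h.continuous_mk }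
  exact (Homeomorph.prodAssoc _ _ _).isOpenEmbedding.comp
    (f.isOpenEmbedding.prodMap isOpen_Ioi.isOpenEmbedding_subtypeVal)

lemma Heis.IsHomogeneousMetric.isRiemannianDistance_hypDist (h : Heis.IsHomogeneousMetric m) :
    letI := h.isOpenEmbedding_heisPlusCoords.singletonChartedSpace
    haveI := h.isOpenEmbedding_heisPlusCoords.isManifold_singleton
      (I := 𝓘(ℝ, EuclideanSpace ℂ (Fin m) × ℝ × ℝ)) (n := ∞)
    IsRiemannianDistance (E := EuclideanSpace ℂ (Fin m) × ℝ × ℝ)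
      (fun p q : Heis m × PosReal =>
        NegativePoints.hypDist (horosphericalSqrt p) (horosphericalSqrt q)) := by
  have hd : ∀ p q : Heis m × PosReal,
      NegativePoints.hypDist (horosphericalSqrt p) (horosphericalSqrt q) =
        Real.arcosh √(coshSqDist (p.1⁻¹ * q.1) q.2 p.2) := fun p q => by
    rw [hypDist_horosphericalSqrt, ← coshSqDist_inv, mul_inv_rev, inv_inv]
  refine isRiemannianDistance_of_globalChart h.isOpenEmbedding_heisPlusCoords hypForm
    hypForm_symm ?_ ?_ ?_ ?_ ?_
  · rw [range_heisPlusCoords]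
    exact fun x hx => hypForm_pos hx
  · rw [range_heisPlusCoords]
    exact contDiffOn_hypForm
  · intro p q
    rw [hd]
    exact Real.arcosh_nonneg (Real.one_le_sqrt.2 (one_le_coshSqDist _ q.2.2 p.2.2))
  · intro p q c hc hrange h0 h1
    rw [range_heisPlusCoords] at hrange
    rw [hd]
    simp only [hypForm_self]
    exact ofReal_arcosh_coshSqDist_le hc hrange h0 h1
  · intro p q
    obtain ⟨c, hc, hpos, h0, h1, heq⟩ := exists_contDiffOn_lintegral_eq p.1 q.1 p.2.2 q.2.2
    refine ⟨c, hc, by rwa [range_heisPlusCoords], h0, h1, ?_⟩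
    rw [hd]
    simp only [hypForm_self]
    exact heq.le

end SimilaritySpace

theorem mainTheorem8 (m : ℕ) (hm : 1 ≤ m)
    (B : LinearMap.BilinForm ℝ (EuclideanSpace ℂ (Fin m)))
    (hB_symm : ∀ v w, B v w = B w v) (hB_pos : ∀ v, v ≠ 0 → 0 < B v v) :
    Function.Bijective (horosphericalSqrt (m := m)) ∧
    ∃ M : MetricSpace (Heis m),
      (∀ x y : Heis m, edist x y = Heis.ccEDist B x y) ∧
      ∃ (cs : ChartedSpace (EuclideanSpace ℂ (Fin m) × ℝ × ℝ) (Heis m × PosReal))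
        (mfd : IsManifold 𝓘(ℝ, EuclideanSpace ℂ (Fin m) × ℝ × ℝ) ∞ (Heis m × PosReal)),
        (∃ e ∈ IsManifold.maximalAtlas 𝓘(ℝ, EuclideanSpace ℂ (Fin m) × ℝ × ℝ) ∞
            (Heis m × PosReal), e.source = univ ∧ ∀ p, e p = heisPlusCoords p) ∧
        ∃ K : Set (Heis m),
          IsMetricSimilaritySpace (2 * m + 1) (Heis.integerLattice m) (Heis.dilation 2) 2 K
            (E := EuclideanSpace ℂ (Fin m) × ℝ × ℝ)
            (fun p q => NegativePoints.hypDist (horosphericalSqrt p) (horosphericalSqrt q)) := by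
  refine ⟨bijective_horosphericalSqrt, Heis.ccMetricSpace hm hB_pos, fun x y => rfl, ?_⟩
  let := Heis.ccMetricSpace hm hB_pos
  -- From here on the inner product `B` enters only through these properties of the metric.
  have h : Heis.IsHomogeneousMetric m :=
    Heis.isHomogeneousMetric_of_edist_eq (B := B) (fun x y => rfl) hm hB_pos
  have hφ := h.isOpenEmbedding_heisPlusCoords
  let cs := hφ.singletonChartedSpace
  have mfd := hφ.isManifold_singleton
    (I := 𝓘(ℝ, EuclideanSpace ℂ (Fin m) × ℝ × ℝ)) (n := ∞)
  refine ⟨cs, mfd, ⟨hφ.toOpenPartialHomeomorph _,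
    IsManifold.chart_mem_maximalAtlas (1, ⟨1, mem_Ioi.2 one_pos⟩), rfl, fun p => rfl⟩, Heis.tile m, ?_⟩
  refine ⟨h.isStackedTiling, ?_, h.isRiemannianDistance_hypDist,
    fun g p q => hypDist_smul g.1 p q, fun ha p q => hypDist_dilation ha p q⟩
  rw [Module.finrank_prod, Module.finrank_prod, finrank_real_of_complex, finrank_euclideanSpace]
  simp
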